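/- Let $k$ be a field and let $H$ be a finite dimensional Hopf algebra over $k$ with bijective antipode $S$. Let $A$ be a right $H$-comodule algebra with coaction $a\mapsto\sum a_0\otimes a_1$ and coinvariant subalgebra $B=A^{coH}=\{a\in A : \sum a_0\otimes a_1=a\otimes 1\}$, and assume that $A/B$ is $H$-Galois, i.e. that the canonical map $\beta:A\otimes_BA\to A\otimes_k H$, $\beta(x\otimes y)=\sum xy_0\otimes y_1$, is bijective. Let $D(A)$, $D(B)$ be the derived categories of complexes of right $A$-modules and right $B$-modules, and let $M\in D^-(A)$, regarded also as an object of $D(B)$ by restriction. For an object $X$ of $D(A)$ or $D(B)$, $\operatorname{Ext}^*(X,X)=\bigoplus_{i\in\mathbb Z}\operatorname{Hom}(X,X[i])$ is a graded $k$-algebra under the Yoneda product. (i) There is a unique left $H$-module algebra structure on $\operatorname{Ext}^*_B(M,M)$ such that, for every bounded above complex $P$ of projective right $A$-modules, every isomorphism $P\cong M$ in $D(A)$, every $h\in H$, every $n\in\mathbb Z$ and every degree $n$ cocycle $f$ of the complex $\operatorname{Hom}_B(P,P)$, one has $h\cdot[f]=[h\cdot f]$, where $[\,\cdot\,]$ is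 the class in $\operatorname{Hom}_{D(B)}(P,P[n])\cong\operatorname{Hom}_{D(B)}(M,M[n])$ and $$(h\cdot f)(p)=\sum_i f(pX_i)Y_i,\qquad \sum_i X_i\otimes Y_i=\beta^{-1}(1\otimes S(h)).$$ This action preserves degrees. (ii) Let $\operatorname{Ext}^*_B(M,M)\#H$ be the corresponding smash product, i.e. $\operatorname{Ext}^*_B(M,M)\otimes_k H$ with the multiplication $(x\# h)(y\# g)=\sum x(h_{1}\cdot y)\# h_{2}g$, graded with $H$ in degree $0$. Then there is an isomorphism of graded $k$-algebras $$\operatorname{Ext}^*_A(M\otimes^L_BA,\;M\otimes^L_BA)\;\cong\;\operatorname{Ext}^*_B(M,M)\# H,$$ where $M\otimes_B^LA$ is the object $Q\otimes_BA$ of $D(A)$ for any bounded above complex $Q$ of projective right $B$-modules isomorphic to $M$ in $D(B)$. -/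

import Mathlib

universe v₁ v₂ v₃ u w₁ w₂

namespace HopfGalois

open CategoryTheory TensorProduct DirectSum

section ModuleAlgebra

/-- A left `H`-module algebra structure on the `k`-algebra `E`: a left `H`-module structure `h · x`
such that `h · 1 = ε(h) 1` and `h · (x y) = ∑ (h₁ · x) (h₂ · y)`. -/
structure HopfModuleAlgebra (k : Type v₁) (H : Type v₂) (E : Type v₃) [Field k] [Ring H] [HopfAlgebra k H]
    [Ring E] [Algebra k E] where
  act : H →ₐ[k] Module.End k E
  act_one : ∀ h : H, act h 1 = algebraMap k E (Coalgebra.counit h)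
  act_mul : ∀ (h : H) (x y : E), act h (x * y) =
    LinearMap.mul' k E (TensorProduct.map (act.toLinearMap.flip x) (act.toLinearMap.flip y)
      (Coalgebra.comul h))

variable {k : Type v₁} {H : Type v₂} {E : Type v₃} [Field k] [Ring H] [HopfAlgebra k H]
    [Ring E] [Algebra k E]

/-- The smash product `E # H`: the vector space `E ⊗ H` with the multiplication
`(x # h) (y # g) = ∑ x (h₁ · y) # h₂ g` and unit `1 # 1` (see the `Ring` instance below). -/
def SmashProduct (_α : HopfModuleAlgebra k H E) : Type (max v₂ v₃) := E ⊗[k] H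

namespace SmashProduct

variable (α : HopfModuleAlgebra k H E)

noncomputable instance : AddCommGroup (SmashProduct α) := inferInstanceAs (AddCommGroup (E ⊗[k] H))
noncomputable instance : Module k (SmashProduct α) := inferInstanceAs (Module k (E ⊗[k] H))

/-- The map `y ⊗ g ↦ ∑ x (h₁ · y) ⊗ h₂ g`. -/
noncomputable def mulAux (x : E) (h : H) : E ⊗[k] H →ₗ[k] E ⊗[k] H :=
  TensorProduct.lift <| LinearMap.mk₂ k
    (fun y g => TensorProduct.map (LinearMap.mulLeft k x ∘ₗ α.act.toLinearMap.flip y)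
      (LinearMap.mulRight k g) (Coalgebra.comul h))
    (fun y y' g => by
      rw [map_add, LinearMap.comp_add, TensorProduct.map_add_left, LinearMap.add_apply])
    (fun c y g => by
      rw [map_smul, LinearMap.comp_smul, TensorProduct.map_smul_left, LinearMap.smul_apply])
    (fun y g g' => by
      have : LinearMap.mulRight k (g + g') = LinearMap.mulRight k g + LinearMap.mulRight k g' := by
        ext; simp [mul_add]
      rw [this, TensorProduct.map_add_right, LinearMap.add_apply])
    (fun c y g => by
      have : LinearMap.mulRight k (c • g) = c • LinearMap.mulRight k g := by
        ext; simp
      rw [this, TensorProduct.map_smul_right, LinearMap.smul_apply])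

theorem mulAux_tmul (x y : E) (h g : H) : mulAux α x h (y ⊗ₜ g) =
    TensorProduct.map (LinearMap.mulLeft k x ∘ₗ α.act.toLinearMap.flip y)
      (LinearMap.mulRight k g) (Coalgebra.comul h) := by
  simp [mulAux]

/-- The multiplication `(x # h) (y # g) = ∑ x (h₁ · y) # h₂ g`, as a bilinear map. -/
noncomputable def mulₗ : E ⊗[k] H →ₗ[k] E ⊗[k] H →ₗ[k] E ⊗[k] H :=
  TensorProduct.lift <| LinearMap.mk₂ k (mulAux α)
    (fun x x' h => by
      have e : LinearMap.mulLeft k (x + x') = LinearMap.mulLeft k x + LinearMap.mulLeft k x' := by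
        ext; simp [add_mul]
      refine TensorProduct.ext' fun y g => ?_
      rw [LinearMap.add_apply, mulAux_tmul, mulAux_tmul, mulAux_tmul, e, LinearMap.add_comp,
        TensorProduct.map_add_left, LinearMap.add_apply])
    (fun c x h => by
      have e : LinearMap.mulLeft k (c • x) = c • LinearMap.mulLeft k x := by
        ext; simp
      refine TensorProduct.ext' fun y g => ?_
      rw [LinearMap.smul_apply, mulAux_tmul, mulAux_tmul, e, LinearMap.smul_comp,
        TensorProduct.map_smul_left, LinearMap.smul_apply])
    (fun x h h' => TensorProduct.ext' fun y g => by
      rw [LinearMap.add_apply, mulAux_tmul, mulAux_tmul, mulAux_tmul, map_add, map_add])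
    (fun c x h => TensorProduct.ext' fun y g => by
      rw [LinearMap.smul_apply, mulAux_tmul, mulAux_tmul, map_smul, map_smul])

theorem mulₗ_tmul_tmul (x y : E) (h g : H) : mulₗ α (x ⊗ₜ h) (y ⊗ₜ g) =
    TensorProduct.map (LinearMap.mulLeft k x ∘ₗ α.act.toLinearMap.flip y)
      (LinearMap.mulRight k g) (Coalgebra.comul h) := by
  simp [mulₗ, mulAux_tmul]

theorem mulₗ_assoc (s t r : E ⊗[k] H) : mulₗ α (mulₗ α s t) r = mulₗ α s (mulₗ α t r) := by
  induction s using TensorProduct.induction_on with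
  | zero => simp
  | add s s' h1 h2 => simp only [map_add, LinearMap.add_apply, h1, h2]
  | tmul x h =>
  induction t using TensorProduct.induction_on with
  | zero => simp
  | add s s' h1 h2 => simp only [map_add, LinearMap.add_apply, h1, h2]
  | tmul y g =>
  induction r using TensorProduct.induction_on with
  | zero => simp
  | add s s' h1 h2 => simp only [map_add, h1, h2]
  | tmul z l =>
  let 𝓖 := Coalgebra.Repr.arbitrary k g
  -- the trilinear expression `a ⊗ (b ⊗ c) ↦ x (a · y) (b u · z) ⊗ c v l`
  let G : H → H → H ⊗[k] (H ⊗[k] H) →ₗ[k] E ⊗[k] H := fun u v =>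
    TensorProduct.map (LinearMap.mulLeft k x ∘ₗ LinearMap.mul' k E) LinearMap.id ∘ₗ
      (TensorProduct.assoc k E E H).symm.toLinearMap ∘ₗ
      TensorProduct.map (α.act.toLinearMap.flip y)
        (TensorProduct.map (α.act.toLinearMap.flip z ∘ₗ LinearMap.mulRight k u)
          (LinearMap.mulRight k (v * l)))
  have hG (u v a b c : H) : G u v (a ⊗ₜ (b ⊗ₜ c)) =
      (x * (α.act a y * α.act (b * u) z)) ⊗ₜ (c * (v * l)) := by
    simp [G, mul_assoc]
  have h1 : mulₗ α (mulₗ α (x ⊗ₜ h) (y ⊗ₜ g)) (z ⊗ₜ l) = ∑ i ∈ 𝓖.index,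
      G (𝓖.left i) (𝓖.right i) (TensorProduct.map LinearMap.id Coalgebra.comul
        (Coalgebra.comul (R := k) h)) := by
    rw [mulₗ_tmul_tmul]
    generalize Coalgebra.comul (R := k) h = d
    induction d using TensorProduct.induction_on with
    | zero => simp
    | add s s' h1 h2 =>
      simp only [map_add, LinearMap.add_apply, h1, h2, Finset.sum_add_distrib]
    | tmul a b =>
      simp only [TensorProduct.map_tmul, LinearMap.id_coe, id, LinearMap.comp_apply,
        LinearMap.mulRight_apply, LinearMap.mulLeft_apply, LinearMap.flip_apply,
        AlgHom.toLinearMap_apply, mulₗ_tmul_tmul, Bialgebra.comul_mul]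
      rw [← 𝓖.eq]
      generalize Coalgebra.comul (R := k) b = d
      induction d using TensorProduct.induction_on with
      | zero => simp
      | add s s' h1 h2 =>
        simp only [add_mul, TensorProduct.tmul_add, map_add, h1, h2, Finset.sum_add_distrib]
      | tmul b c =>
        simp [Finset.mul_sum, hG, mul_assoc]
  have h2 : mulₗ α (x ⊗ₜ h) (mulₗ α (y ⊗ₜ g) (z ⊗ₜ l)) = ∑ i ∈ 𝓖.index,
      G (𝓖.left i) (𝓖.right i) (TensorProduct.assoc k H H H
        (TensorProduct.map Coalgebra.comul LinearMap.id (Coalgebra.comul (R := k) h))) := by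
    rw [mulₗ_tmul_tmul α y z, ← 𝓖.eq, map_sum, map_sum]
    refine Finset.sum_congr rfl fun i _ => ?_
    rw [TensorProduct.map_tmul, mulₗ_tmul_tmul]
    generalize Coalgebra.comul (R := k) h = d
    induction d using TensorProduct.induction_on with
    | zero => simp
    | add s s' h1 h2 => simp only [map_add, h1, h2]
    | tmul a c =>
      simp only [TensorProduct.map_tmul, LinearMap.id_coe, id, LinearMap.comp_apply,
        LinearMap.mulRight_apply, LinearMap.mulLeft_apply, LinearMap.flip_apply,
        AlgHom.toLinearMap_apply, α.act_mul]
      generalize Coalgebra.comul (R := k) a = d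
      induction d using TensorProduct.induction_on with
      | zero => simp
      | add s s' h1 h2 =>
        simp only [map_add, mul_add, TensorProduct.add_tmul, h1, h2]
      | tmul a b =>
        simp [hG]
  rw [h1, h2]
  have := Coalgebra.coassoc_apply (R := k) h
  simp only [LinearMap.rTensor, LinearMap.lTensor] at this
  rw [this]

theorem one_mulₗ (t : E ⊗[k] H) : mulₗ α (1 ⊗ₜ 1) t = t := by
  induction t using TensorProduct.induction_on with
  | zero => simp
  | add s s' h1 h2 => simp only [map_add, h1, h2]
  | tmul y g => simp [mulₗ_tmul_tmul, Algebra.TensorProduct.one_def]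

theorem mulₗ_one (t : E ⊗[k] H) : mulₗ α t (1 ⊗ₜ 1) = t := by
  induction t using TensorProduct.induction_on with
  | zero => simp
  | add s s' h1 h2 => simp only [map_add, LinearMap.add_apply, h1, h2]
  | tmul x h =>
    let 𝓖 := Coalgebra.Repr.arbitrary k h
    rw [mulₗ_tmul_tmul, ← 𝓖.eq]
    have := Coalgebra.sum_counit_smul 𝓖
    conv_rhs => rw [← this]
    simp [α.act_one, Algebra.algebraMap_eq_smul_one, TensorProduct.tmul_sum, TensorProduct.smul_tmul]

noncomputable instance : Ring (SmashProduct α) :=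
  { (inferInstance : AddCommGroup (SmashProduct α)) with
    mul := fun s t => mulₗ α s t
    one := (1 ⊗ₜ 1 : E ⊗[k] H)
    left_distrib := fun s t r => map_add (mulₗ α s) t r
    right_distrib := fun s t r => LinearMap.congr_fun (map_add (mulₗ α) s t) r
    zero_mul := fun t => LinearMap.congr_fun (map_zero (mulₗ α)) t
    mul_zero := fun s => map_zero (mulₗ α s)
    mul_assoc := mulₗ_assoc α
    one_mul := one_mulₗ α
    mul_one := mulₗ_one α }

noncomputable instance : Algebra k (SmashProduct α) :=
  Algebra.ofModule
    (fun c s t => LinearMap.congr_fun (map_smul (mulₗ α) c s) t)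
    (fun c s t => map_smul (mulₗ α s) c t)

/-- The part of `E # H` coming from a subspace `V` of `E`: the image of `V ⊗ H`. Applied to the
components of a grading of `E`, it gives the grading of `E # H` for which `H` has degree zero. -/
noncomputable def part (V : Submodule k E) : Submodule k (SmashProduct α) :=
  LinearMap.range (M₂ := SmashProduct α) (TensorProduct.map V.subtype (LinearMap.id (R := k) (M := H)))

end SmashProduct
end ModuleAlgebra


section Ext

variable {C : Type u} [Category.{v₁} C] [HasShift C ℤ]

theorem sigma_comp_eq {X Y Z : C} {a b c c' : ℤ} (f : ShiftedHom X Y a) (g : ShiftedHom Y Z b)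
    (f' : ShiftedHom X Z c') (h : b + a = c) (hc : c = c') (hf : f.comp g (h.trans hc) = f') :
    GradedMonoid.mk (A := fun i : ℤ => ShiftedHom X Z i) c (f.comp g h) = GradedMonoid.mk c' f' := by
  subst hc
  exact congrArg _ hf

/-- The Yoneda product `f * g = f[j] ∘ g` of `f : X ⟶ X[i]` and `g : X ⟶ X[j]`. -/
noncomputable instance gMul (X : C) : GradedMonoid.GMul (fun i : ℤ => ShiftedHom X X i) where
  mul f g := ShiftedHom.comp g f rfl

noncomputable instance gOne (X : C) : GradedMonoid.GOne (fun i : ℤ => ShiftedHom X X i) where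
  one := ShiftedHom.mk₀ 0 rfl (𝟙 X)

noncomputable instance gMonoid (X : C) : GradedMonoid.GMonoid (fun i : ℤ => ShiftedHom X X i) where
  one_mul := fun ⟨_, f⟩ =>
    sigma_comp_eq f _ f rfl (zero_add _) (ShiftedHom.comp_mk₀_id f 0 rfl)
  mul_one := fun ⟨_, f⟩ =>
    sigma_comp_eq _ f f rfl (add_zero _) (ShiftedHom.mk₀_id_comp 0 rfl f)
  mul_assoc := fun ⟨a, f⟩ ⟨b, g⟩ ⟨c, h⟩ =>
    sigma_comp_eq h (g.comp f rfl) ((h.comp g rfl).comp f rfl) rfl (add_assoc a b c)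
      (ShiftedHom.comp_assoc h g f rfl rfl (add_assoc a b c)).symm

variable [Preadditive C] [∀ n : ℤ, (shiftFunctor C n).Additive]

noncomputable instance gRing (X : C) : DirectSum.GRing (fun i : ℤ => ShiftedHom X X i) where
  __ := gMonoid X
  mul_zero _ := ShiftedHom.zero_comp _ _ _ _
  zero_mul _ := ShiftedHom.comp_zero _ _ _
  mul_add _ _ _ := ShiftedHom.add_comp _ _ _ _
  add_mul _ _ _ := ShiftedHom.comp_add _ _ _ _
  natCast n := n • ShiftedHom.mk₀ 0 rfl (𝟙 X)
  natCast_zero := zero_smul _ _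
  natCast_succ _ := succ_nsmul _ _
  intCast n := n • ShiftedHom.mk₀ 0 rfl (𝟙 X)
  intCast_ofNat _ := natCast_zsmul _ _
  intCast_negSucc_ofNat _ := negSucc_zsmul _ _

variable (k : Type v₂) [Field k] [Linear k C] [∀ n : ℤ, Functor.Linear k (shiftFunctor C n)]

noncomputable instance gAlgebra (X : C) : DirectSum.GAlgebra k (fun i : ℤ => ShiftedHom X X i) where
  toFun := (LinearMap.toSpanSingleton k (ShiftedHom X X (0 : ℤ))
    (ShiftedHom.mk₀ 0 rfl (𝟙 X))).toAddMonoidHom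
  map_one := one_smul _ _
  map_mul _ _ := (sigma_comp_eq _ _ _ rfl (add_zero 0) (by simp [mul_smul])).symm
  commutes := fun r ⟨i, f⟩ => by
    have h1 := sigma_comp_eq f (r • ShiftedHom.mk₀ 0 rfl (𝟙 X)) (r • f) rfl (zero_add i) (by simp)
    have h2 := sigma_comp_eq (r • ShiftedHom.mk₀ 0 rfl (𝟙 X)) f (r • f) rfl (add_zero i) (by simp)
    exact h1.trans h2.symm
  smul_def := fun r ⟨i, f⟩ => by
    have h1 := sigma_comp_eq f (r • ShiftedHom.mk₀ 0 rfl (𝟙 X)) (r • f) rfl (zero_add i) (by simp)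
    exact h1.symm

/-- The graded algebra `Ext^*(X, X) = ⨁ i, Hom(X, X[i])` with the Yoneda product, for an object `X`
of a category with shift such as a derived category. -/
def YonedaExt (X : C) : Type v₁ := ⨁ i : ℤ, ShiftedHom X X i

noncomputable instance (X : C) : Ring (YonedaExt X) :=
  inferInstanceAs (Ring (⨁ i : ℤ, ShiftedHom X X i))

noncomputable instance (X : C) : Algebra k (YonedaExt X) :=
  inferInstanceAs (Algebra k (⨁ i : ℤ, ShiftedHom X X i))

/-- The inclusion of `Hom(X, X[i])` in `Ext^*(X, X)`. -/
noncomputable def YonedaExt.of (X : C) (i : ℤ) : ShiftedHom X X i →ₗ[k] YonedaExt X :=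
  DirectSum.lof k ℤ (fun i : ℤ => ShiftedHom X X i) i

/-- The component of degree `i` of `Ext^*(X, X)`. -/
noncomputable def YonedaExt.deg (X : C) (i : ℤ) : Submodule k (YonedaExt X) :=
  LinearMap.range (YonedaExt.of k X i)

theorem YonedaExt.of_mul (X : C) (i j : ℤ) (f : ShiftedHom X X i) (g : ShiftedHom X X j) :
  YonedaExt.of k X i f * YonedaExt.of k X j g = YonedaExt.of k X (i + j) (g.comp f rfl) :=
  DirectSum.of_mul_of _ _

end Ext

section Induction

theorem quasiIso_restriction {C : Type u} [Category.{v₁} C] [Abelian C] {K L : CochainComplex C ℤ}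
    (f : K ⟶ L) [QuasiIso f] :
    QuasiIso ((ComplexShape.embeddingDownIntUpInt.restrictionFunctor C).map f) where
  quasiIsoAt j := by
    rw [quasiIsoAt_iff' _ (j + 1) j (j - 1) (by simp) (by simp)]
    have := (quasiIsoAt_iff' f (-(j + 1)) (-j) (-(j - 1)) (by simp [CochainComplex.prev]; lia)
      (by simp [CochainComplex.next]; lia)).1 inferInstance
    exact this

/-- Bounded above complexes have bounded above projective resolutions. -/
theorem exists_projective {C : Type u} [Category.{v₁} C] [Abelian C] [EnoughProjectives C]
    (K : CochainComplex C ℤ) (n : ℤ) [K.IsStrictlyLE n] :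
    ∃ (P : CochainComplex C ℤ) (f : P ⟶ K), QuasiIso f ∧ (∀ i, Projective (P.X i)) ∧
      P.IsStrictlyLE n := by
  let E := CochainComplex.opEquivalence C
  let K' : CochainComplex Cᵒᵖ ℤ := E.functor.obj (Opposite.op K)
  have : K'.IsStrictlyGE (-n) := by
    rw [CochainComplex.isStrictlyGE_iff]
    intro i hi
    exact (K.isZero_of_isStrictlyLE n _ (by
      change n < -i; lia)).op
  obtain ⟨L, i, _, hL, hL'⟩ :=
    CochainComplex.Plus.modelCategoryQuillen.exists_quasiIso_injective K' (-n)
  have := quasiIso_restriction i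
  refine ⟨(E.inverse.obj L).unop, (E.unitIso.hom.app (Opposite.op K) ≫ E.inverse.map i).unop, ?_, ?_, ?_⟩
  · rw [unop_comp]
    have : QuasiIso (E.inverse.map i).unop := by
      exact (HomologicalComplex.quasiIso_unopFunctor_map_iff
        ((ComplexShape.embeddingDownIntUpInt.restrictionFunctor Cᵒᵖ).map i)).2 this
    infer_instance
  · intro j
    have := hL (-j)
    exact inferInstanceAs (Projective (L.X (-j)).unop)
  · rw [CochainComplex.isStrictlyLE_iff]
    intro j hj
    exact (L.isZero_of_isStrictlyGE (-n) (-j) (by lia)).unop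

noncomputable section
variable {S R : Type u} [Ring S] [Ring R] (φ : S →+* R)

/-- The submodule of `R ⊗_ℤ M` spanned by the relations `r φ(s) ⊗ m - r ⊗ s m`. -/
def balancing (M : Type u) [AddCommGroup M] [Module S M] : Submodule R (R ⊗[ℤ] M) :=
  Submodule.span R {t | ∃ (r : R) (s : S) (m : M), t = (r * φ s) ⊗ₜ[ℤ] m - r ⊗ₜ[ℤ] (s • m)}

/-- The map `R ⊗_S M → R ⊗_S N` induced by an `S`-linear map `M → N`. -/
def balancedMap {M N : Type u} [AddCommGroup M] [Module S M] [AddCommGroup N] [Module S N]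
    (f : M →ₗ[S] N) :
    ((R ⊗[ℤ] M) ⧸ balancing φ M) →ₗ[R] ((R ⊗[ℤ] N) ⧸ balancing φ N) :=
  Submodule.mapQ _ _ (f.toAddMonoidHom.toIntLinearMap.baseChange R) (by
    rw [balancing, Submodule.span_le]
    rintro _ ⟨r, s, m, rfl⟩
    refine Submodule.subset_span ⟨r, s, f m, ?_⟩
    simp)

@[simp]
theorem balancedMap_mk {M N : Type u} [AddCommGroup M] [Module S M] [AddCommGroup N] [Module S N]
    (f : M →ₗ[S] N) (r : R) (m : M) :
    balancedMap φ f (Submodule.Quotient.mk (r ⊗ₜ[ℤ] m)) = Submodule.Quotient.mk (r ⊗ₜ[ℤ] f m) :=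
  rfl

theorem balanced_ext {M : Type u} [AddCommGroup M] [Module S M] {N : Type u} [AddCommGroup N] [Module R N]
    {f g : ((R ⊗[ℤ] M) ⧸ balancing φ M) →ₗ[R] N}
    (h : ∀ r m, f (Submodule.Quotient.mk (r ⊗ₜ[ℤ] m)) = g (Submodule.Quotient.mk (r ⊗ₜ[ℤ] m))) : f = g := by
  refine Submodule.linearMap_qext _ (LinearMap.ext fun t => ?_)
  induction t using TensorProduct.induction_on with
  | zero => simp
  | tmul r m => exact h r m
  | add a b ha hb => simp only [map_add, ha, hb]

/-- Extension of scalars `M ↦ R ⊗_S M` along a homomorphism `φ : S → R` of (noncommutative) rings,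
for left modules. For opposite rings `S = Bᵐᵒᵖ`, `R = Aᵐᵒᵖ`, left modules are right `B`- and
`A`-modules, and this is the functor `M ↦ M ⊗_B A` (with `op a ⊗ m` standing for `m ⊗ a`). -/
def inducedModule : ModuleCat.{u} S ⥤ ModuleCat.{u} R where
  obj M := ModuleCat.of R ((R ⊗[ℤ] M) ⧸ balancing φ M)
  map f := ModuleCat.ofHom (balancedMap φ f.hom)
  map_id M := by
    refine ModuleCat.hom_ext (balanced_ext φ fun r m => ?_)
    simp
  map_comp f g := by
    refine ModuleCat.hom_ext (balanced_ext φ fun r m => ?_)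
    simp

instance : (inducedModule φ).Additive where
  map_add {M N f g} := by
    refine ModuleCat.hom_ext (balanced_ext φ fun r m => ?_)
    exact congrArg Submodule.Quotient.mk (TensorProduct.tmul_add r (f.hom m) (g.hom m))

end

end Induction
noncomputable section
open MulOpposite
/-- The structure of a right `H`-comodule algebra on `A`: a coassociative and counital coaction
`A → A ⊗ H` which is a homomorphism of algebras. -/
structure ComoduleAlgebra (k : Type v₁) (H : Type v₂) (A : Type u) [Field k] [Ring H] [HopfAlgebra k H]
    [Ring A] [Algebra k A] where
  /-- The coaction `a ↦ ∑ a₀ ⊗ a₁`. -/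
  coact : A →ₐ[k] A ⊗[k] H
  coassoc : ∀ a : A, TensorProduct.assoc k A H H (coact.toLinearMap.rTensor H (coact a)) =
    (Coalgebra.comul (R := k) (A := H)).lTensor A (coact a)
  counit : ∀ a : A, TensorProduct.rid k A ((Coalgebra.counit (R := k) (A := H)).lTensor A (coact a)) = a

section SelfTensor

variable {k : Type v₁} {A : Type u} [Field k] [Ring A] [Algebra k A] (B : Subalgebra k A)

/-- The relations `x b ⊗ y - x ⊗ b y` (`b ∈ B`). -/
def selfRel : AddSubgroup (A ⊗[ℤ] A) :=
  AddSubgroup.closure {t | ∃ (x : A) (b : B) (y : A), t = (x * b) ⊗ₜ[ℤ] y - x ⊗ₜ[ℤ] (b * y)}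

/-- The tensor product `A ⊗_B A` over the (noncommutative) subalgebra `B`. -/
abbrev SelfTensor : Type u := (A ⊗[ℤ] A) ⧸ selfRel B

variable {B}

/-- The class of `x ⊗ y` in `A ⊗_B A`. -/
def SelfTensor.tmul (x y : A) : SelfTensor B := QuotientAddGroup.mk (x ⊗ₜ[ℤ] y)

theorem SelfTensor.add_tmul (x x' y : A) :
    SelfTensor.tmul (B := B) (x + x') y = SelfTensor.tmul x y + SelfTensor.tmul x' y :=
  congrArg _ (TensorProduct.add_tmul x x' y)

theorem SelfTensor.tmul_add (x y y' : A) :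
    SelfTensor.tmul (B := B) x (y + y') = SelfTensor.tmul x y + SelfTensor.tmul x y' :=
  congrArg _ (TensorProduct.tmul_add x y y')

theorem SelfTensor.mul_tmul (x : A) (b : B) (y : A) :
    SelfTensor.tmul (B := B) (x * b) y = SelfTensor.tmul x (b * y) :=
  QuotientAddGroup.eq_iff_sub_mem.2 (AddSubgroup.subset_closure ⟨x, b, y, rfl⟩)

variable {X : Type v₃} [AddCommGroup X]

/-- The additive map out of `A ⊗_B A` given by a balanced biadditive map. -/
def SelfTensor.lift (f : A → A → X)
    (h₁ : ∀ x x' y, f (x + x') y = f x y + f x' y) (h₂ : ∀ x y y', f x (y + y') = f x y + f x y')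
    (h₃ : ∀ (x : A) (b : B) (y : A), f (x * b) y = f x (b * y)) : SelfTensor B →+ X :=
  QuotientAddGroup.lift _
    (TensorProduct.lift (LinearMap.mk₂ ℤ f h₁
      (fun c x y => by simpa using map_zsmul (AddMonoidHom.mk' (f · y) (h₁ · · y)) c x) h₂
      (fun c x y => by
        simpa using map_zsmul (AddMonoidHom.mk' (f x) (h₂ x)) c y))).toAddMonoidHom
    (by
      rw [selfRel, AddSubgroup.closure_le]
      rintro _ ⟨x, b, y, rfl⟩
      exact (map_sub _ _ _).trans (sub_eq_zero.2 (h₃ x b y)))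

@[simp]
theorem SelfTensor.lift_tmul (f : A → A → X)
    (h₁ : ∀ x x' y, f (x + x') y = f x y + f x' y) (h₂ : ∀ x y y', f x (y + y') = f x y + f x y')
    (h₃ : ∀ (x : A) (b : B) (y : A), f (x * b) y = f x (b * y)) (x y : A) :
    SelfTensor.lift f h₁ h₂ h₃ (SelfTensor.tmul x y) = f x y := rfl

theorem SelfTensor.hom_ext {f g : SelfTensor B →+ X}
    (h : ∀ x y : A, f (SelfTensor.tmul x y) = g (SelfTensor.tmul x y)) : f = g := by
  refine QuotientAddGroup.addMonoidHom_ext _ (AddMonoidHom.ext fun t => ?_)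
  induction t using TensorProduct.induction_on with
  | zero => simp only [map_zero]
  | tmul x y => exact h x y
  | add a b ha hb => simp only [map_add, ha, hb]

end SelfTensor

namespace ComoduleAlgebra
variable {k : Type v₁} {H : Type v₂} {A : Type u} [Field k] [Ring H] [HopfAlgebra k H]
    [Ring A] [Algebra k A] (ρ : ComoduleAlgebra k H A)

/-- The coinvariant subalgebra `B = A^{co H}`, of the `a` with coaction `a ⊗ 1`. -/
def coinvariants : Subalgebra k A := AlgHom.equalizer ρ.coact Algebra.TensorProduct.includeLeft

theorem coact_coe (b : ρ.coinvariants) : ρ.coact (b : A) = (b : A) ⊗ₜ 1 := b.2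

/-- The canonical map `β : A ⊗_B A → A ⊗ H`, `x ⊗ y ↦ ∑ x y₀ ⊗ y₁`. -/
def canonical : SelfTensor ρ.coinvariants →+ A ⊗[k] H :=
  SelfTensor.lift (fun x y : A => (x ⊗ₜ[k] (1 : H)) * ρ.coact y)
    (fun x x' y => by rw [TensorProduct.add_tmul, add_mul])
    (fun x y y' => by rw [map_add, mul_add])
    (fun x b y => by simp [coact_coe, ← mul_assoc])

@[simp]
theorem canonical_mk (x y : A) : ρ.canonical (SelfTensor.tmul x y) =
    (x ⊗ₜ[k] (1 : H)) * ρ.coact y := rfl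

/-- `A/B` is an `H`-Galois extension, for `B = A^{co H}`: the canonical map is bijective. -/
def IsGalois : Prop := Function.Bijective ρ.canonical

/-- The element `∑ X ⊗ Y = β⁻¹(1 ⊗ h)` of `A ⊗_B A`. -/
def translation (hρ : ρ.IsGalois) (h : H) : SelfTensor ρ.coinvariants :=
  (Equiv.ofBijective _ hρ).symm (1 ⊗ₜ h)

theorem canonical_translation (hρ : ρ.IsGalois) (h : H) :
    ρ.canonical (ρ.translation hρ h) = 1 ⊗ₜ h :=
  (Equiv.ofBijective _ hρ).apply_symm_apply _

/-- The inclusion `B → A`, as a homomorphism of opposite rings. -/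
def inclOp : (ρ.coinvariants)ᵐᵒᵖ →+* Aᵐᵒᵖ := ρ.coinvariants.val.toRingHom.op

/-- The restriction functor from right `A`-modules to right `B`-modules. -/
abbrev res : ModuleCat.{u} Aᵐᵒᵖ ⥤ ModuleCat.{u} (ρ.coinvariants)ᵐᵒᵖ :=
  ModuleCat.restrictScalars ρ.inclOp

theorem res_exact (S : ShortComplex (ModuleCat.{u} Aᵐᵒᵖ)) (h : S.Exact) :
    (S.map ρ.res).Exact := by
  rw [ShortComplex.ShortExact.moduleCat_exact_iff_function_exact] at h ⊢
  exact h

instance : Limits.PreservesFiniteLimits ρ.res :=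
  have h : Limits.PreservesFiniteLimits ρ.res ∧ Limits.PreservesFiniteColimits ρ.res :=
    ((Functor.exact_tfae ρ.res).out 1 3).mp ρ.res_exact
  h.1

instance : Limits.PreservesFiniteColimits ρ.res :=
  have h : Limits.PreservesFiniteLimits ρ.res ∧ Limits.PreservesFiniteColimits ρ.res :=
    ((Functor.exact_tfae ρ.res).out 1 3).mp ρ.res_exact
  h.2

/-- The induction functor `- ⊗_B A` from right `B`-modules to right `A`-modules. -/
abbrev ind : ModuleCat.{u} (ρ.coinvariants)ᵐᵒᵖ ⥤ ModuleCat.{u} Aᵐᵒᵖ :=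
  inducedModule ρ.inclOp

section Action

variable {M N : ModuleCat.{u} Aᵐᵒᵖ}

/-- A `B`-linear map of right `A`-modules, as an additive map. -/
def toAddHom (f : ρ.res.obj M ⟶ ρ.res.obj N) : M →+ N := f.hom.toAddMonoidHom

theorem toAddHom_smul (f : ρ.res.obj M ⟶ ρ.res.obj N) (b : ρ.coinvariants) (m : M) :
    ρ.toAddHom f (op (b : A) • m) = op (b : A) • ρ.toAddHom f m :=
  f.hom.map_smul (op b) m

/-- For a `B`-linear map `f : M → N` of right `A`-modules and `m : M`, the additive map
`A ⊗_B A → N`, `x ⊗ y ↦ f (m x) y`. -/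
def sandwich (f : ρ.res.obj M ⟶ ρ.res.obj N) (m : M) : SelfTensor ρ.coinvariants →+ N :=
  SelfTensor.lift (fun x y => op y • ρ.toAddHom f (op x • m))
    (fun x x' y => by rw [MulOpposite.op_add, add_smul, map_add, smul_add])
    (fun x y y' => by rw [MulOpposite.op_add, add_smul])
    (fun x b y => by rw [op_mul, op_mul, mul_smul, mul_smul, toAddHom_smul])

@[simp]
theorem sandwich_mk (f : ρ.res.obj M ⟶ ρ.res.obj N) (m : M) (x y : A) :
    ρ.sandwich f m (SelfTensor.tmul x y) = op y • ρ.toAddHom f (op x • m) :=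
  rfl

/-- Left multiplication by `b ∈ B` on `A ⊗_B A`. -/
def lmul (b : ρ.coinvariants) : SelfTensor ρ.coinvariants →+ SelfTensor ρ.coinvariants :=
  SelfTensor.lift (fun x y => SelfTensor.tmul ((b : A) * x) y)
    (fun x x' y => by rw [mul_add, SelfTensor.add_tmul])
    (fun x y y' => by rw [SelfTensor.tmul_add])
    (fun x c y => by rw [← mul_assoc, SelfTensor.mul_tmul])

/-- Right multiplication by `b ∈ B` on `A ⊗_B A`. -/
def rmul (b : ρ.coinvariants) : SelfTensor ρ.coinvariants →+ SelfTensor ρ.coinvariants :=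
  SelfTensor.lift (fun x y => SelfTensor.tmul x (y * (b : A)))
    (fun x x' y => by rw [SelfTensor.add_tmul])
    (fun x y y' => by rw [add_mul, SelfTensor.tmul_add])
    (fun x c y => by rw [mul_assoc, SelfTensor.mul_tmul])

theorem lmul_translation (hρ : ρ.IsGalois) (b : ρ.coinvariants) (h : H) :
    ρ.lmul b (ρ.translation hρ h) = ρ.rmul b (ρ.translation hρ h) := by
  have h₁ : ρ.canonical.comp (ρ.lmul b) =
      (AddMonoidHom.mulLeft ((b : A) ⊗ₜ[k] (1 : H))).comp ρ.canonical :=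
    SelfTensor.hom_ext fun x y => by
      change (((b : A) * x) ⊗ₜ[k] (1 : H)) * ρ.coact y =
        ((b : A) ⊗ₜ[k] (1 : H)) * ((x ⊗ₜ[k] (1 : H)) * ρ.coact y)
      simp [← mul_assoc]
  have h₂ : ρ.canonical.comp (ρ.rmul b) =
      (AddMonoidHom.mulRight ((b : A) ⊗ₜ[k] (1 : H))).comp ρ.canonical :=
    SelfTensor.hom_ext fun x y => by
      change (x ⊗ₜ[k] (1 : H)) * ρ.coact (y * b) =
        ((x ⊗ₜ[k] (1 : H)) * ρ.coact y) * ((b : A) ⊗ₜ[k] (1 : H))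
      rw [map_mul, coact_coe, mul_assoc]
  apply hρ.1
  refine (DFunLike.congr_fun h₁ _).trans (Eq.trans ?_ (DFunLike.congr_fun h₂ _).symm)
  simp [canonical_translation]

theorem sandwich_smul (f : ρ.res.obj M ⟶ ρ.res.obj N) (b : ρ.coinvariants) (m : M) :
    ρ.sandwich f (op (b : A) • m) = (ρ.sandwich f m).comp (ρ.lmul b) :=
  SelfTensor.hom_ext fun x y => by
    change op y • ρ.toAddHom f (op x • op (b : A) • m) =
      op y • ρ.toAddHom f (op ((b : A) * x) • m)
    rw [op_mul, mul_smul]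

theorem smul_sandwich (f : ρ.res.obj M ⟶ ρ.res.obj N) (b : ρ.coinvariants) (m : M)
    (t : SelfTensor ρ.coinvariants) :
    op (b : A) • ρ.sandwich f m t = ρ.sandwich f m (ρ.rmul b t) := by
  have : (DistribSMul.toAddMonoidHom N (op (b : A))).comp (ρ.sandwich f m) =
      (ρ.sandwich f m).comp (ρ.rmul b) :=
    SelfTensor.hom_ext fun x y => by
      change op (b : A) • op y • ρ.toAddHom f (op x • m) =
        op (y * (b : A)) • ρ.toAddHom f (op x • m)
      rw [op_mul, mul_smul]
  exact DFunLike.congr_fun this t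

theorem sandwich_add (f : ρ.res.obj M ⟶ ρ.res.obj N) (m m' : M) :
    ρ.sandwich f (m + m') = ρ.sandwich f m + ρ.sandwich f m' :=
  SelfTensor.hom_ext fun x y => by
    change op y • ρ.toAddHom f (op x • (m + m')) =
      op y • ρ.toAddHom f (op x • m) + op y • ρ.toAddHom f (op x • m')
    rw [smul_add, map_add, smul_add]

/-- The action `(h · f)(m) = ∑ f (m X) Y`, where `∑ X ⊗ Y = β⁻¹(1 ⊗ S h)`, on `B`-linear maps. -/
def homAct (hρ : ρ.IsGalois) (h : H) (f : ρ.res.obj M ⟶ ρ.res.obj N) : ρ.res.obj M ⟶ ρ.res.obj N :=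
  ModuleCat.ofHom (X := ρ.res.obj M) (Y := ρ.res.obj N)
  { toFun := fun m => ρ.sandwich f m (ρ.translation hρ (HopfAlgebra.antipode k h))
    map_add' := fun m m' => DFunLike.congr_fun (ρ.sandwich_add f m m') _
    map_smul' := fun b m => by
      refine (DFunLike.congr_fun (ρ.sandwich_smul f b.unop m) _).trans ?_
      refine Eq.trans ?_ (ρ.smul_sandwich f b.unop m _).symm
      exact congrArg (ρ.sandwich f m) (ρ.lmul_translation hρ b.unop _) }

theorem sandwich_map_add (f g : ρ.res.obj M ⟶ ρ.res.obj N) (m : M) :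
    ρ.sandwich (f + g) m = ρ.sandwich f m + ρ.sandwich g m :=
  SelfTensor.hom_ext fun x y => smul_add (op y) (ρ.toAddHom f (op x • m)) (ρ.toAddHom g (op x • m))

/-- `f ↦ h · f` is additive. -/
def homActHom (hρ : ρ.IsGalois) (h : H) (M N : ModuleCat.{u} Aᵐᵒᵖ) :
    (ρ.res.obj M ⟶ ρ.res.obj N) →+ (ρ.res.obj M ⟶ ρ.res.obj N) :=
  AddMonoidHom.mk' (ρ.homAct hρ h) fun f g => by
    refine ModuleCat.hom_ext (LinearMap.ext fun m => ?_)
    exact DFunLike.congr_fun (ρ.sandwich_map_add f g m) _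

/-- The action is natural with respect to `A`-linear maps in the source. -/
theorem homAct_comp_left (hρ : ρ.IsGalois) (h : H) {M' : ModuleCat.{u} Aᵐᵒᵖ} (a : M' ⟶ M)
    (f : ρ.res.obj M ⟶ ρ.res.obj N) :
    ρ.homAct hρ h (ρ.res.map a ≫ f) = ρ.res.map a ≫ ρ.homAct hρ h f := by
  refine ModuleCat.hom_ext (LinearMap.ext fun m => ?_)
  have : ρ.sandwich (ρ.res.map a ≫ f) m = ρ.sandwich f (a.hom m) :=
    SelfTensor.hom_ext fun x y =>
      congrArg (fun z => op y • ρ.toAddHom f z) (a.hom.map_smul (op x) m)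
  exact DFunLike.congr_fun this _

/-- The action is natural with respect to `A`-linear maps in the target. -/
theorem homAct_comp_right (hρ : ρ.IsGalois) (h : H) {N' : ModuleCat.{u} Aᵐᵒᵖ}
    (f : ρ.res.obj M ⟶ ρ.res.obj N) (a : N ⟶ N') :
    ρ.homAct hρ h (f ≫ ρ.res.map a) = ρ.homAct hρ h f ≫ ρ.res.map a := by
  refine ModuleCat.hom_ext (LinearMap.ext fun m => ?_)
  have : ρ.sandwich (f ≫ ρ.res.map a) m = a.hom.toAddMonoidHom.comp (ρ.sandwich f m) :=
    SelfTensor.hom_ext fun x y => (a.hom.map_smul (op y) (ρ.toAddHom f (op x • m))).symm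
  exact DFunLike.congr_fun this _

end Action

section Complexes
open CochainComplex.HomComplex

/-- Restriction of complexes from `A` to `B`. -/
abbrev resComplex (P : CochainComplex (ModuleCat.{u} Aᵐᵒᵖ) ℤ) :
    CochainComplex (ModuleCat.{u} (ρ.coinvariants)ᵐᵒᵖ) ℤ :=
  (ρ.res.mapHomologicalComplex (ComplexShape.up ℤ)).obj P

/-- The complex `Q ⊗_B A`. -/
abbrev indComplex (Q : CochainComplex (ModuleCat.{u} (ρ.coinvariants)ᵐᵒᵖ) ℤ) :
    CochainComplex (ModuleCat.{u} Aᵐᵒᵖ) ℤ :=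
  (ρ.ind.mapHomologicalComplex (ComplexShape.up ℤ)).obj Q

/-- The action of `h` on the complex `Hom_B(P, P')`. -/
def cochainAct (hρ : ρ.IsGalois) (h : H) {P P' : CochainComplex (ModuleCat.{u} Aᵐᵒᵖ) ℤ} {n : ℤ}
    (z : Cochain (ρ.resComplex P) (ρ.resComplex P') n) :
    Cochain (ρ.resComplex P) (ρ.resComplex P') n :=
  Cochain.mk fun p q hpq => ρ.homAct hρ h (M := P.X p) (N := P'.X q) (z.v p q hpq)

theorem δ_cochainAct (hρ : ρ.IsGalois) (h : H) {P P' : CochainComplex (ModuleCat.{u} Aᵐᵒᵖ) ℤ}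
    {n m : ℤ} (z : Cochain (ρ.resComplex P) (ρ.resComplex P') n) (hnm : n + 1 = m) :
    δ n m (ρ.cochainAct hρ h z) = ρ.cochainAct hρ h (δ n m z) := by
  refine Cochain.ext _ _ fun p q hpq => ?_
  rw [δ_v n m hnm _ p q hpq (q - 1) (p + 1) rfl rfl]
  refine Eq.trans ?_ (congrArg (ρ.homActHom hρ h (P.X p) (P'.X q))
    (δ_v n m hnm z p q hpq (q - 1) (p + 1) rfl rfl)).symm
  refine Eq.trans (congrArg₂ (· + ·) ?_ ?_) (map_add (ρ.homActHom hρ h (P.X p) (P'.X q)) _ _).symm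
  · exact (ρ.homAct_comp_right hρ h (z.v p (q - 1) _) (P'.d (q - 1) q)).symm
  · refine Eq.trans ?_ (map_zsmul (ρ.homActHom hρ h (P.X p) (P'.X q)) m.negOnePow.val _).symm
    exact congrArg (m.negOnePow.val • ·)
      (ρ.homAct_comp_left hρ h (P.d p (p + 1)) (z.v (p + 1) q _)).symm

/-- The action of `h` on the cocycles of `Hom_B(P, P')`. -/
def cocycleAct (hρ : ρ.IsGalois) (h : H) {P P' : CochainComplex (ModuleCat.{u} Aᵐᵒᵖ) ℤ} {n : ℤ}
    (z : Cocycle (ρ.resComplex P) (ρ.resComplex P') n) :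
    Cocycle (ρ.resComplex P) (ρ.resComplex P') n :=
  Cocycle.mk (ρ.cochainAct hρ h z) (n + 1) rfl (by
    rw [δ_cochainAct _ _ _ _ rfl, Cocycle.δ_eq_zero]
    refine Cochain.ext _ _ fun p q hpq => ?_
    exact map_zero (ρ.homActHom hρ h (P.X p) (P'.X q)))

variable [HasDerivedCategory.{w₁} (ModuleCat.{u} Aᵐᵒᵖ)]
  [HasDerivedCategory.{w₂} (ModuleCat.{u} (ρ.coinvariants)ᵐᵒᵖ)]

/-- The restriction functor `D(A) → D(B)`. -/
abbrev dRes : DerivedCategory (ModuleCat.{u} Aᵐᵒᵖ) ⥤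
    DerivedCategory (ModuleCat.{u} (ρ.coinvariants)ᵐᵒᵖ) :=
  ρ.res.mapDerivedCategory

/-- Let `P` be a complex isomorphic to `M` in `D(A)`. A cocycle `z` of degree `n` of the complex
`Hom_B(P, P)` is a morphism of complexes `P → P[n]` over `B`; this is the corresponding element of
`Hom_{D(B)}(M, M[n])`. -/
def cocycleClass {M : DerivedCategory (ModuleCat.{u} Aᵐᵒᵖ)}
    {P : CochainComplex (ModuleCat.{u} Aᵐᵒᵖ) ℤ} (e : DerivedCategory.Q.obj P ≅ M) {n : ℤ}
    (z : Cocycle (ρ.resComplex P) (ρ.resComplex P) n) :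
    ShiftedHom (ρ.dRes.obj M) (ρ.dRes.obj M) n :=
  let e' : DerivedCategory.Q.obj (ρ.resComplex P) ≅ ρ.dRes.obj M :=
    (ρ.res.mapDerivedCategoryFactors.app P).symm ≪≫ ρ.dRes.mapIso e
  e'.inv ≫ ShiftedHom.map (Cocycle.equivHomShift.symm z) DerivedCategory.Q ≫ e'.hom⟦n⟧'

/-- The `H`-action on `Ext_B^*(M, M)` is the natural one: whenever `P` is a bounded above complex of
projective right `A`-modules which is isomorphic to `M` in `D(A)`, it is induced on cohomology classes
by the action of `H` on the complex `Hom_B(P, P)`, which is given by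
`(h · f)(p) = ∑ f (p X) Y` with `∑ X ⊗ Y = β⁻¹(1 ⊗ S h)`. -/
def IsNaturalAction (hρ : ρ.IsGalois) (M : DerivedCategory (ModuleCat.{u} Aᵐᵒᵖ))
    (α : HopfModuleAlgebra k H (YonedaExt (ρ.dRes.obj M))) : Prop :=
  ∀ (P : CochainComplex (ModuleCat.{u} Aᵐᵒᵖ) ℤ), (∃ d : ℤ, P.IsStrictlyLE d) →
    (∀ i : ℤ, Projective (P.X i)) →
    ∀ (e : DerivedCategory.Q.obj P ≅ M) (n : ℤ) (h : H)
      (z : Cocycle (ρ.resComplex P) (ρ.resComplex P) n),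
      α.act h (YonedaExt.of k _ n (ρ.cocycleClass e z)) =
        YonedaExt.of k _ n (ρ.cocycleClass e (ρ.cocycleAct hρ h z))

/-- `T` is (isomorphic to) the left derived tensor product `N ⊗^L_B A` of `N` in `D^-(B)`: it is
`Q ⊗_B A` for a bounded above complex `Q` of projective right `B`-modules isomorphic to `N` in
`D(B)`. -/
def IsDerivedTensor (N : DerivedCategory (ModuleCat.{u} (ρ.coinvariants)ᵐᵒᵖ))
    (T : DerivedCategory (ModuleCat.{u} Aᵐᵒᵖ)) : Prop :=
  ∃ Q : CochainComplex (ModuleCat.{u} (ρ.coinvariants)ᵐᵒᵖ) ℤ,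
    (∃ d : ℤ, Q.IsStrictlyLE d) ∧ (∀ i : ℤ, Projective (Q.X i)) ∧
    Nonempty (DerivedCategory.Q.obj Q ≅ N) ∧
    Nonempty (DerivedCategory.Q.obj (ρ.indComplex Q) ≅ T)

theorem exists_isDerivedTensor (N : DerivedCategory (ModuleCat.{u} (ρ.coinvariants)ᵐᵒᵖ))
    (hN : DerivedCategory.TStructure.t.minus N) : ∃ T, ρ.IsDerivedTensor N T := by
  obtain ⟨d, hd⟩ := hN
  have : N.IsLE d := hd
  obtain ⟨K, _, ⟨e⟩⟩ := N.exists_iso_Q_obj_of_isLE d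
  obtain ⟨Q, f, _, hQ, hd'⟩ := exists_projective K d
  exact ⟨_, Q, ⟨d, hd'⟩, hQ, ⟨asIso (DerivedCategory.Q.map f) ≪≫ e.symm⟩, ⟨Iso.refl _⟩⟩

theorem dRes_minus (M : DerivedCategory (ModuleCat.{u} Aᵐᵒᵖ))
    (hM : DerivedCategory.TStructure.t.minus M) :
    DerivedCategory.TStructure.t.minus (ρ.dRes.obj M) := by
  obtain ⟨d, hd⟩ := hM
  have : M.IsLE d := hd
  obtain ⟨K, hK, ⟨e⟩⟩ := M.exists_iso_Q_obj_of_isLE d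
  have : (ρ.resComplex K).IsStrictlyLE d := by
    rw [CochainComplex.isStrictlyLE_iff] at hK ⊢
    exact fun i hi => ρ.res.map_isZero (hK i hi)
  have hQ : (DerivedCategory.Q.obj (ρ.resComplex K)).IsLE d := inferInstance
  exact ⟨d, DerivedCategory.TStructure.t.isLE_of_iso (X := DerivedCategory.Q.obj (ρ.resComplex K))
    ((ρ.res.mapDerivedCategoryFactors.app K).symm ≪≫ ρ.dRes.mapIso e.symm) d⟩

end Complexes
end ComoduleAlgebra
end

end HopfGalois

/-!
The argument works with the right action of `H` on `B`-linear maps between `A`-modules given by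
`(f ◁ h)(m) = ∑ f(m X) Y`, where `∑ X ⊗ Y = β⁻¹(1 ⊗ h)` (`twist`); the action in the theorem is
`h · f = f ◁ S(h)`. Since `β` is surjective, all identities about `◁` can be checked on the elements
`β(x ⊗ y)` of `A ⊗ H`. It is an action, `A`-linear maps are invariant, and
`(f ≫ g) ◁ h = ∑ (f ◁ h₁) ≫ (g ◁ h₂)` (`twist_twist`, `twist_res_map`, `twist_comp`). As the antipode
reverses products and coproducts, `S` turns this into a left module algebra structure on the
`B`-linear endomorphisms of a complex of `A`-modules.

To pass to `Ext`, a projective resolution `P` of `M` over `A` has to stay projective over `B`, so that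
classes in `Hom_{D(B)}(M, M[n])` are homotopy classes of morphisms `P → P[n]`. This holds because `A` is
a projective right `B`-module (`exists_dual_basis`, `projective_res`): there are integrals `Tᵢ` of `H^*`
and elements `Λᵢ` of `H` with `∑ Tᵢ(Λᵢ h) = ε(h)`, which comes from a trace formula for integrals
(`leftHit_traceIntegral`, `sum_traceIntegral`), the maps `a ↦ ∑ a₀ Tᵢ(a₁)` take values in `B`, and with
the components of the elements `β⁻¹(1 ⊗ Λᵢ)` they give a finite dual basis. Two resolutions are compared
by `A`-linear morphisms, with which `◁` commutes; this gives naturality, and uniqueness follows as every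
class is represented on `P`.

For the smash product, `P ⊗_B A` represents the derived tensor product, and `β` identifies it with
`P ⊗ H`. Left multiplication on `H` becomes an `A`-linear endomorphism `leftMul h` of `P ⊗_B A`, and it
satisfies the commutation rule of the smash product with the maps `f ⊗_B A`
(`ind_map_comp_leftMul`). By adjunction, an `A`-linear map out of `P ⊗_B A` is a `B`-linear map out of
`P`, so `A`-linear maps `P ⊗_B A → P' ⊗_B A` are `H ⊗ Hom_B(P, P')`. In terms of a basis `bᵢ` of `H`, this
is expressed by the maps `component`, with which each `t` is `∑ (tᵢ ⊗_B A) ≫ leftMul bᵢ`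
(`component_indShifted`, `sum_indShifted_component`). Hence `h ⊗ x ↦ h x` is a bijection
`H ⊗ Ext_B → Ext_A`, and bijectivity of the antipode turns it into `x # h ↦ x h`
(`SmashProduct.lift_bijective`).
-/

namespace HopfGalois

open CategoryTheory TensorProduct Coalgebra HopfAlgebra MulOpposite
open scoped ModuleCat

noncomputable section

/-! ### The comultiplication of the antipode -/

section Antipode

variable {k : Type v₁} {H : Type v₂} [Field k] [Ring H] [HopfAlgebra k H]

theorem sum_antipode_tmul_one_mul_comul {ι : Type*} {h : H} (𝓡 : Repr k h ι) :
    ∑ i ∈ 𝓡.index, (antipode k (𝓡.left i) ⊗ₜ[k] (1 : H)) * comul (𝓡.right i) = 1 ⊗ₜ[k] h := by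
  let Φ : H ⊗[k] (H ⊗[k] H) →ₗ[k] H ⊗[k] H :=
    TensorProduct.map (LinearMap.mul' k H ∘ₗ TensorProduct.map (antipode k) LinearMap.id)
      LinearMap.id ∘ₗ (TensorProduct.assoc k H H H).symm.toLinearMap
  have e := congr(Φ $(sum_tmul_tmul_eq 𝓡 (fun i => ℛ k (𝓡.left i)) (fun i => ℛ k (𝓡.right i))))
  have e₁ (i : ι) : (antipode k (𝓡.left i) ⊗ₜ[k] (1 : H)) * comul (𝓡.right i) =
      ∑ j ∈ (ℛ k (𝓡.right i)).index,
        (antipode k (𝓡.left i) * (ℛ k (𝓡.right i)).left j) ⊗ₜ (ℛ k (𝓡.right i)).right j := by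
    rw [← (ℛ k (𝓡.right i)).eq, Finset.mul_sum]
    simp
  have e₂ (i : ι) : ∑ j ∈ (ℛ k (𝓡.left i)).index,
      (antipode k ((ℛ k (𝓡.left i)).left j) * (ℛ k (𝓡.left i)).right j) ⊗ₜ[k] 𝓡.right i =
      (1 : H) ⊗ₜ[k] (counit (R := k) (𝓡.left i) • 𝓡.right i) := by
    rw [← TensorProduct.sum_tmul, sum_antipode_mul_eq_smul, TensorProduct.smul_tmul]
  simp only [e₁]
  simp only [map_sum, Φ, LinearMap.comp_apply, LinearEquiv.coe_coe, TensorProduct.assoc_symm_tmul,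
    TensorProduct.map_tmul, LinearMap.mul'_apply, LinearMap.id_apply] at e
  rw [← e, Finset.sum_congr rfl fun i _ => e₂ i, ← TensorProduct.tmul_sum, sum_counit_smul]

/-- The antipode is an anti-homomorphism of coalgebras: `h ↦ ∑ S(h₂) ⊗ S(h₁)` and `Δ ∘ S` are
respectively a left and a right inverse of `Δ` for the convolution product. -/
theorem comul_antipode {ι : Type*} {h : H} (𝓡 : Repr k h ι) :
    comul (antipode k h) =
      ∑ i ∈ 𝓡.index, antipode k (𝓡.right i) ⊗ₜ[k] antipode k (𝓡.left i) := by
  let G : H ⊗[k] H →ₗ[k] H ⊗[k] H :=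
    TensorProduct.map (antipode k) (antipode k) ∘ₗ (TensorProduct.comm k H H).toLinearMap
  have hG : WithConv.toConv (G ∘ₗ comul) * WithConv.toConv (comul (R := k) (A := H)) = 1 := by
    ext x
    let 𝓡 := ℛ k x
    let E : H ⊗[k] (H ⊗[k] H) →ₗ[k] H ⊗[k] H :=
      LinearMap.mul' k (H ⊗[k] H) ∘ₗ TensorProduct.map G comul ∘ₗ
        (TensorProduct.assoc k H H H).symm.toLinearMap
    have e := congr(E $(sum_tmul_tmul_eq 𝓡 (fun i => ℛ k (𝓡.left i)) (fun i => ℛ k (𝓡.right i))))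
    simp only [map_sum, E, LinearMap.comp_apply, LinearEquiv.coe_coe, G,
      TensorProduct.assoc_symm_tmul, TensorProduct.map_tmul, LinearMap.mul'_apply,
      TensorProduct.comm_tmul] at e
    rw [𝓡.convMul_apply]
    refine Eq.trans ?_ (e.trans ?_)
    · refine Finset.sum_congr rfl fun i _ => ?_
      rw [← Finset.sum_mul]
      change G (comul (𝓡.left i)) * comul (𝓡.right i) = _
      rw [← (ℛ k (𝓡.left i)).eq]
      simp [G]
    · have e₁ (i : H × H) : ∑ j ∈ (ℛ k (𝓡.right i)).index,
          antipode k ((ℛ k (𝓡.right i)).left j) ⊗ₜ[k] antipode k (𝓡.left i) *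
            comul ((ℛ k (𝓡.right i)).right j) = 1 ⊗ₜ[k] (antipode k (𝓡.left i) * 𝓡.right i) := by
        have := congr(((1 : H) ⊗ₜ[k] antipode k (𝓡.left i)) *
          $(sum_antipode_tmul_one_mul_comul (ℛ k (𝓡.right i))))
        simpa [Finset.mul_sum, ← mul_assoc] using this
      rw [Finset.sum_congr rfl fun i _ => e₁ i, ← TensorProduct.tmul_sum,
        sum_antipode_mul_eq_smul, LinearMap.convOne_apply, Algebra.algebraMap_eq_smul_one,
        Algebra.TensorProduct.one_def, TensorProduct.tmul_smul]
  have := congr(($(left_inv_eq_right_inv hG LinearMap.comul_right_inv)) h)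
  change G (comul h) = comul (antipode k h) at this
  rw [← this, ← 𝓡.eq]
  simp [G]

end Antipode

/-! ### Integrals on a finite dimensional Hopf algebra -/

section Integral

variable {k : Type v₁} {H : Type v₂} [Field k] [Ring H] [HopfAlgebra k H]

section InverseAntipode

variable {s : H →ₗ[k] H} (hs : ∀ h, s (antipode k h) = h) (hs' : ∀ h, antipode k (s h) = h)
include hs hs'

theorem inverse_antipode_mul (a b : H) : s (a * b) = s b * s a := by
  conv_lhs => rw [← hs' a, ← hs' b, ← antipode_mul_antidistrib, hs]

omit hs' in
theorem inverse_antipode_one : s 1 = 1 := by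
  simpa using hs 1

theorem sum_inverse_antipode_mul {ι : Type*} {h : H} (𝓡 : Repr k h ι) :
    ∑ i ∈ 𝓡.index, s (𝓡.right i) * 𝓡.left i = counit (R := k) h • 1 := by
  have := congr(s $(sum_antipode_mul_eq_smul 𝓡))
  simpa [inverse_antipode_mul hs hs', hs, inverse_antipode_one hs] using this

theorem sum_mul_inverse_antipode {ι : Type*} {h : H} (𝓡 : Repr k h ι) :
    ∑ i ∈ 𝓡.index, 𝓡.right i * s (𝓡.left i) = counit (R := k) h • 1 := by
  have := congr(s $(sum_mul_antipode_eq_smul 𝓡))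
  simpa [inverse_antipode_mul hs hs', hs, inverse_antipode_one hs] using this

theorem sum_comul_mul_inverse_antipode_tmul_one {ι : Type*} {h : H} (𝓡 : Repr k h ι) :
    ∑ i ∈ 𝓡.index, comul (R := k) (𝓡.right i) * (s (𝓡.left i) ⊗ₜ[k] (1 : H)) = 1 ⊗ₜ[k] h := by
  let Φ : H ⊗[k] (H ⊗[k] H) →ₗ[k] H ⊗[k] H :=
    TensorProduct.map (LinearMap.mul' k H ∘ₗ TensorProduct.map LinearMap.id s ∘ₗ
      (TensorProduct.comm k H H).toLinearMap) LinearMap.id ∘ₗ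
        (TensorProduct.assoc k H H H).symm.toLinearMap
  have e := congr(Φ $(sum_tmul_tmul_eq 𝓡 (fun i => ℛ k (𝓡.left i)) (fun i => ℛ k (𝓡.right i))))
  have e₁ (i : ι) : comul (R := k) (𝓡.right i) * (s (𝓡.left i) ⊗ₜ[k] (1 : H)) =
      ∑ j ∈ (ℛ k (𝓡.right i)).index,
        ((ℛ k (𝓡.right i)).left j * s (𝓡.left i)) ⊗ₜ (ℛ k (𝓡.right i)).right j := by
    rw [← (ℛ k (𝓡.right i)).eq, Finset.sum_mul]
    simp
  have e₂ (i : ι) : ∑ j ∈ (ℛ k (𝓡.left i)).index,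
      ((ℛ k (𝓡.left i)).right j * s ((ℛ k (𝓡.left i)).left j)) ⊗ₜ[k] 𝓡.right i =
      (1 : H) ⊗ₜ[k] (counit (R := k) (𝓡.left i) • 𝓡.right i) := by
    rw [← TensorProduct.sum_tmul, sum_mul_inverse_antipode hs hs', TensorProduct.smul_tmul]
  simp only [e₁]
  simp only [map_sum, Φ, LinearMap.comp_apply, LinearEquiv.coe_coe, TensorProduct.assoc_symm_tmul,
    TensorProduct.comm_tmul, TensorProduct.map_tmul, LinearMap.mul'_apply,
    LinearMap.id_apply] at e
  rw [← e, Finset.sum_congr rfl fun i _ => e₂ i, ← TensorProduct.tmul_sum, sum_counit_smul]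

theorem comul_inverse_antipode {ι : Type*} {h : H} (𝓡 : Repr k h ι) :
    comul (s h) = ∑ i ∈ 𝓡.index, s (𝓡.right i) ⊗ₜ[k] s (𝓡.left i) := by
  have e := comul_antipode (ℛ k (s h))
  rw [hs', ← 𝓡.eq] at e
  have := congr(TensorProduct.comm k H H (TensorProduct.map s s $e))
  simp only [map_sum, TensorProduct.map_tmul, TensorProduct.comm_tmul, hs, (ℛ k (s h)).eq] at this
  exact this.symm

/-- The representation `∑ S⁻²(h₁) ⊗ S⁻²(h₂)` of the comultiplication of `S⁻²(h)`. -/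
def reprInverseAntipodeSq {ι : Type*} {h : H} (𝓡 : Repr k h ι) : Repr k (s (s h)) ι where
  index := 𝓡.index
  left i := s (s (𝓡.left i))
  right i := s (s (𝓡.right i))
  eq := by
    let 𝓢 : Repr k (s h) ι := ⟨𝓡.index, fun i => s (𝓡.right i), fun i => s (𝓡.left i),
      (comul_inverse_antipode hs hs' 𝓡).symm⟩
    exact (comul_inverse_antipode hs hs' 𝓢).symm

end InverseAntipode

/-- The map `h ↦ ∑ h₁ f(h₂)`. -/
def leftHit (f : H →ₗ[k] k) : H →ₗ[k] H :=
  (TensorProduct.rid k H).toLinearMap ∘ₗ f.lTensor H ∘ₗ comul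

theorem leftHit_apply (f : H →ₗ[k] k) {ι : Type*} {h : H} (𝓡 : Repr k h ι) :
    leftHit f h = ∑ i ∈ 𝓡.index, f (𝓡.right i) • 𝓡.left i := by
  simp [leftHit, ← 𝓡.eq]

theorem comul_leftHit (f : H →ₗ[k] k) {ι : Type*} {h : H} (𝓡 : Repr k h ι) :
    comul (leftHit f h) = ∑ i ∈ 𝓡.index, 𝓡.left i ⊗ₜ[k] leftHit f (𝓡.right i) := by
  let Φ : H ⊗[k] (H ⊗[k] H) →ₗ[k] H ⊗[k] H :=
    TensorProduct.map LinearMap.id ((TensorProduct.rid k H).toLinearMap ∘ₗ f.lTensor H)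
  have e := congr(Φ $(sum_tmul_tmul_eq 𝓡 (fun i => ℛ k (𝓡.left i)) (fun i => ℛ k (𝓡.right i))))
  simp only [map_sum, Φ, TensorProduct.map_tmul, LinearMap.id_apply, LinearMap.comp_apply,
    LinearMap.lTensor_tmul, LinearEquiv.coe_coe, TensorProduct.rid_tmul] at e
  rw [leftHit_apply f 𝓡, map_sum]
  simp only [map_smul, leftHit_apply f (ℛ k (𝓡.right _)), TensorProduct.tmul_sum]
  rw [← e]
  refine Finset.sum_congr rfl fun i _ => ?_
  rw [← (ℛ k (𝓡.left i)).eq, Finset.smul_sum]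
  simp

/-- For a functional `f`, the trace of `x ↦ ∑ f(x₂) S⁻²(x₁) g`, as a function of `g`. Here `s` stands
for the inverse of the antipode. It is the projection of `f` to the integrals, the coinvariants of
the Hopf module `H^*`. -/
def traceIntegral (s : H →ₗ[k] H) (f : H →ₗ[k] k) : H →ₗ[k] k where
  toFun g := LinearMap.trace k H (LinearMap.mulRight k g ∘ₗ s ∘ₗ s ∘ₗ leftHit f)
  map_add' g g' := by
    rw [← map_add, ← LinearMap.add_comp]
    congr 2
    ext; simp [mul_add]
  map_smul' c g := by
    rw [RingHom.id_apply, ← map_smul, ← LinearMap.smul_comp]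
    congr 2
    ext; simp

theorem traceIntegral_apply (s : H →ₗ[k] H) (f : H →ₗ[k] k) (g : H) : traceIntegral s f g =
    LinearMap.trace k H (LinearMap.mulRight k g ∘ₗ s ∘ₗ s ∘ₗ leftHit f) := rfl

variable [Module.Finite k H]
variable {s : H →ₗ[k] H} (hs : ∀ h, s (antipode k h) = h) (hs' : ∀ h, antipode k (s h) = h)
include hs hs'

/-- The functional `traceIntegral s f` is an integral. Paired with a functional `ξ`, this is an
identity of traces, which follows from the invariance of the trace under cyclic permutations. -/
theorem leftHit_traceIntegral (f : H →ₗ[k] k) (g : H) :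
    leftHit (traceIntegral s f) g = traceIntegral s f g • 1 := by
  have b := Module.finBasis k H
  rw [← sub_eq_zero, ← Module.forall_dual_apply_eq_zero_iff k]
  intro ξ
  rw [map_sub, sub_eq_zero, map_smul, smul_eq_mul]
  let W : H →ₗ[k] H := LinearMap.mulRight k g ∘ₗ s ∘ₗ s ∘ₗ leftHit f
  let ev : H ⊗[k] H →ₗ[k] H := (TensorProduct.lid k H).toLinearMap ∘ₗ
    TensorProduct.map ξ LinearMap.id
  let K : H →ₗ[k] H →ₗ[k] H :=
    { toFun := fun v => ev ∘ₗ LinearMap.mulLeft k (s v ⊗ₜ[k] (1 : H)) ∘ₗ comul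
      map_add' := fun v w => by ext; simp [TensorProduct.add_tmul, add_mul]
      map_smul' := fun c v => by ext; simp [← TensorProduct.smul_tmul'] }
  have hK (v y : H) : K v y = ev ((s v ⊗ₜ[k] (1 : H)) * comul y) := rfl
  have hK' {ι : Type v₂} (v : H) {y : H} (𝓡 : Repr k y ι) :
      K v y = ∑ i ∈ 𝓡.index, ξ (s v * 𝓡.left i) • 𝓡.right i := by
    simp [hK, ev, ← 𝓡.eq, Finset.mul_sum]
  let G (e : H →ₗ[k] k) : H →ₗ[k] H := (TensorProduct.lid k H).toLinearMap ∘ₗ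
    TensorProduct.map e (LinearMap.mulRight k g ∘ₗ s ∘ₗ s) ∘ₗ comul
  have hG {ι : Type v₂} (e : H →ₗ[k] k) {y : H} (𝓡 : Repr k y ι) :
      G e y = ∑ i ∈ 𝓡.index, e (𝓡.left i) • (s (s (𝓡.right i)) * g) := by
    simp [G, ← 𝓡.eq]
  have hGf {ι : Type v₂} (e : H →ₗ[k] k) {y : H} (𝓡 : Repr k y ι) :
      G e (leftHit f y) = ∑ i ∈ 𝓡.index, e (𝓡.left i) • W (𝓡.right i) := by
    simp [G, comul_leftHit f 𝓡, W]
  have hKb (v : H) : ∑ j, b.coord j v • K (b j) = K v := by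
    conv_rhs => rw [← b.sum_repr v, map_sum]
    simp
  -- the left hand side, as a trace
  have h₁ : ξ (leftHit (traceIntegral s f) g) =
      LinearMap.trace k H ((∑ j, K (b j) ∘ₗ G (b.coord j)) ∘ₗ leftHit f) := by
    have hg := ℛ k g
    have : ∑ j, K (b j) ∘ₗ G (b.coord j) =
        ∑ i ∈ hg.index, ξ (hg.left i) • (LinearMap.mulRight k (hg.right i) ∘ₗ s ∘ₗ s) := by
      ext u
      have 𝓡 := ℛ k u
      have e := congr(ev ($(sum_antipode_tmul_one_mul_comul
        (reprInverseAntipodeSq hs hs' 𝓡)) * comul g))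
      simp only [reprInverseAntipodeSq, hs', Finset.sum_mul, map_sum, mul_assoc,
        ← Bialgebra.comul_mul] at e
      simp only [← hK] at e
      simp only [LinearMap.sum_apply, LinearMap.comp_apply, hG _ 𝓡, map_sum, map_smul]
      rw [Finset.sum_comm]
      have h (i : H × H) : ∑ j, b.coord j (𝓡.left i) • K (b j) (s (s (𝓡.right i)) * g) =
          K (𝓡.left i) (s (s (𝓡.right i)) * g) := by
        simpa using congr($(hKb (𝓡.left i)) (s (s (𝓡.right i)) * g))
      rw [Finset.sum_congr rfl fun i _ => h i, e, ← hg.eq]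
      simp [ev, Finset.mul_sum]
    have this' : (∑ i ∈ hg.index, ξ (hg.left i) • (LinearMap.mulRight k (hg.right i) ∘ₗ s ∘ₗ s))
        ∘ₗ leftHit f = ∑ i ∈ hg.index, ξ (hg.left i) •
          (LinearMap.mulRight k (hg.right i) ∘ₗ s ∘ₗ s ∘ₗ leftHit f) := by
      ext; simp
    rw [this, this', leftHit_apply _ hg, map_sum, map_sum]
    simp only [map_smul, smul_eq_mul, traceIntegral_apply]
    exact Finset.sum_congr rfl fun i _ => mul_comm _ _
  -- the rotated composition
  have h₂ : ∑ j, G (b.coord j) ∘ₗ leftHit f ∘ₗ K (b j) = ξ 1 • W := by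
    ext y
    have 𝓡 := ℛ k y
    let Ψ : H ⊗[k] (H ⊗[k] H) →ₗ[k] H := (TensorProduct.lid k H).toLinearMap ∘ₗ
      TensorProduct.map (ξ ∘ₗ LinearMap.mul' k H ∘ₗ (TensorProduct.comm k H H).toLinearMap ∘ₗ
        TensorProduct.map LinearMap.id s) W ∘ₗ (TensorProduct.assoc k H H H).symm.toLinearMap
    have hΨ (a b c : H) : Ψ (a ⊗ₜ (b ⊗ₜ c)) = ξ (s b * a) • W c := by simp [Ψ]
    have e := congr(Ψ $(sum_tmul_tmul_eq 𝓡 (fun i => ℛ k (𝓡.left i)) (fun i => ℛ k (𝓡.right i))))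
    simp only [map_sum, hΨ, ← Finset.sum_smul] at e
    simp only [← map_sum, sum_inverse_antipode_mul hs hs'] at e
    have e' : ∑ i ∈ 𝓡.index, ξ (counit (R := k) (𝓡.left i) • 1) • W (𝓡.right i) = ξ 1 • W y := by
      conv_rhs => rw [← sum_counit_smul 𝓡]
      simp [Finset.smul_sum, smul_smul, mul_comm]
    rw [LinearMap.smul_apply, ← e', e]
    simp only [LinearMap.sum_apply, LinearMap.comp_apply, hK' _ 𝓡, map_sum, map_smul,
      hGf _ (ℛ k (𝓡.right _)), Finset.smul_sum, smul_smul]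
    rw [Finset.sum_comm]
    refine Finset.sum_congr rfl fun i _ => ?_
    rw [Finset.sum_comm]
    refine Finset.sum_congr rfl fun l _ => ?_
    rw [← Finset.sum_smul]
    congr 1
    conv_rhs => rw [← b.sum_repr ((ℛ k (𝓡.right i)).left l), map_sum, Finset.sum_mul, map_sum]
    refine Finset.sum_congr rfl fun j _ => ?_
    rw [map_smul, smul_mul_assoc, map_smul, smul_eq_mul, mul_comm, Module.Basis.coord_apply]
  have h₃ : (∑ j, K (b j) ∘ₗ G (b.coord j)) ∘ₗ leftHit f =
      ∑ j, K (b j) ∘ₗ (G (b.coord j) ∘ₗ leftHit f) := by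
    ext; simp
  rw [h₁, h₃, map_sum, traceIntegral_apply, mul_comm, ← smul_eq_mul, ← map_smul, ← h₂, map_sum]
  exact Finset.sum_congr rfl fun j _ => LinearMap.trace_comp_comm' _ _

omit [Module.Finite k H] in
/-- There are integrals `Tᵢ` of `H^*` and elements `Λᵢ` of `H` with `∑ Tᵢ(Λᵢ h) = ε(h)`. -/
theorem sum_traceIntegral {ι : Type*} [Fintype ι] (b : Module.Basis ι k H) (g : H) :
    ∑ j, traceIntegral s (b.coord j) (s (b j) * g) = counit (R := k) g := by
  have : ∑ j, LinearMap.mulRight k (s (b j) * g) ∘ₗ s ∘ₗ s ∘ₗ leftHit (b.coord j) =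
      (counit (R := k) (A := H)).smulRight g := by
    ext h
    have 𝓡 := ℛ k h
    simp only [LinearMap.sum_apply, LinearMap.comp_apply, leftHit_apply _ 𝓡, map_sum, map_smul]
    rw [Finset.sum_comm]
    have (i : H × H) : ∑ j, b.coord j (𝓡.right i) •
        LinearMap.mulRight k (s (b j) * g) (s (s (𝓡.left i))) =
        s (𝓡.right i * s (𝓡.left i)) * g := by
      conv_rhs => rw [← b.sum_repr (𝓡.right i)]
      simp only [Finset.sum_mul, map_sum, smul_mul_assoc, map_smul, LinearMap.mulRight_apply,
        Module.Basis.coord_apply, inverse_antipode_mul hs hs', mul_assoc]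
    rw [Finset.sum_congr rfl fun i _ => this i, ← Finset.sum_mul, ← map_sum,
      sum_mul_inverse_antipode hs hs', map_smul, inverse_antipode_one hs]
    simp
  simp only [traceIntegral_apply, ← map_sum, this]
  have : Module.Free k H := inferInstance
  have := Module.Finite.of_basis b
  exact LinearMap.trace_smulRight _ _

end Integral

/-! ### The action of the Hopf algebra on linear maps over the coinvariants -/

namespace ComoduleAlgebra

variable {k : Type v₁} {H : Type v₂} {A : Type u} [Field k] [Ring H] [HopfAlgebra k H]
    [Ring A] [Algebra k A] (ρ : ComoduleAlgebra k H A) (hρ : ρ.IsGalois)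

section Twist

variable {M N P : ModuleCat.{u} Aᵐᵒᵖ}

theorem hom_ext_toAddHom {f g : ρ.res.obj M ⟶ ρ.res.obj N}
    (h : ∀ m, ρ.toAddHom f m = ρ.toAddHom g m) : f = g :=
  ModuleCat.hom_ext (LinearMap.ext h)

include hρ in
/-- Since `β` is surjective, additive maps out of `A ⊗ H` are determined by their values on the
elements `β(x ⊗ y)`. -/
theorem addHom_ext_of_isGalois {X : Type*} [AddCommGroup X] {f g : A ⊗[k] H →+ X}
    (h : ∀ x y : A, f ((x ⊗ₜ[k] (1 : H)) * ρ.coact y) = g ((x ⊗ₜ[k] (1 : H)) * ρ.coact y)) :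
    f = g := by
  have : f.comp ρ.canonical = g.comp ρ.canonical := SelfTensor.hom_ext h
  ext t
  obtain ⟨s, rfl⟩ := hρ.2 t
  exact DFunLike.congr_fun this s

/-- For a `B`-linear map `f : M → N` of right `A`-modules and `m : M`, the additive map
`A ⊗ H → N` which sends `β(x ⊗ y)` to `f (m x) y`. -/
def sandwichExt (f : ρ.res.obj M ⟶ ρ.res.obj N) (m : M) : A ⊗[k] H →+ N :=
  (ρ.sandwich f m).comp (AddEquiv.ofBijective ρ.canonical hρ).symm.toAddMonoidHom

theorem sandwichExt_canonical (f : ρ.res.obj M ⟶ ρ.res.obj N) (m : M)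
    (t : SelfTensor ρ.coinvariants) :
    ρ.sandwichExt hρ f m (ρ.canonical t) = ρ.sandwich f m t :=
  congrArg (ρ.sandwich f m) ((AddEquiv.ofBijective ρ.canonical hρ).symm_apply_apply t)

/-- The map `sandwichExt f` is `A`-linear on both sides. -/
theorem sandwichExt_mul (f : ρ.res.obj M ⟶ ρ.res.obj N) (m : M) (x y : A) (t : A ⊗[k] H) :
    ρ.sandwichExt hρ f m ((x ⊗ₜ[k] (1 : H)) * t * ρ.coact y) =
      op y • ρ.sandwichExt hρ f (op x • m) t := by
  have : (ρ.sandwichExt hρ f m).comp ((AddMonoidHom.mulRight (ρ.coact y)).comp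
      (AddMonoidHom.mulLeft (x ⊗ₜ[k] (1 : H)))) =
      (DistribSMul.toAddMonoidHom N (op y)).comp (ρ.sandwichExt hρ f (op x • m)) := by
    refine ρ.addHom_ext_of_isGalois hρ fun u v => ?_
    have h₁ : (x ⊗ₜ[k] (1 : H)) * ((u ⊗ₜ[k] (1 : H)) * ρ.coact v) * ρ.coact y =
        ρ.canonical (SelfTensor.tmul (x * u) (v * y)) := by
      simp [mul_assoc, ← mul_assoc (x ⊗ₜ[k] (1 : H))]
    have h₂ := ρ.sandwichExt_canonical hρ f (op x • m) (SelfTensor.tmul u v)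
    rw [canonical_mk] at h₂
    change ρ.sandwichExt hρ f m ((x ⊗ₜ[k] (1 : H)) * ((u ⊗ₜ[k] (1 : H)) * ρ.coact v) *
      ρ.coact y) = op y • ρ.sandwichExt hρ f (op x • m) ((u ⊗ₜ[k] (1 : H)) * ρ.coact v)
    rw [h₁, sandwichExt_canonical, h₂]
    simp only [sandwich_mk, op_mul, mul_smul]
  exact DFunLike.congr_fun this t

theorem sandwichExt_one_mul (f : ρ.res.obj M ⟶ ρ.res.obj N) (m : M) (y : A) (t : A ⊗[k] H) :
    ρ.sandwichExt hρ f m (t * ρ.coact y) = op y • ρ.sandwichExt hρ f m t := by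
  simpa [← Algebra.TensorProduct.one_def] using ρ.sandwichExt_mul hρ f m 1 y t

theorem sandwichExt_coact (f : ρ.res.obj M ⟶ ρ.res.obj N) (m : M) (a : A) :
    ρ.sandwichExt hρ f m (ρ.coact a) = op a • ρ.toAddHom f m := by
  have := ρ.sandwichExt_canonical hρ f m (SelfTensor.tmul 1 a)
  simpa [← Algebra.TensorProduct.one_def] using this

theorem sandwichExt_tmul_mul (f : ρ.res.obj M ⟶ ρ.res.obj N) (m : M) (x : A) (t : A ⊗[k] H) :
    ρ.sandwichExt hρ f m ((x ⊗ₜ[k] (1 : H)) * t) = ρ.sandwichExt hρ f (op x • m) t := by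
  simpa using ρ.sandwichExt_mul hρ f m x 1 t

theorem sandwichExt_smul (f : ρ.res.obj M ⟶ ρ.res.obj N) (m : M) (c : k) (t : A ⊗[k] H) :
    ρ.sandwichExt hρ f m (c • t) = c • ρ.sandwichExt hρ f m t := by
  have h := ρ.sandwichExt_one_mul hρ f m (algebraMap k A c) t
  rw [AlgHom.commutes, ← Algebra.commutes, ← Algebra.smul_def] at h
  exact h

/-- The `B`-linear map `f ◁ h` given by `(f ◁ h)(m) = ∑ f (m X) Y` with `∑ X ⊗ Y = β⁻¹(1 ⊗ h)`, for a
`B`-linear map `f` of right `A`-modules. It gives a right action of `H`; composed with the antipode,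
it is the left action `homAct`. -/
def twist (h : H) (f : ρ.res.obj M ⟶ ρ.res.obj N) : ρ.res.obj M ⟶ ρ.res.obj N :=
  ModuleCat.ofHom (X := ρ.res.obj M) (Y := ρ.res.obj N)
  { toFun := fun m => ρ.sandwich f m (ρ.translation hρ h)
    map_add' := fun m m' => DFunLike.congr_fun (ρ.sandwich_add f m m') _
    map_smul' := fun b m => by
      refine (DFunLike.congr_fun (ρ.sandwich_smul f b.unop m) _).trans ?_
      refine Eq.trans ?_ (ρ.smul_sandwich f b.unop m _).symm
      exact congrArg (ρ.sandwich f m) (ρ.lmul_translation hρ b.unop _) }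

theorem homAct_eq_twist (h : H) (f : ρ.res.obj M ⟶ ρ.res.obj N) :
    ρ.homAct hρ h f = ρ.twist hρ (antipode k h) f := rfl

theorem twist_apply (h : H) (f : ρ.res.obj M ⟶ ρ.res.obj N) (m : M) :
    ρ.toAddHom (ρ.twist hρ h f) m = ρ.sandwichExt hρ f m (1 ⊗ₜ h) := rfl

theorem sandwichExt_tmul (f : ρ.res.obj M ⟶ ρ.res.obj N) (m : M) (x : A) (h : H) :
    ρ.sandwichExt hρ f m (x ⊗ₜ h) = ρ.toAddHom (ρ.twist hρ h f) (op x • m) := by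
  rw [twist_apply, ← sandwichExt_tmul_mul]
  simp

theorem sandwichExt_add_hom (f g : ρ.res.obj M ⟶ ρ.res.obj N) (m : M) :
    ρ.sandwichExt hρ (f + g) m = ρ.sandwichExt hρ f m + ρ.sandwichExt hρ g m := by
  ext t
  exact DFunLike.congr_fun (ρ.sandwich_map_add f g m) _

theorem toAddHom_smul_hom (c : k) (f : ρ.res.obj M ⟶ ρ.res.obj N) (m : M) :
    ρ.toAddHom (c • f) m = c • ρ.toAddHom f m := rfl

/-- `f ◁ h` as a bilinear map. -/
def twistₗ : H →ₗ[k] (ρ.res.obj M ⟶ ρ.res.obj N) →ₗ[k] (ρ.res.obj M ⟶ ρ.res.obj N) :=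
  LinearMap.mk₂ k (ρ.twist hρ)
    (fun h h' f => ρ.hom_ext_toAddHom fun m => by
      change _ = ρ.toAddHom (ρ.twist hρ h f) m + ρ.toAddHom (ρ.twist hρ h' f) m
      simp only [twist_apply, TensorProduct.tmul_add, map_add])
    (fun c h f => ρ.hom_ext_toAddHom fun m => by
      rw [toAddHom_smul_hom]
      simp only [twist_apply, TensorProduct.tmul_smul, sandwichExt_smul])
    (fun h f g => ρ.hom_ext_toAddHom fun m => by
      change _ = ρ.toAddHom (ρ.twist hρ h f) m + ρ.toAddHom (ρ.twist hρ h g) m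
      simp only [twist_apply, sandwichExt_add_hom, AddMonoidHom.add_apply])
    (fun c h f => ρ.hom_ext_toAddHom fun m => by
      rw [toAddHom_smul_hom, twist_apply, twist_apply, ← sandwichExt_smul]
      have : ρ.sandwichExt hρ (c • f) m = (ρ.sandwichExt hρ f m).comp
          (DistribSMul.toAddMonoidHom (A ⊗[k] H) c) := by
        refine ρ.addHom_ext_of_isGalois hρ fun x y => ?_
        change _ = ρ.sandwichExt hρ f m (c • _)
        rw [sandwichExt_smul, sandwichExt_tmul_mul, sandwichExt_tmul_mul, sandwichExt_coact,
          sandwichExt_coact, toAddHom_smul_hom, smul_comm]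
      exact DFunLike.congr_fun this _)

@[simp]
theorem twistₗ_apply (h : H) (f : ρ.res.obj M ⟶ ρ.res.obj N) :
    ρ.twistₗ hρ h f = ρ.twist hρ h f := rfl

theorem twist_res_map (h : H) (a : M ⟶ N) :
    ρ.twist hρ h (ρ.res.map a) = Coalgebra.counit (R := k) h • ρ.res.map a := by
  refine ρ.hom_ext_toAddHom fun m => ?_
  have : ρ.sandwichExt hρ (ρ.res.map a) m =
      (((LinearMap.toSpanSingleton Aᵐᵒᵖ N (a.hom m)).toAddMonoidHom.comp opAddEquiv.toAddMonoidHom).comp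
        (TensorProduct.rid k A).toLinearMap.toAddMonoidHom).comp
        ((Coalgebra.counit (R := k) (A := H)).lTensor A).toAddMonoidHom := by
    refine ρ.addHom_ext_of_isGalois hρ fun x y => ?_
    have h₁ : ∀ t : A ⊗[k] H, TensorProduct.rid k A ((Coalgebra.counit (R := k) (A := H)).lTensor A
        ((x ⊗ₜ[k] (1 : H)) * t)) = x * TensorProduct.rid k A
          ((Coalgebra.counit (R := k) (A := H)).lTensor A t) := fun t => by
      induction t using TensorProduct.induction_on with
      | zero => simp
      | add s t hs ht => simp only [mul_add, map_add, hs, ht]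
      | tmul a h => simp
    rw [sandwichExt_tmul_mul, sandwichExt_coact]
    change op y • a.hom (op x • m) = op (TensorProduct.rid k A ((Coalgebra.counit (R := k) (A := H)).lTensor A
        ((x ⊗ₜ[k] (1 : H)) * ρ.coact y))) • a.hom m
    rw [h₁, ρ.counit, map_smul, op_mul, mul_smul]
  rw [twist_apply, this, toAddHom_smul_hom]
  change op (TensorProduct.rid k A ((Coalgebra.counit (R := k) (A := H)).lTensor A
        ((1 ⊗ₜ[k] h)))) • a.hom m = _
  rw [LinearMap.lTensor_tmul, TensorProduct.rid_tmul, op_smul, op_one]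
  exact (smul_assoc _ _ _).trans (congrArg _ (one_smul _ _))

theorem twist_one (f : ρ.res.obj M ⟶ ρ.res.obj N) : ρ.twist hρ 1 f = f := by
  refine ρ.hom_ext_toAddHom fun m => ?_
  have := ρ.sandwichExt_coact hρ f m 1
  rw [map_one, op_one, one_smul] at this
  exact this

theorem sandwichExt_twist (h : H) (f : ρ.res.obj M ⟶ ρ.res.obj N) (m : M) (t : A ⊗[k] H) :
    ρ.sandwichExt hρ (ρ.twist hρ h f) m t = ρ.sandwichExt hρ f m ((1 ⊗ₜ h) * t) := by
  have : ρ.sandwichExt hρ (ρ.twist hρ h f) m = (ρ.sandwichExt hρ f m).comp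
      (AddMonoidHom.mulLeft (1 ⊗ₜ[k] h)) := by
    refine ρ.addHom_ext_of_isGalois hρ fun x y => ?_
    rw [sandwichExt_tmul_mul, sandwichExt_coact, twist_apply, ← sandwichExt_mul]
    simp [← mul_assoc]
  exact DFunLike.congr_fun this t

theorem twist_twist (g h : H) (f : ρ.res.obj M ⟶ ρ.res.obj N) :
    ρ.twist hρ g (ρ.twist hρ h f) = ρ.twist hρ (h * g) f := by
  refine ρ.hom_ext_toAddHom fun m => ?_
  rw [twist_apply, sandwichExt_twist, twist_apply]
  simp

/-- For `B`-linear maps `f : M → N` and `g : N → P`, the map `A ⊗ H → P` which sends `β(x ⊗ y)` to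
`g (f (m x)) y` is `x ⊗ h ↦ ∑ (g ◁ h₂)((f ◁ h₁)(m x))`. -/
theorem sandwichExt_comp (f : ρ.res.obj M ⟶ ρ.res.obj N) (g : ρ.res.obj N ⟶ ρ.res.obj P) (m : M)
    {ι : Type*} {h : H} (𝓡 : Repr k h ι) :
    ρ.sandwichExt hρ (f ≫ g) m (1 ⊗ₜ h) = ∑ i ∈ 𝓡.index,
      ρ.sandwichExt hρ g (ρ.sandwichExt hρ f m (1 ⊗ₜ 𝓡.left i)) (1 ⊗ₜ 𝓡.right i) := by
  let F : A ⊗[k] H →ₗ[k] N := ⟨(ρ.sandwichExt hρ f m).toAddHom, ρ.sandwichExt_smul hρ f m⟩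
  let G : N →ₗ[k] H →ₗ[k] P := LinearMap.mk₂ k
    (fun n l => ρ.toAddHom (ρ.twist hρ l g) n) (fun n n' l => map_add _ _ _)
    (fun c n l => ρ.toAddHom_smul (ρ.twist hρ l g) (algebraMap k ρ.coinvariants c) n)
    (fun n l l' => by simp only [twist_apply, TensorProduct.tmul_add, map_add])
    (fun c n l => by simp only [twist_apply, TensorProduct.tmul_smul, sandwichExt_smul])
  let L : A ⊗[k] (H ⊗[k] H) →ₗ[k] P := TensorProduct.lift G ∘ₗ F.rTensor H ∘ₗ
    (TensorProduct.assoc k A H H).symm.toLinearMap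
  have hL (a : A) (h l : H) : L (a ⊗ₜ (h ⊗ₜ l)) =
      ρ.toAddHom (ρ.twist hρ l g) (ρ.sandwichExt hρ f m (a ⊗ₜ h)) := by
    simp only [L, G, F, LinearMap.comp_apply, LinearEquiv.coe_coe, TensorProduct.assoc_symm_tmul,
      LinearMap.rTensor_tmul, TensorProduct.lift.tmul]
    rfl
  have hL' (x : A) (t : A ⊗[k] H) : L ((x ⊗ₜ[k] (1 : H ⊗[k] H)) *
      TensorProduct.assoc k A H H (ρ.coact.toLinearMap.rTensor H t)) =
      ρ.sandwichExt hρ g (ρ.toAddHom f (op x • m)) t := by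
    induction t using TensorProduct.induction_on with
    | zero => simp
    | add s t hs ht => simp only [mul_add, map_add, hs, ht]
    | tmul a l =>
      have : ∀ s : A ⊗[k] H, L ((x ⊗ₜ[k] (1 : H ⊗[k] H)) * TensorProduct.assoc k A H H (s ⊗ₜ l)) =
          ρ.toAddHom (ρ.twist hρ l g) (ρ.sandwichExt hρ f m ((x ⊗ₜ[k] (1 : H)) * s)) := fun s => by
        induction s using TensorProduct.induction_on with
        | zero => simp
        | add s t hs ht => simp only [mul_add, map_add, TensorProduct.add_tmul, hs, ht]
        | tmul b h => simp [hL]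
      rw [LinearMap.rTensor_tmul, this, AlgHom.toLinearMap_apply, sandwichExt_tmul_mul,
        sandwichExt_coact, ← sandwichExt_tmul]
  have hl (x : A) (t : A ⊗[k] H) : (comul (R := k) (A := H)).lTensor A ((x ⊗ₜ[k] (1 : H)) * t) =
      (x ⊗ₜ[k] (1 : H ⊗[k] H)) * (comul (R := k) (A := H)).lTensor A t := by
    induction t using TensorProduct.induction_on with
    | zero => simp
    | add s t hs ht => simp only [mul_add, map_add, hs, ht]
    | tmul a l => simp
  have key : ρ.sandwichExt hρ (f ≫ g) m =
      (L ∘ₗ (comul (R := k) (A := H)).lTensor A).toAddMonoidHom := by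
    refine ρ.addHom_ext_of_isGalois hρ fun x y => ?_
    change _ = L ((comul (R := k) (A := H)).lTensor A ((x ⊗ₜ[k] (1 : H)) * ρ.coact y))
    rw [hl, ← ρ.coassoc, hL', sandwichExt_tmul_mul, sandwichExt_coact, sandwichExt_coact]
    rfl
  rw [key]
  change L ((comul (R := k) (A := H)).lTensor A (1 ⊗ₜ h)) = _
  rw [LinearMap.lTensor_tmul, ← 𝓡.eq, TensorProduct.tmul_sum, map_sum]
  exact Finset.sum_congr rfl fun i _ => hL _ _ _

theorem twist_comp (f : ρ.res.obj M ⟶ ρ.res.obj N) (g : ρ.res.obj N ⟶ ρ.res.obj P)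
    {ι : Type*} {h : H} (𝓡 : Repr k h ι) :
    ρ.twist hρ h (f ≫ g) =
      ∑ i ∈ 𝓡.index, ρ.twist hρ (𝓡.left i) f ≫ ρ.twist hρ (𝓡.right i) g := by
  refine ρ.hom_ext_toAddHom fun m => ?_
  have : ∀ (s : Finset ι) (F : ι → (ρ.res.obj M ⟶ ρ.res.obj P)),
      ρ.toAddHom (∑ i ∈ s, F i) m = ∑ i ∈ s, ρ.toAddHom (F i) m := fun s F =>
    map_sum (AddMonoidHom.mk' (fun f : ρ.res.obj M ⟶ ρ.res.obj P => ρ.toAddHom f m)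
      fun _ _ => rfl) F s
  rw [twist_apply, sandwichExt_comp ρ hρ f g m 𝓡, this]
  rfl

theorem twist_res_map_comp (h : H) (a : M ⟶ N) (g : ρ.res.obj N ⟶ ρ.res.obj P) :
    ρ.twist hρ h (ρ.res.map a ≫ g) = ρ.res.map a ≫ ρ.twist hρ h g := by
  refine ModuleCat.hom_ext (LinearMap.ext fun m => ?_)
  have : ρ.sandwich (ρ.res.map a ≫ g) m = ρ.sandwich g (a.hom m) :=
    SelfTensor.hom_ext fun x y =>
      congrArg (fun z => op y • ρ.toAddHom g z) (a.hom.map_smul (op x) m)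
  exact DFunLike.congr_fun this _

theorem twist_comp_res_map (h : H) (f : ρ.res.obj M ⟶ ρ.res.obj N) (a : N ⟶ P) :
    ρ.twist hρ h (f ≫ ρ.res.map a) = ρ.twist hρ h f ≫ ρ.res.map a := by
  refine ModuleCat.hom_ext (LinearMap.ext fun m => ?_)
  have : ρ.sandwich (f ≫ ρ.res.map a) m = a.hom.toAddMonoidHom.comp (ρ.sandwich f m) :=
    SelfTensor.hom_ext fun x y => (a.hom.map_smul (op y) (ρ.toAddHom f (op x • m))).symm
  exact DFunLike.congr_fun this _

end Twist

end ComoduleAlgebra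

/-! ### Projectivity of the extension -/

namespace ComoduleAlgebra

variable {k : Type v₁} {H : Type v₂} {A : Type u} [Field k] [Ring H] [HopfAlgebra k H]
    [Ring A] [Algebra k A] (ρ : ComoduleAlgebra k H A) (hρ : ρ.IsGalois)

section Functional

/-- The map `a ↦ ∑ a₀ ξ(a₁)` on `A` defined by a functional `ξ` on `H`. -/
def hit (ξ : H →ₗ[k] k) : A →ₗ[k] A :=
  (TensorProduct.rid k A).toLinearMap ∘ₗ ξ.lTensor A ∘ₗ ρ.coact.toLinearMap

theorem hit_apply (ξ : H →ₗ[k] k) (a : A) :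
    ρ.hit ξ a = TensorProduct.rid k A (ξ.lTensor A (ρ.coact a)) := rfl

theorem rid_lTensor_tmul_mul (ξ : H →ₗ[k] k) (x : A) (t : A ⊗[k] H) :
    TensorProduct.rid k A (ξ.lTensor A ((x ⊗ₜ[k] (1 : H)) * t)) =
      x * TensorProduct.rid k A (ξ.lTensor A t) := by
  induction t using TensorProduct.induction_on with
  | zero => simp
  | add s t hs ht => simp only [mul_add, map_add, hs, ht]
  | tmul a h => simp

theorem rid_lTensor_mul_tmul (ξ : H →ₗ[k] k) (x : A) (t : A ⊗[k] H) :
    TensorProduct.rid k A (ξ.lTensor A (t * (x ⊗ₜ[k] (1 : H)))) =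
      TensorProduct.rid k A (ξ.lTensor A t) * x := by
  induction t using TensorProduct.induction_on with
  | zero => simp
  | add s t hs ht => simp only [add_mul, map_add, hs, ht]
  | tmul a h => simp

theorem hit_coe_mul (ξ : H →ₗ[k] k) (b : ρ.coinvariants) (a : A) :
    ρ.hit ξ (b * a) = b * ρ.hit ξ a := by
  rw [hit_apply, map_mul, coact_coe, rid_lTensor_tmul_mul, hit_apply]

theorem hit_mul_coe (ξ : H →ₗ[k] k) (a : A) (b : ρ.coinvariants) :
    ρ.hit ξ (a * b) = ρ.hit ξ a * b := by
  rw [hit_apply, map_mul, coact_coe, rid_lTensor_mul_tmul, hit_apply]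

theorem sum_rid_lTensor_coord {ι : Type*} [Fintype ι] (b : Module.Basis ι k H) (t : A ⊗[k] H) :
    ∑ i, TensorProduct.rid k A ((b.coord i).lTensor A t) ⊗ₜ[k] b i = t := by
  induction t using TensorProduct.induction_on with
  | zero => simp
  | add s t hs ht =>
    simp only [map_add, TensorProduct.add_tmul, Finset.sum_add_distrib, hs, ht]
  | tmul a h =>
    conv_rhs => rw [← b.sum_repr h, TensorProduct.tmul_sum]
    refine Finset.sum_congr rfl fun i _ => ?_
    rw [LinearMap.lTensor_tmul, TensorProduct.rid_tmul, TensorProduct.smul_tmul]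
    rfl

/-- If `T` is an integral of `H^*`, then `a ↦ ∑ a₀ T(a₁)` takes values in the coinvariants. -/
theorem hit_mem_coinvariants {T : H →ₗ[k] k} (hT : ∀ h, leftHit T h = T h • 1) (a : A) :
    ρ.hit T a ∈ ρ.coinvariants := by
  change ρ.coact (ρ.hit T a) = ρ.hit T a ⊗ₜ[k] (1 : H)
  have h₁ : ∀ t : A ⊗[k] H, ρ.coact (TensorProduct.rid k A (T.lTensor A t)) =
      (TensorProduct.rid k H ∘ₗ T.lTensor H).lTensor A
        (TensorProduct.assoc k A H H (ρ.coact.toLinearMap.rTensor H t)) := fun t => by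
    induction t using TensorProduct.induction_on with
    | zero => simp
    | add s t hs ht => simp only [map_add, hs, ht]
    | tmul a h =>
      simp only [LinearMap.lTensor_tmul, TensorProduct.rid_tmul, map_smul, LinearMap.rTensor_tmul,
        AlgHom.toLinearMap_apply]
      generalize ρ.coact a = s
      induction s using TensorProduct.induction_on with
      | zero => simp
      | add s t hs ht => simp only [map_add, smul_add, TensorProduct.add_tmul, hs, ht]
      | tmul b l => simp
  have h₂ : ∀ t : A ⊗[k] H, (TensorProduct.rid k H ∘ₗ T.lTensor H).lTensor A
      ((comul (R := k) (A := H)).lTensor A t) =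
        TensorProduct.rid k A (T.lTensor A t) ⊗ₜ[k] (1 : H) := fun t => by
    induction t using TensorProduct.induction_on with
    | zero => simp
    | add s t hs ht => simp only [map_add, TensorProduct.add_tmul, hs, ht]
    | tmul b l =>
      have : TensorProduct.rid k H (T.lTensor H (comul l)) = T l • 1 := hT l
      simp [this, TensorProduct.smul_tmul]
  rw [hit_apply, h₁, ρ.coassoc, h₂]

end Functional

section Projective

theorem SelfTensor_exists_sum {B : Subalgebra k A} (t : SelfTensor B) :
    ∃ (n : ℕ) (x y : Fin n → A), t = ∑ i, SelfTensor.tmul (x i) (y i) := by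
  obtain ⟨t, rfl⟩ := QuotientAddGroup.mk_surjective t
  induction t using TensorProduct.induction_on with
  | zero => exact ⟨0, Fin.elim0, Fin.elim0, rfl⟩
  | tmul x y => exact ⟨1, fun _ => x, fun _ => y, by simp; rfl⟩
  | add s t hs ht =>
    obtain ⟨n, x, y, hs⟩ := hs
    obtain ⟨m, x', y', ht⟩ := ht
    refine ⟨n + m, Fin.append x x', Fin.append y y', ?_⟩
    rw [QuotientAddGroup.mk_add, hs, ht, Fin.sum_univ_add]
    simp

variable [Module.Finite k H] (hS : Function.Bijective (antipode k (A := H)))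

include hS hρ in
/-- A dual basis for `A` as a right `B`-module. For an integral `T` of `H^*` and `Λ ∈ H` with
`∑ X ⊗ Y = β⁻¹(1 ⊗ Λ)`, one has `∑ X T(Y a) = ∑ a₀ T(Λ a₁)`, where `T(a) = ∑ a₀ T(a₁) ∈ B`. -/
theorem exists_dual_basis : ∃ (n : ℕ) (x : Fin n → A) (φ : Fin n → A → ρ.coinvariants),
    (∀ i a a', φ i (a + a') = φ i a + φ i a') ∧ (∀ i a (b : ρ.coinvariants), φ i (a * b) = φ i a * b) ∧
      ∀ a, ∑ i, x i * φ i a = a := by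
  let e := LinearEquiv.ofBijective (antipode k (A := H)) hS
  let s : H →ₗ[k] H := e.symm.toLinearMap
  have hs : ∀ h, s (antipode k h) = h := e.symm_apply_apply
  have hs' : ∀ h, antipode k (s h) = h := e.apply_symm_apply
  let b := Module.finBasis k H
  let T (j) := traceIntegral s (b.coord j)
  have hT (j) := leftHit_traceIntegral hs hs' (b.coord j)
  choose n x y hxy using fun j => SelfTensor_exists_sum (ρ.translation hρ (s (b j)))
  have h₁ (j) : ∑ i, (x j i ⊗ₜ[k] (1 : H)) * ρ.coact (y j i) = 1 ⊗ₜ s (b j) := by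
    rw [← ρ.canonical_translation hρ, hxy, map_sum]
    rfl
  have h₂ (j) (a : A) : ∑ i, x j i * ρ.hit (T j) (y j i * a) =
      TensorProduct.rid k A ((T j).lTensor A ((1 ⊗ₜ s (b j)) * ρ.coact a)) := by
    rw [← h₁, Finset.sum_mul, map_sum, map_sum]
    refine Finset.sum_congr rfl fun i _ => ?_
    rw [mul_assoc, rid_lTensor_tmul_mul, ← map_mul, hit_apply]
  have h₃ (t : A ⊗[k] H) :
      ∑ j, TensorProduct.rid k A ((T j).lTensor A ((1 ⊗ₜ s (b j)) * t)) =
        TensorProduct.rid k A ((Coalgebra.counit (R := k) (A := H)).lTensor A t) := by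
    induction t using TensorProduct.induction_on with
    | zero => simp
    | add s t hs ht => simp only [mul_add, map_add, Finset.sum_add_distrib, hs, ht]
    | tmul a h =>
      simp only [Algebra.TensorProduct.tmul_mul_tmul, LinearMap.lTensor_tmul, one_mul,
        TensorProduct.rid_tmul, ← Finset.sum_smul, T, sum_traceIntegral hs hs']
  let J := Σ j, Fin (n j)
  let x' : J → A := fun p => x p.1 p.2
  let φ' : J → A → ρ.coinvariants := fun p a =>
    ⟨ρ.hit (T p.1) (y p.1 p.2 * a), ρ.hit_mem_coinvariants (hT p.1) _⟩
  let q := Fintype.equivFin J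
  refine ⟨_, x' ∘ q.symm, φ' ∘ q.symm, fun i a a' => Subtype.ext ?_, fun i a c => Subtype.ext ?_,
    fun a => ?_⟩
  · simp [φ', mul_add]
  · simp [φ', ← mul_assoc, hit_mul_coe]
  · refine (q.symm.sum_comp (fun p => x' p * (φ' p a : A))).trans ?_
    rw [Fintype.sum_sigma]
    refine (Finset.sum_congr rfl fun j _ => h₂ j a).trans ?_
    rw [h₃, ρ.counit]

include hS hρ in
theorem projective_res_self :
    Module.Projective (ρ.coinvariants)ᵐᵒᵖ (ρ.res.obj (ModuleCat.of Aᵐᵒᵖ Aᵐᵒᵖ)) := by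
  obtain ⟨n, x, φ, h₁, h₂, h₃⟩ := ρ.exists_dual_basis hρ hS
  let i : ρ.res.obj (ModuleCat.of Aᵐᵒᵖ Aᵐᵒᵖ) →ₗ[(ρ.coinvariants)ᵐᵒᵖ] (Fin n → (ρ.coinvariants)ᵐᵒᵖ) :=
    { toFun := fun a j => op (φ j (unop (show Aᵐᵒᵖ from a)))
      map_add' := fun a a' => funext fun j => congrArg op (h₁ j _ _)
      map_smul' := fun c a => funext fun j => congrArg op (h₂ j _ _) }
  let p : (Fin n → (ρ.coinvariants)ᵐᵒᵖ) →ₗ[(ρ.coinvariants)ᵐᵒᵖ] ρ.res.obj (ModuleCat.of Aᵐᵒᵖ Aᵐᵒᵖ) :=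
    Fintype.linearCombination _ (fun j => show ρ.res.obj (ModuleCat.of Aᵐᵒᵖ Aᵐᵒᵖ) from op (x j))
  refine Module.Projective.of_split i p (LinearMap.ext fun a => ?_)
  have : p (i a) = ∑ j, op (x j * φ j (unop (show Aᵐᵒᵖ from a))) := rfl
  rw [LinearMap.comp_apply, this]
  refine Eq.trans ?_ (congrArg op (h₃ (unop (show Aᵐᵒᵖ from a))))
  exact (map_sum opAddEquiv _ _).symm

include hS hρ in
/-- Projective right `A`-modules are projective as right `B`-modules. -/
theorem projective_res (P : ModuleCat.{u} Aᵐᵒᵖ) [Projective P] : Projective (ρ.res.obj P) := by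
  rw [← IsProjective.iff_projective] at *
  obtain ⟨s, hs⟩ := Module.projective_def'.1 ‹Module.Projective Aᵐᵒᵖ P›
  have := ρ.projective_res_self hρ hS
  let F : ModuleCat.{u} Aᵐᵒᵖ := ModuleCat.of Aᵐᵒᵖ (P →₀ Aᵐᵒᵖ)
  let e : ρ.res.obj F ≃ₗ[(ρ.coinvariants)ᵐᵒᵖ] (P →₀ ρ.res.obj (ModuleCat.of Aᵐᵒᵖ Aᵐᵒᵖ)) :=
    { AddEquiv.refl (P →₀ Aᵐᵒᵖ) with map_smul' := fun _ _ => rfl }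
  have : Module.Projective (ρ.coinvariants)ᵐᵒᵖ (P →₀ ρ.res.obj (ModuleCat.of Aᵐᵒᵖ Aᵐᵒᵖ)) := by
    classical
    exact Module.Projective.of_equiv
      (finsuppLequivDFinsupp (M := ρ.res.obj (ModuleCat.of Aᵐᵒᵖ Aᵐᵒᵖ)) (ρ.coinvariants)ᵐᵒᵖ).symm
  have : Module.Projective (ρ.coinvariants)ᵐᵒᵖ (ρ.res.obj F) := Module.Projective.of_equiv e.symm
  refine Module.Projective.of_split (ρ.res.map (X := P) (Y := F) (ModuleCat.ofHom s)).hom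
    (ρ.res.map (X := F) (Y := P) (ModuleCat.ofHom (Finsupp.linearCombination _ id))).hom ?_
  exact LinearMap.ext fun p => LinearMap.congr_fun hs p

end Projective

end ComoduleAlgebra

/-! ### Induced modules -/

section Induced

variable {S R : Type u} [Ring S] [Ring R] (φ : S →+* R)

/-- The unit `m ↦ 1 ⊗ m` of the adjunction between extension and restriction of scalars. -/
def inducedUnit (M : ModuleCat.{u} S) :
    M ⟶ (ModuleCat.restrictScalars φ).obj ((inducedModule φ).obj M) :=
  ModuleCat.ofHom (Y := (ModuleCat.restrictScalars φ).obj ((inducedModule φ).obj M))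
  { toFun := fun m => (Submodule.Quotient.mk ((1 : R) ⊗ₜ[ℤ] m) : (R ⊗[ℤ] M) ⧸ balancing φ M)
    map_add' := fun m m' => congrArg Submodule.Quotient.mk (TensorProduct.tmul_add (1 : R) m m')
    map_smul' := fun s m => by
      refine ((Submodule.Quotient.eq (balancing φ M)).2
        (Submodule.subset_span ⟨1, s, m, rfl⟩)).symm.trans ?_
      change Submodule.Quotient.mk ((1 * φ s) ⊗ₜ[ℤ] m) =
        φ s • (Submodule.Quotient.mk ((1 : R) ⊗ₜ[ℤ] m) : (R ⊗[ℤ] M) ⧸ balancing φ M)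
      rw [← Submodule.Quotient.mk_smul, TensorProduct.smul_tmul', smul_eq_mul, one_mul, mul_one] }

variable {M N : ModuleCat.{u} S} {Y Z : ModuleCat.{u} R}

theorem mk_tmul_eq_smul (r : R) (m : M) :
    (Submodule.Quotient.mk (r ⊗ₜ[ℤ] m) : (R ⊗[ℤ] M) ⧸ balancing φ M) =
      r • ((inducedUnit φ M).hom m : (inducedModule φ).obj M) := by
  change _ = r • (Submodule.Quotient.mk ((1 : R) ⊗ₜ[ℤ] m) : (R ⊗[ℤ] M) ⧸ balancing φ M)
  rw [← Submodule.Quotient.mk_smul, TensorProduct.smul_tmul', smul_eq_mul, mul_one]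

theorem induced_hom_ext {f g : (inducedModule φ).obj M ⟶ Y}
    (h : inducedUnit φ M ≫ (ModuleCat.restrictScalars φ).map f =
      inducedUnit φ M ≫ (ModuleCat.restrictScalars φ).map g) : f = g := by
  refine ModuleCat.hom_ext (balanced_ext φ fun r m => ?_)
  rw [mk_tmul_eq_smul]
  have h' : f.hom ((inducedUnit φ M).hom m) = g.hom ((inducedUnit φ M).hom m) :=
    LinearMap.congr_fun (congrArg ModuleCat.Hom.hom h) m
  exact (f.hom.map_smul r _).trans ((congrArg (r • ·) h').trans (g.hom.map_smul r _).symm)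

/-- The `R`-linear extension `r ⊗ m ↦ r g(m)` of an `S`-linear map `g : M → Y`. -/
def inducedDesc (g : M ⟶ (ModuleCat.restrictScalars φ).obj Y) : (inducedModule φ).obj M ⟶ Y :=
  ModuleCat.ofHom (X := (R ⊗[ℤ] M) ⧸ balancing φ M)
    (Submodule.liftQ (balancing φ M)
      (TensorProduct.AlgebraTensorModule.lift
        { toFun := fun r => r • (g.hom.toAddMonoidHom.toIntLinearMap : M →ₗ[ℤ] Y)
          map_add' := fun r r' => add_smul r r' _
          map_smul' := fun r r' => mul_smul r r' _ })
      (by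
        rw [balancing, Submodule.span_le]
        rintro _ ⟨r, s, m, rfl⟩
        have h : g.hom (s • m) = φ s • (g.hom m : Y) := g.hom.map_smul s m
        change _ = (0 : Y)
        rw [map_sub, sub_eq_zero]
        change (r * φ s) • (g.hom m : Y) = r • (g.hom (s • m) : Y)
        rw [h, mul_smul]))

theorem inducedUnit_inducedDesc (g : M ⟶ (ModuleCat.restrictScalars φ).obj Y) :
    inducedUnit φ M ≫ (ModuleCat.restrictScalars φ).map (inducedDesc φ g) = g :=
  ModuleCat.hom_ext (LinearMap.ext fun m => one_smul R (g.hom m : Y))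

theorem inducedUnit_naturality (f : M ⟶ N) :
    inducedUnit φ M ≫ (ModuleCat.restrictScalars φ).map ((inducedModule φ).map f) =
      f ≫ inducedUnit φ N :=
  rfl

/-- Extension of scalars is left adjoint to restriction, which preserves epimorphisms. -/
theorem projective_induced (M : ModuleCat.{u} S) [Projective M] :
    Projective ((inducedModule φ).obj M) where
  factors {E X} f e _ := by
    have : Epi ((ModuleCat.restrictScalars φ).map e) := by
      rw [ModuleCat.epi_iff_surjective] at *
      assumption
    refine ⟨inducedDesc φ (Projective.factorThru
      (inducedUnit φ M ≫ (ModuleCat.restrictScalars φ).map f)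
      ((ModuleCat.restrictScalars φ).map e)), induced_hom_ext φ ?_⟩
    rw [Functor.map_comp, ← Category.assoc, inducedUnit_inducedDesc, Projective.factorThru_comp]

end Induced

namespace ComoduleAlgebra

variable {k : Type v₁} {H : Type v₂} {A : Type u} [Field k] [Ring H] [HopfAlgebra k H]
    [Ring A] [Algebra k A] (ρ : ComoduleAlgebra k H A) (hρ : ρ.IsGalois)

instance : ρ.ind.Linear k where
  map_smul {M N} f c := by
    refine induced_hom_ext _ ?_
    have h₁ : (ModuleCat.restrictScalars ρ.inclOp).map (c • ρ.ind.map f) =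
      c • (ModuleCat.restrictScalars ρ.inclOp).map (ρ.ind.map f) := rfl
    rw [h₁, Linear.comp_smul, inducedUnit_naturality, inducedUnit_naturality, Linear.smul_comp]

instance : ρ.res.Linear k where
  map_smul _ _ := rfl

/-- The `B`-linear map `M → M ⊗_B A`, `m ↦ m ⊗ 1`. -/
abbrev unit (M : ModuleCat.{u} (ρ.coinvariants)ᵐᵒᵖ) : M ⟶ ρ.res.obj (ρ.ind.obj M) :=
  inducedUnit ρ.inclOp M

section

variable (M : ModuleCat.{u} Aᵐᵒᵖ) {N : ModuleCat.{u} Aᵐᵒᵖ}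

/-- The `A`-linear endomorphism of `M ⊗_B A` which extends `m ↦ ∑ m X ⊗ Y`, where
`∑ X ⊗ Y = β⁻¹(1 ⊗ h)`. Under the isomorphism of `M ⊗_B A` with `M ⊗ H` given by `β`, it is the
left multiplication by `h` on `H`. -/
def leftMul (h : H) : ρ.ind.obj (ρ.res.obj M) ⟶ ρ.ind.obj (ρ.res.obj M) :=
  inducedDesc ρ.inclOp (ρ.twist hρ h (ρ.unit (ρ.res.obj M)))

theorem unit_leftMul (h : H) :
    ρ.unit (ρ.res.obj M) ≫ ρ.res.map (ρ.leftMul hρ M h) = ρ.twist hρ h (ρ.unit (ρ.res.obj M)) :=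
  inducedUnit_inducedDesc _ _

theorem leftMul_comp_leftMul (g h : H) :
    ρ.leftMul hρ M h ≫ ρ.leftMul hρ M g = ρ.leftMul hρ M (g * h) := by
  refine induced_hom_ext _ ?_
  rw [Functor.map_comp, ← Category.assoc, unit_leftMul, unit_leftMul, ← twist_comp_res_map,
    unit_leftMul, twist_twist]

theorem leftMul_one : ρ.leftMul hρ M 1 = 𝟙 _ := by
  refine induced_hom_ext _ ?_
  rw [unit_leftMul, twist_one, CategoryTheory.Functor.map_id, Category.comp_id]

theorem leftMul_add (g h : H) :
    ρ.leftMul hρ M (g + h) = ρ.leftMul hρ M g + ρ.leftMul hρ M h := by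
  refine induced_hom_ext _ ?_
  rw [Functor.map_add, Preadditive.comp_add, unit_leftMul, unit_leftMul, unit_leftMul]
  exact congr($(map_add (ρ.twistₗ hρ) g h) _)

theorem leftMul_smul (c : k) (h : H) :
    ρ.leftMul hρ M (c • h) = c • ρ.leftMul hρ M h := by
  refine induced_hom_ext _ ?_
  rw [Functor.map_smul, Linear.comp_smul, unit_leftMul, unit_leftMul]
  exact congr($(map_smul (ρ.twistₗ hρ) c h) _)

variable {M}

theorem leftMul_naturality (h : H) (a : M ⟶ N) :
    ρ.ind.map (ρ.res.map a) ≫ ρ.leftMul hρ N h = ρ.leftMul hρ M h ≫ ρ.ind.map (ρ.res.map a) := by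
  refine induced_hom_ext _ ?_
  rw [Functor.map_comp, Functor.map_comp, ← Category.assoc, ← Category.assoc,
    inducedUnit_naturality, unit_leftMul, Category.assoc, unit_leftMul, ← twist_comp_res_map,
    inducedUnit_naturality, twist_res_map_comp]

/-- The commutation rule `(1 # h) (f # 1) = ∑ (h₁ · f # 1) (1 # h₂)`. -/
theorem ind_map_comp_leftMul (f : ρ.res.obj M ⟶ ρ.res.obj N) {ι : Type*} {h : H}
    (𝓡 : Repr k h ι) : ρ.ind.map f ≫ ρ.leftMul hρ N h =
      ∑ i ∈ 𝓡.index, ρ.leftMul hρ M (𝓡.right i) ≫ ρ.ind.map (ρ.homAct hρ (𝓡.left i) f) := by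
  refine induced_hom_ext _ ?_
  have h₁ (i : ι) : ρ.unit (ρ.res.obj M) ≫
      ρ.res.map (ρ.leftMul hρ M (𝓡.right i) ≫ ρ.ind.map (ρ.homAct hρ (𝓡.left i) f)) =
      ∑ j ∈ (ℛ k (𝓡.right i)).index,
        ρ.twist hρ (antipode k (𝓡.left i) * (ℛ k (𝓡.right i)).left j) f ≫
          ρ.twist hρ ((ℛ k (𝓡.right i)).right j) (ρ.unit (ρ.res.obj N)) := by
    rw [Functor.map_comp, ← Category.assoc, unit_leftMul, ← twist_comp_res_map,
      inducedUnit_naturality, twist_comp ρ hρ _ _ (ℛ k (𝓡.right i))]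
    simp only [homAct_eq_twist, twist_twist]
  rw [Functor.map_comp, ← Category.assoc, inducedUnit_naturality, Category.assoc, unit_leftMul,
    Functor.map_sum, Preadditive.comp_sum, Finset.sum_congr rfl fun i _ => h₁ i]
  -- `∑ S(h₁) h₂ ⊗ h₃ = 1 ⊗ h`
  let Ψ : H ⊗[k] H →ₗ[k] (ρ.res.obj M ⟶ ρ.res.obj (ρ.ind.obj (ρ.res.obj N))) :=
    TensorProduct.lift ((Linear.comp _ _ _).compl₁₂ ((ρ.twistₗ hρ).flip f)
      ((ρ.twistₗ hρ).flip (ρ.unit (ρ.res.obj N))))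
  have hΨ (g l : H) : Ψ (g ⊗ₜ l) = ρ.twist hρ g f ≫ ρ.twist hρ l (ρ.unit (ρ.res.obj N)) := by
    simp [Ψ]
  have e := congr(Ψ $(sum_antipode_tmul_one_mul_comul 𝓡))
  rw [hΨ, twist_one, map_sum] at e
  rw [← e]
  refine Finset.sum_congr rfl fun i _ => ?_
  rw [← (ℛ k (𝓡.right i)).eq, Finset.mul_sum, map_sum]
  refine Finset.sum_congr rfl fun j _ => ?_
  rw [Algebra.TensorProduct.tmul_mul_tmul, one_mul, hΨ]

variable (M)

/-- For a functional `ξ` on `H`, the `B`-linear map `M ⊗_B A → M`, `m ⊗ a ↦ ∑ m a₀ ξ(a₁)`. -/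
def contract (ξ : H →ₗ[k] k) : ρ.res.obj (ρ.ind.obj (ρ.res.obj M)) ⟶ ρ.res.obj M :=
  let F₀ : Aᵐᵒᵖ ⊗[ℤ] M →ₗ[ℤ] M := TensorProduct.lift (LinearMap.mk₂ ℤ
    (fun (a : Aᵐᵒᵖ) (m : M) => op (ρ.hit ξ a.unop) • m)
    (fun a a' m => by rw [MulOpposite.unop_add, map_add, MulOpposite.op_add, add_smul])
    (fun c a m => by rw [MulOpposite.unop_smul, map_zsmul, MulOpposite.op_smul, smul_assoc])
    (fun a m m' => smul_add _ m m')
    (fun c a m => smul_comm _ c m))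
  let F : Aᵐᵒᵖ ⊗[ℤ] ρ.res.obj M →ₗ[ℤ] M := F₀
  have hF : ∀ t ∈ balancing ρ.inclOp (ρ.res.obj M), ∀ r : Aᵐᵒᵖ, F (r • t) = 0 := fun t ht => by
    refine Submodule.span_induction ?_ ?_ ?_ ?_ ht
    · rintro _ ⟨r, s, m, rfl⟩ r'
      rw [smul_sub, map_sub, sub_eq_zero]
      change op (ρ.hit ξ (unop (r' * (r * ρ.inclOp s)))) • (m : M) =
        op (ρ.hit ξ (unop (r' * r))) • (ρ.inclOp s • (m : M))
      rw [← mul_assoc, smul_smul]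
      congr 1
      exact congrArg op (ρ.hit_coe_mul ξ s.unop (unop (r' * r)))
    · intro r; simp
    · intro x y _ _ hx hy r
      rw [smul_add, map_add, hx, hy, add_zero]
    · intro r x _ hx r'
      rw [smul_smul, hx]
  ModuleCat.ofHom (X := ρ.res.obj (ρ.ind.obj (ρ.res.obj M))) (Y := ρ.res.obj M)
    { toFun := fun t => QuotientAddGroup.lift (balancing ρ.inclOp (ρ.res.obj M)).toAddSubgroup
        F.toAddMonoidHom (fun t ht => by
          have := hF t ht 1
          rwa [one_smul] at this) t
      map_add' := fun s t => map_add _ s t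
      map_smul' := fun b t => by
        obtain ⟨t, rfl⟩ := QuotientAddGroup.mk_surjective t
        change F (ρ.inclOp b • t) = ρ.inclOp b • F t
        induction t using TensorProduct.induction_on with
        | zero => simp
        | add s t hs ht => rw [smul_add, map_add, hs, ht, map_add, smul_add]
        | tmul a m =>
          change op (ρ.hit ξ (unop (ρ.inclOp b * a))) • (m : M) =
            ρ.inclOp b • op (ρ.hit ξ a.unop) • (m : M)
          rw [smul_smul]
          congr 1
          exact congrArg op (ρ.hit_mul_coe ξ a.unop b.unop) }

theorem contract_apply (ξ : H →ₗ[k] k) (a : A) (m : M) :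
    ρ.toAddHom (ρ.contract M ξ) (op a • (ρ.toAddHom (N := ρ.ind.obj (ρ.res.obj M))
      (ρ.unit (ρ.res.obj M)) m)) = op (ρ.hit ξ a) • m := by
  have := (mk_tmul_eq_smul ρ.inclOp (M := ρ.res.obj M) (op a) m).symm
  refine (congrArg (ρ.toAddHom (ρ.contract M ξ)) this).trans ?_
  rfl

theorem induced_addHom_ext {X : Type*} [AddCommGroup X]
    {f g : ρ.ind.obj (ρ.res.obj M) →+ X}
    (h : ∀ (a : A) (m : M), f (op a • (ρ.toAddHom (N := ρ.ind.obj (ρ.res.obj M))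
      (ρ.unit (ρ.res.obj M)) m)) = g (op a • (ρ.toAddHom (N := ρ.ind.obj (ρ.res.obj M))
      (ρ.unit (ρ.res.obj M)) m))) : f = g := by
  refine QuotientAddGroup.addMonoidHom_ext (balancing ρ.inclOp (ρ.res.obj M)).toAddSubgroup
    (AddMonoidHom.ext fun t => ?_)
  induction t using TensorProduct.induction_on with
  | zero => simp only [map_zero]
  | tmul a m =>
    have := mk_tmul_eq_smul ρ.inclOp (M := ρ.res.obj M) a m
    exact (congrArg f this).trans ((h a.unop m).trans (congrArg g this).symm)
  | add a b ha hb => simp only [map_add, ha, hb]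

variable {M} in
theorem contract_naturality (ξ : H →ₗ[k] k) (a : M ⟶ N) :
    ρ.res.map (ρ.ind.map (ρ.res.map a)) ≫ ρ.contract N ξ = ρ.contract M ξ ≫ ρ.res.map a := by
  refine ρ.hom_ext_toAddHom fun t => DFunLike.congr_fun (ρ.induced_addHom_ext M
    (f := ρ.toAddHom (ρ.res.map (ρ.ind.map (ρ.res.map a)) ≫ ρ.contract N ξ))
    (g := ρ.toAddHom (ρ.contract M ξ ≫ ρ.res.map a)) fun x m => ?_) t
  have h₁ := congrArg (ρ.toAddHom (ρ.contract N ξ)) ((ρ.ind.map (ρ.res.map a)).hom.map_smul (op x)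
    (ρ.toAddHom (N := ρ.ind.obj (ρ.res.obj M)) (ρ.unit (ρ.res.obj M)) m))
  have h₂ := congrArg a.hom (ρ.contract_apply M ξ x m)
  exact h₁.trans ((ρ.contract_apply N ξ x (a.hom m)).trans (h₂.trans (a.hom.map_smul _ m)).symm)

/-- Together with `sum_contract_twist_unit`, this says that the maps `twist h unit` are the inclusions,
and the maps `contract ξ` the projections, of a decomposition `M ⊗_B A ≅ M ⊗ H` of `B`-modules. -/
theorem twist_unit_contract (ξ : H →ₗ[k] k) (h : H) :
    ρ.twist hρ h (ρ.unit (ρ.res.obj M)) ≫ ρ.contract M ξ = ξ h • 𝟙 (ρ.res.obj M) := by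
  refine ρ.hom_ext_toAddHom fun m => ?_
  have : (ρ.toAddHom (ρ.contract M ξ)).comp (ρ.sandwichExt hρ (ρ.unit (ρ.res.obj M)) m) =
      (((LinearMap.toSpanSingleton Aᵐᵒᵖ M m).toAddMonoidHom.comp opAddEquiv.toAddMonoidHom).comp
        (TensorProduct.rid k A).toLinearMap.toAddMonoidHom).comp (ξ.lTensor A).toAddMonoidHom := by
    refine ρ.addHom_ext_of_isGalois hρ fun x y => ?_
    change ρ.toAddHom (ρ.contract M ξ) (ρ.sandwichExt hρ (ρ.unit (ρ.res.obj M)) m _) =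
      op (TensorProduct.rid k A (ξ.lTensor A ((x ⊗ₜ[k] (1 : H)) * ρ.coact y))) • m
    rw [sandwichExt_tmul_mul, sandwichExt_coact, contract_apply, rid_lTensor_tmul_mul, op_mul,
      mul_smul, hit_apply]
  refine (DFunLike.congr_fun this (1 ⊗ₜ h)).trans ?_
  change op (TensorProduct.rid k A (ξ.lTensor A (1 ⊗ₜ h))) • m = _
  rw [LinearMap.lTensor_tmul, TensorProduct.rid_tmul, op_smul, op_one]
  exact (smul_assoc _ _ _).trans (congrArg _ (one_smul _ _))

theorem sum_contract_twist_unit {ι : Type*} [Fintype ι] (b : Module.Basis ι k H) :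
    ∑ i, ρ.contract M (b.coord i) ≫ ρ.twist hρ (b i) (ρ.unit (ρ.res.obj M)) = 𝟙 _ := by
  have hsum : ∀ (s : Finset ι) (F : ι → (ρ.res.obj (ρ.ind.obj (ρ.res.obj M)) ⟶
      ρ.res.obj (ρ.ind.obj (ρ.res.obj M)))),
      ρ.toAddHom (∑ i ∈ s, F i) = ∑ i ∈ s, ρ.toAddHom (F i) := fun s F =>
    map_sum (AddMonoidHom.mk' (fun f => ρ.toAddHom f) fun _ _ => rfl) F s
  refine ρ.hom_ext_toAddHom fun t => DFunLike.congr_fun (ρ.induced_addHom_ext M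
    (f := ρ.toAddHom (∑ i, ρ.contract M (b.coord i) ≫ ρ.twist hρ (b i) (ρ.unit (ρ.res.obj M))))
    (g := ρ.toAddHom (𝟙 _)) fun x m => ?_) t
  rw [hsum, AddMonoidHom.finsetSum_apply]
  have h₁ (i : ι) : ρ.toAddHom (ρ.contract M (b.coord i) ≫
      ρ.twist hρ (b i) (ρ.unit (ρ.res.obj M))) (op x • (ρ.toAddHom (N := ρ.ind.obj (ρ.res.obj M))
        (ρ.unit (ρ.res.obj M)) m)) = ρ.sandwichExt hρ (ρ.unit (ρ.res.obj M)) m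
          (TensorProduct.rid k A ((b.coord i).lTensor A (ρ.coact x)) ⊗ₜ b i) := by
    rw [sandwichExt_tmul, ← hit_apply, ← contract_apply]
    rfl
  rw [Finset.sum_congr rfl fun i _ => h₁ i, ← map_sum, sum_rid_lTensor_coord, sandwichExt_coact]
  rfl

end

end ComoduleAlgebra

/-! ### Complexes -/

namespace ComoduleAlgebra

variable {k : Type v₁} {H : Type v₂} {A : Type u} [Field k] [Ring H] [HopfAlgebra k H]
    [Ring A] [Algebra k A] (ρ : ComoduleAlgebra k H A) (hρ : ρ.IsGalois)

section TwistComplex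

variable {P P' P'' : CochainComplex (ModuleCat.{u} Aᵐᵒᵖ) ℤ} {n : ℤ}

theorem twist_zsmul {M N : ModuleCat.{u} Aᵐᵒᵖ} (h : H) (c : ℤ) (f : ρ.res.obj M ⟶ ρ.res.obj N) :
    ρ.twist hρ h (c • f) = c • ρ.twist hρ h f :=
  map_zsmul (ρ.twistₗ hρ h) c f

theorem twist_comm {M M' N N' : ModuleCat.{u} Aᵐᵒᵖ} (h : H) (c : ℤ)
    (f : ρ.res.obj M ⟶ ρ.res.obj N) (f' : ρ.res.obj M' ⟶ ρ.res.obj N') (a : M ⟶ M') (b : N ⟶ N')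
    (e : f ≫ (c • ρ.res.map b) = ρ.res.map a ≫ f') :
    ρ.twist hρ h f ≫ (c • ρ.res.map b) = ρ.res.map a ≫ ρ.twist hρ h f' := by
  rw [← twist_res_map_comp, ← e, Preadditive.comp_zsmul, Preadditive.comp_zsmul, twist_zsmul,
    twist_comp_res_map]

theorem twist_add_hom {M N : ModuleCat.{u} Aᵐᵒᵖ} (h : H) (f g : ρ.res.obj M ⟶ ρ.res.obj N) :
    ρ.twist hρ h (f + g) = ρ.twist hρ h f + ρ.twist hρ h g :=
  map_add (ρ.twistₗ hρ h) f g

theorem twist_homotopy {M M' N N' : ModuleCat.{u} Aᵐᵒᵖ} (h : H) (c : ℤ)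
    (f : ρ.res.obj M ⟶ ρ.res.obj N) (s : ρ.res.obj M' ⟶ ρ.res.obj N)
    (t : ρ.res.obj M ⟶ ρ.res.obj N') (a : M ⟶ M') (b : N' ⟶ N)
    (e : f = ρ.res.map a ≫ s + t ≫ (c • ρ.res.map b)) :
    ρ.twist hρ h f =
      ρ.res.map a ≫ ρ.twist hρ h s + ρ.twist hρ h t ≫ (c • ρ.res.map b) := by
  rw [e, twist_add_hom, twist_res_map_comp, Preadditive.comp_zsmul, Preadditive.comp_zsmul,
    twist_zsmul, twist_comp_res_map]

theorem twist_comp_comp_res_map {M N N' N'' : ModuleCat.{u} Aᵐᵒᵖ}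
    (f : ρ.res.obj M ⟶ ρ.res.obj N) (g : ρ.res.obj N ⟶ ρ.res.obj N') (a : N' ⟶ N'')
    {ι : Type*} {h : H} (𝓡 : Repr k h ι) :
    ρ.twist hρ h (f ≫ g ≫ ρ.res.map a) = ∑ i ∈ 𝓡.index,
      ρ.twist hρ (𝓡.left i) f ≫ ρ.twist hρ (𝓡.right i) g ≫ ρ.res.map a := by
  simp only [twist_comp ρ hρ f _ 𝓡, twist_comp_res_map]

/-- The twist `f ◁ h` of a morphism `f : P → P'[n]` of complexes of `B`-modules, where `P` and `P'` are
complexes of `A`-modules. -/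
def twistComplex (h : H) (f : ρ.resComplex P ⟶ (ρ.resComplex P')⟦n⟧) :
    ρ.resComplex P ⟶ (ρ.resComplex P')⟦n⟧ where
  f i := ρ.twist hρ h (M := P.X i) (N := P'.X (i + n)) (f.f i)
  comm' i j hij := by
    exact ρ.twist_comm hρ h n.negOnePow (f.f i) (f.f j) (P.d i j) (P'.d (i + n) (j + n))
      (f.comm i j)

theorem twistComplex_f (h : H) (f : ρ.resComplex P ⟶ (ρ.resComplex P')⟦n⟧) (i : ℤ) :
    (ρ.twistComplex hρ h f).f i = ρ.twist hρ h (M := P.X i) (N := P'.X (i + n)) (f.f i) := rfl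

/-- `twistComplex` as a bilinear map. -/
def twistComplexₗ (P P' : CochainComplex (ModuleCat.{u} Aᵐᵒᵖ) ℤ) (n : ℤ) :
    H →ₗ[k] (ρ.resComplex P ⟶ (ρ.resComplex P')⟦n⟧) →ₗ[k]
      (ρ.resComplex P ⟶ (ρ.resComplex P')⟦n⟧) :=
  LinearMap.mk₂ k (ρ.twistComplex hρ)
    (fun h h' f => HomologicalComplex.hom_ext _ _ fun i =>
      congr($(map_add (ρ.twistₗ hρ) h h') (f.f i)))
    (fun c h f => HomologicalComplex.hom_ext _ _ fun i =>
      congr($(map_smul (ρ.twistₗ hρ) c h) (f.f i)))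
    (fun h f g => HomologicalComplex.hom_ext _ _ fun i => map_add (ρ.twistₗ hρ h) (f.f i) (g.f i))
    (fun c h f => HomologicalComplex.hom_ext _ _ fun i => map_smul (ρ.twistₗ hρ h) c (f.f i))

theorem twistComplexₗ_apply (h : H) (f : ρ.resComplex P ⟶ (ρ.resComplex P')⟦n⟧) :
    ρ.twistComplexₗ hρ P P' n h f = ρ.twistComplex hρ h f := rfl

theorem twistComplex_one (f : ρ.resComplex P ⟶ (ρ.resComplex P')⟦n⟧) :
    ρ.twistComplex hρ 1 f = f :=
  HomologicalComplex.hom_ext _ _ fun i => ρ.twist_one hρ (f.f i)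

theorem twistComplex_twistComplex (g h : H) (f : ρ.resComplex P ⟶ (ρ.resComplex P')⟦n⟧) :
    ρ.twistComplex hρ g (ρ.twistComplex hρ h f) = ρ.twistComplex hρ (h * g) f :=
  HomologicalComplex.hom_ext _ _ fun i => ρ.twist_twist hρ g h (f.f i)

theorem twistComplex_mk₀_id (h : H) :
    ρ.twistComplex hρ h (ShiftedHom.mk₀ (0 : ℤ) rfl (𝟙 (ρ.resComplex P))) =
      Coalgebra.counit (R := k) h • ShiftedHom.mk₀ 0 rfl (𝟙 (ρ.resComplex P)) := by
  refine HomologicalComplex.hom_ext _ _ fun i => ?_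
  have e : (ShiftedHom.mk₀ (0 : ℤ) rfl (𝟙 (ρ.resComplex P))).f i =
      ρ.res.map (P.XIsoOfEq (add_zero i).symm).hom := by
    simp [ShiftedHom.mk₀, shiftFunctorZero', CochainComplex.shiftFunctorZero_inv_app_f,
      HomologicalComplex.XIsoOfEq, eqToHom_map]
    rfl
  rw [HomologicalComplex.smul_f_apply, twistComplex_f, e]
  exact ρ.twist_res_map hρ h _

theorem shiftedHom_comp_f {C : Type*} [Category* C] [Preadditive C] {K L M : CochainComplex C ℤ}
    {a b c : ℤ} (f : ShiftedHom K L a) (g : ShiftedHom L M b) (e : b + a = c) (i : ℤ) :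
    (f.comp g e).f i = f.f i ≫ g.f (i + a) ≫
      (M.XIsoOfEq (show i + a + b = i + c by lia)).hom := by
  simp [ShiftedHom.comp, CochainComplex.shiftFunctorAdd'_inv_app_f']

theorem twistComplex_comp {a b c : ℤ} (f : ShiftedHom (ρ.resComplex P) (ρ.resComplex P') a)
    (g : ShiftedHom (ρ.resComplex P') (ρ.resComplex P'') b) (e : b + a = c)
    {ι : Type*} {h : H} (𝓡 : Repr k h ι) :
    ρ.twistComplex hρ h (f.comp g e) =
      ∑ i ∈ 𝓡.index, ShiftedHom.comp (ρ.twistComplex hρ (𝓡.left i) f)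
        (ρ.twistComplex hρ (𝓡.right i) g) e := by
  refine HomologicalComplex.hom_ext _ _ fun j => ?_
  have e₁ : ((ρ.resComplex P'').XIsoOfEq (show j + a + b = j + c by lia)).hom =
      ρ.res.map (P''.XIsoOfEq (show j + a + b = j + c by lia)).hom :=
    (eqToHom_map ρ.res (congrArg P''.X (show j + a + b = j + c by lia))).symm
  refine Eq.trans ?_ (map_sum (HomologicalComplex.Hom.fAddMonoidHom (C₁ := ρ.resComplex P)
    (C₂ := (ρ.resComplex P'')⟦c⟧) j) _ _).symm
  refine Eq.trans (congrArg (ρ.twist hρ h (M := P.X j) (N := P''.X (j + c)))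
    ((shiftedHom_comp_f f g e j).trans (congrArg (f.f j ≫ g.f (j + a) ≫ ·) e₁))) ?_
  refine (ρ.twist_comp_comp_res_map hρ (M := P.X j) (N := P'.X (j + a)) (f.f j) (g.f (j + a))
    (P''.XIsoOfEq (show j + a + b = j + c by lia)).hom 𝓡).trans ?_
  refine Finset.sum_congr rfl fun i _ => ?_
  exact ((shiftedHom_comp_f (ρ.twistComplex hρ (𝓡.left i) f) (ρ.twistComplex hρ (𝓡.right i) g)
    e j).trans (congrArg ((ρ.twistComplex hρ (𝓡.left i) f).f j ≫
      (ρ.twistComplex hρ (𝓡.right i) g).f (j + a) ≫ ·) e₁)).symm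

theorem twistComplex_res_map_comp (h : H) {Q Q' : CochainComplex (ModuleCat.{u} Aᵐᵒᵖ) ℤ}
    (u : Q ⟶ P) (v : P' ⟶ Q') (f : ρ.resComplex P ⟶ (ρ.resComplex P')⟦n⟧) :
    ρ.twistComplex hρ h ((ρ.res.mapHomologicalComplex _).map u ≫ f ≫
      ((ρ.res.mapHomologicalComplex _).map v)⟦n⟧') =
    (ρ.res.mapHomologicalComplex _).map u ≫ ρ.twistComplex hρ h f ≫
      ((ρ.res.mapHomologicalComplex _).map v)⟦n⟧' := by
  refine HomologicalComplex.hom_ext _ _ fun i => ?_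
  refine (ρ.twist_res_map_comp hρ h (u.f i)
    (f.f i ≫ ρ.res.map (v.f (i + n)) : ρ.res.obj (P.X i) ⟶ ρ.res.obj (Q'.X (i + n)))).trans ?_
  exact congrArg (ρ.res.map (u.f i) ≫ ·)
    (ρ.twist_comp_res_map hρ h (N := P'.X (i + n)) (f.f i) (v.f (i + n)))

/-- A homotopy from `f` to zero can be twisted. -/
def homotopyTwistComplex (h : H) {f : ρ.resComplex P ⟶ (ρ.resComplex P')⟦n⟧} (t : Homotopy f 0) :
    Homotopy (ρ.twistComplex hρ h f) 0 where
  hom i j := ρ.twist hρ h (M := P.X i) (N := P'.X (j + n)) (t.hom i j)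
  zero i j hij := by
    rw [t.zero i j hij]
    exact map_zero (ρ.twistₗ hρ h)
  comm i := by
    have e := t.comm i
    rw [dNext_eq _ (show (ComplexShape.up ℤ).Rel i (i + 1) from rfl),
      prevD_eq _ (show (ComplexShape.up ℤ).Rel (i - 1) i from sub_add_cancel i 1)] at e
    refine Eq.trans ?_ (congrArg (· + _) (congrArg₂ (· + ·)
      (dNext_eq _ (show (ComplexShape.up ℤ).Rel i (i + 1) from rfl))
      (prevD_eq _ (show (ComplexShape.up ℤ).Rel (i - 1) i from sub_add_cancel i 1)))).symm
    refine Eq.trans ?_ (add_zero _).symm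
    exact ρ.twist_homotopy hρ h n.negOnePow (f.f i) (t.hom (i + 1) i) (t.hom i (i - 1))
      (P.d i (i + 1)) (P'.d (i - 1 + n) (i + n)) (e.trans (add_zero _))

open CochainComplex.HomComplex in
theorem equivHomShift_symm_cocycleAct (h : H) (z : Cocycle (ρ.resComplex P) (ρ.resComplex P') n) :
    Cocycle.equivHomShift.symm (ρ.cocycleAct hρ h z) =
      ρ.twistComplex hρ (antipode k h) (Cocycle.equivHomShift.symm z) := by
  have e (z : Cocycle (ρ.resComplex P) (ρ.resComplex P') n) (i : ℤ) :
      (Cocycle.equivHomShift.symm z).f i = z.1.v i (i + n) rfl := by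
    simp [Cocycle.equivHomShift_symm_apply, Cochain.rightShift_v _ _ _ _ _ _ _ (i + n) rfl,
      CochainComplex.shiftFunctorObjXIso]
    exact Category.comp_id _
  refine HomologicalComplex.hom_ext _ _ fun i => ?_
  rw [e, twistComplex_f, e]
  rfl

end TwistComplex

section InducedComplex

variable {P : CochainComplex (ModuleCat.{u} Aᵐᵒᵖ) ℤ} {n : ℤ}

variable (P) in
/-- The endomorphism `leftMul h` of the complex `P ⊗_B A`. -/
def leftMulComplex (h : H) : ρ.indComplex (ρ.resComplex P) ⟶ ρ.indComplex (ρ.resComplex P) where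
  f i := ρ.leftMul hρ (P.X i) h
  comm' i j _ := (ρ.leftMul_naturality hρ h (P.d i j)).symm

variable (P) in
/-- The morphism `p ↦ p ⊗ 1` of complexes of `B`-modules. -/
def unitComplex : ρ.resComplex P ⟶ ρ.resComplex (ρ.indComplex (ρ.resComplex P)) where
  f i := ρ.unit (ρ.res.obj (P.X i))
  comm' i j _ := inducedUnit_naturality ρ.inclOp (ρ.res.map (P.d i j))

variable (P) in
/-- The morphism `p ⊗ a ↦ ∑ p a₀ ξ(a₁)` of complexes of `B`-modules. -/
def contractComplex (ξ : H →ₗ[k] k) :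
    ρ.resComplex (ρ.indComplex (ρ.resComplex P)) ⟶ ρ.resComplex P where
  f i := ρ.contract (P.X i) ξ
  comm' i j _ := (ρ.contract_naturality ξ (P.d i j)).symm

/-- The morphism `P ⊗_B A → (P ⊗_B A)[n]` induced by `f : P → P[n]`. -/
abbrev indShifted (f : ρ.resComplex P ⟶ (ρ.resComplex P)⟦n⟧) :
    ρ.indComplex (ρ.resComplex P) ⟶ (ρ.indComplex (ρ.resComplex P))⟦n⟧ :=
  ShiftedHom.map f (ρ.ind.mapHomologicalComplex (ComplexShape.up ℤ))

theorem indShifted_f (f : ρ.resComplex P ⟶ (ρ.resComplex P)⟦n⟧) (i : ℤ) :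
    (ρ.indShifted f).f i = ρ.ind.map (f.f i) :=
  Category.comp_id _

/-- Restriction to `B` of a morphism `P ⊗_B A → (P ⊗_B A)[n]`. -/
abbrev resShifted (t : ρ.indComplex (ρ.resComplex P) ⟶ (ρ.indComplex (ρ.resComplex P))⟦n⟧) :
    ρ.resComplex (ρ.indComplex (ρ.resComplex P)) ⟶
      (ρ.resComplex (ρ.indComplex (ρ.resComplex P)))⟦n⟧ :=
  ShiftedHom.map t (ρ.res.mapHomologicalComplex (ComplexShape.up ℤ))

theorem resShifted_f (t : ρ.indComplex (ρ.resComplex P) ⟶ (ρ.indComplex (ρ.resComplex P))⟦n⟧)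
    (i : ℤ) : (ρ.resShifted t).f i = ρ.res.map (t.f i) :=
  Category.comp_id _

/-- The component with respect to a functional `ξ` on `H` of a morphism of complexes
`P ⊗_B A → (P ⊗_B A)[n]`. -/
def component (ξ : H →ₗ[k] k)
    (t : ρ.indComplex (ρ.resComplex P) ⟶ (ρ.indComplex (ρ.resComplex P))⟦n⟧) :
    ρ.resComplex P ⟶ (ρ.resComplex P)⟦n⟧ :=
  ρ.unitComplex P ≫ ρ.resShifted t ≫ (ρ.contractComplex P ξ)⟦n⟧'

theorem component_f (ξ : H →ₗ[k] k)
    (t : ρ.indComplex (ρ.resComplex P) ⟶ (ρ.indComplex (ρ.resComplex P))⟦n⟧) (i : ℤ) :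
    (ρ.component ξ t).f i = ρ.unit (ρ.res.obj (P.X i)) ≫ ρ.res.map (t.f i) ≫
      ρ.contract (P.X (i + n)) ξ :=
  congrArg (fun φ => ρ.unit (ρ.res.obj (P.X i)) ≫ φ ≫ ρ.contract (P.X (i + n)) ξ)
    (ρ.resShifted_f t i)

theorem leftMulComplex_comp (g h : H) :
    ρ.leftMulComplex hρ P h ≫ ρ.leftMulComplex hρ P g = ρ.leftMulComplex hρ P (g * h) :=
  HomologicalComplex.hom_ext _ _ fun i => ρ.leftMul_comp_leftMul hρ (P.X i) g h

theorem leftMulComplex_one : ρ.leftMulComplex hρ P 1 = 𝟙 _ :=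
  HomologicalComplex.hom_ext _ _ fun i => ρ.leftMul_one hρ (P.X i)

theorem leftMulComplex_add (g h : H) :
    ρ.leftMulComplex hρ P (g + h) = ρ.leftMulComplex hρ P g + ρ.leftMulComplex hρ P h :=
  HomologicalComplex.hom_ext _ _ fun i => ρ.leftMul_add hρ (P.X i) g h

theorem leftMulComplex_smul (c : k) (h : H) :
    ρ.leftMulComplex hρ P (c • h) = c • ρ.leftMulComplex hρ P h :=
  HomologicalComplex.hom_ext _ _ fun i => ρ.leftMul_smul hρ (P.X i) c h

theorem indShifted_comp_leftMulComplex (f : ρ.resComplex P ⟶ (ρ.resComplex P)⟦n⟧)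
    {ι : Type*} {h : H} (𝓡 : Repr k h ι) :
    ρ.indShifted f ≫ (ρ.leftMulComplex hρ P h)⟦n⟧' = ∑ i ∈ 𝓡.index,
      ρ.leftMulComplex hρ P (𝓡.right i) ≫
        ρ.indShifted (ρ.twistComplex hρ (antipode k (𝓡.left i)) f) := by
  refine HomologicalComplex.hom_ext _ _ fun j => ?_
  have e₁ : (ρ.indShifted f ≫ (ρ.leftMulComplex hρ P h)⟦n⟧').f j =
      ρ.ind.map (f.f j) ≫ ρ.leftMul hρ (P.X (j + n)) h :=
    congrArg (· ≫ ρ.leftMul hρ (P.X (j + n)) h) (ρ.indShifted_f f j)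
  have e₂ (i : ι) : (ρ.leftMulComplex hρ P (𝓡.right i) ≫
      ρ.indShifted (ρ.twistComplex hρ (antipode k (𝓡.left i)) f)).f j =
      ρ.leftMul hρ (P.X j) (𝓡.right i) ≫
        ρ.ind.map (ρ.twist hρ (M := P.X j) (N := P.X (j + n)) (antipode k (𝓡.left i)) (f.f j)) :=
    congrArg (ρ.leftMul hρ (P.X j) (𝓡.right i) ≫ ·)
      (ρ.indShifted_f (ρ.twistComplex hρ (antipode k (𝓡.left i)) f) j)
  refine e₁.trans ((ρ.ind_map_comp_leftMul hρ (M := P.X j) (N := P.X (j + n)) (f.f j) 𝓡).trans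
    (Eq.trans ?_ (map_sum (HomologicalComplex.Hom.fAddMonoidHom
      (C₁ := ρ.indComplex (ρ.resComplex P)) (C₂ := (ρ.indComplex (ρ.resComplex P))⟦n⟧) j)
      (fun i => ρ.leftMulComplex hρ P (𝓡.right i) ≫
        ρ.indShifted (ρ.twistComplex hρ (antipode k (𝓡.left i)) f)) 𝓡.index).symm))
  exact Finset.sum_congr rfl fun i _ => (e₂ i).symm

theorem unit_ind_map_leftMul_contract {M N : ModuleCat.{u} Aᵐᵒᵖ} (ξ : H →ₗ[k] k) (h : H)
    (f : ρ.res.obj M ⟶ ρ.res.obj N) :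
    ρ.unit (ρ.res.obj M) ≫ ρ.res.map (ρ.ind.map f ≫ ρ.leftMul hρ N h) ≫ ρ.contract N ξ =
      ξ h • f := by
  rw [Functor.map_comp, Category.assoc, ← Category.assoc, inducedUnit_naturality, Category.assoc,
    ← Category.assoc (ρ.unit (ρ.res.obj N)), unit_leftMul, twist_unit_contract, Linear.comp_smul,
    Category.comp_id]

theorem sum_ind_map_leftMul {M N : ModuleCat.{u} Aᵐᵒᵖ} {ι : Type*} [Fintype ι]
    (b : Module.Basis ι k H) (t : ρ.ind.obj (ρ.res.obj M) ⟶ ρ.ind.obj (ρ.res.obj N)) :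
    ∑ i, ρ.ind.map (ρ.unit (ρ.res.obj M) ≫ ρ.res.map t ≫ ρ.contract N (b.coord i)) ≫
      ρ.leftMul hρ N (b i) = t := by
  refine induced_hom_ext _ ?_
  rw [Functor.map_sum, Preadditive.comp_sum]
  have e (i : ι) : ρ.unit (ρ.res.obj M) ≫ ρ.res.map (ρ.ind.map (ρ.unit (ρ.res.obj M) ≫
      ρ.res.map t ≫ ρ.contract N (b.coord i)) ≫ ρ.leftMul hρ N (b i)) =
      (ρ.unit (ρ.res.obj M) ≫ ρ.res.map t) ≫ ρ.contract N (b.coord i) ≫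
        ρ.twist hρ (b i) (ρ.unit (ρ.res.obj N)) := by
    rw [Functor.map_comp, ← Category.assoc, inducedUnit_naturality, ← unit_leftMul]
    simp only [Category.assoc]
  rw [Finset.sum_congr rfl fun i _ => e i, ← Preadditive.comp_sum, sum_contract_twist_unit,
    Category.comp_id]

theorem component_indShifted (ξ : H →ₗ[k] k) (h : H)
    (f : ρ.resComplex P ⟶ (ρ.resComplex P)⟦n⟧) :
    ρ.component ξ (ρ.indShifted f ≫ (ρ.leftMulComplex hρ P h)⟦n⟧') = ξ h • f := by
  refine HomologicalComplex.hom_ext _ _ fun i => ?_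
  have e : (ρ.indShifted f ≫ (ρ.leftMulComplex hρ P h)⟦n⟧').f i =
      ρ.ind.map (f.f i) ≫ ρ.leftMul hρ (P.X (i + n)) h :=
    congrArg (· ≫ ρ.leftMul hρ (P.X (i + n)) h) (ρ.indShifted_f f i)
  refine (ρ.component_f ξ _ i).trans (Eq.trans (congrArg (fun φ => ρ.unit (ρ.res.obj (P.X i)) ≫
    ρ.res.map φ ≫ ρ.contract (P.X (i + n)) ξ) e) ?_)
  exact ρ.unit_ind_map_leftMul_contract hρ (M := P.X i) (N := P.X (i + n)) ξ h (f.f i)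

theorem sum_indShifted_component {ι : Type*} [Fintype ι] (b : Module.Basis ι k H)
    (t : ρ.indComplex (ρ.resComplex P) ⟶ (ρ.indComplex (ρ.resComplex P))⟦n⟧) :
    ∑ i, ρ.indShifted (ρ.component (b.coord i) t) ≫ (ρ.leftMulComplex hρ P (b i))⟦n⟧' = t := by
  refine HomologicalComplex.hom_ext _ _ fun j => ?_
  refine (map_sum (HomologicalComplex.Hom.fAddMonoidHom
    (C₁ := ρ.indComplex (ρ.resComplex P)) (C₂ := (ρ.indComplex (ρ.resComplex P))⟦n⟧) j) _ _).trans ?_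
  have e (i : ι) : (ρ.indShifted (ρ.component (b.coord i) t) ≫
      (ρ.leftMulComplex hρ P (b i))⟦n⟧').f j =
      ρ.ind.map (ρ.unit (ρ.res.obj (P.X j)) ≫ ρ.res.map (t.f j) ≫
        ρ.contract (P.X (j + n)) (b.coord i)) ≫ ρ.leftMul hρ (P.X (j + n)) (b i) :=
    congrArg (· ≫ ρ.leftMul hρ (P.X (j + n)) (b i)) ((ρ.indShifted_f _ j).trans
      (congrArg ρ.ind.map (ρ.component_f _ t j)))
  refine (Finset.sum_congr rfl fun i _ => e i).trans ?_
  exact ρ.sum_ind_map_leftMul hρ (M := P.X j) (N := P.X (j + n)) b (t.f j)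

end InducedComplex

end ComoduleAlgebra

/-! ### Yoneda algebras and smash products -/

section Graded

variable {k : Type v₂} [Field k] {C : Type u} [Category.{v₁} C] [HasShift C ℤ] [Preadditive C]
  [∀ n : ℤ, (shiftFunctor C n).Additive] [Linear k C]
  [∀ n : ℤ, Functor.Linear k (shiftFunctor C n)]

namespace YonedaExt

@[elab_as_elim]
theorem induction_on (k : Type v₂) [Field k] [Linear k C]
    [∀ n : ℤ, Functor.Linear k (shiftFunctor C n)] {X : C} {p : YonedaExt X → Prop}
    (x : YonedaExt X) (zero : p 0) (of : ∀ n f, p (of k X n f))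
    (add : ∀ x y, p x → p y → p (x + y)) : p x :=
  DirectSum.induction_on (β := fun i : ℤ => ShiftedHom X X i) x zero of add

theorem of_mul_of {X : C} {i j n : ℤ} (f : ShiftedHom X X i) (g : ShiftedHom X X j)
    (h : i + j = n) : of k X i f * of k X j g = of k X n (g.comp f h) := by
  subst h
  exact of_mul k X i j f g

theorem of_one {X : C} : of k X 0 (ShiftedHom.mk₀ 0 rfl (𝟙 X)) = 1 := rfl

section

variable {M : Type*} [AddCommGroup M] [Module k M] {X : C}

/-- The linear map out of `Ext^*(X, X)` with given restrictions to the homogeneous components. -/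
def toModule (φ : ∀ n : ℤ, ShiftedHom X X n →ₗ[k] M) : YonedaExt X →ₗ[k] M :=
  DirectSum.toModule k ℤ M φ

theorem toModule_of (φ : ∀ n : ℤ, ShiftedHom X X n →ₗ[k] M) (n : ℤ) (f : ShiftedHom X X n) :
    toModule φ (of k X n f) = φ n f :=
  DirectSum.toModule_lof k n f

theorem linearMap_ext {φ ψ : YonedaExt X →ₗ[k] M}
    (h : ∀ n f, φ (of k X n f) = ψ (of k X n f)) : φ = ψ :=
  DirectSum.linearMap_ext k fun n => LinearMap.ext (h n)

end

/-- The homomorphism of algebras out of `Ext^*(X, X)` with given restrictions to the homogeneous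
components. -/
def toAlgHom {R : Type*} [Ring R] [Algebra k R] {X : C} (φ : ∀ n : ℤ, ShiftedHom X X n →ₗ[k] R)
    (map_one : φ 0 (ShiftedHom.mk₀ 0 rfl (𝟙 X)) = 1)
    (map_comp : ∀ (a b : ℤ) (f : ShiftedHom X X a) (g : ShiftedHom X X b),
      φ (a + b) (g.comp f rfl) = φ a f * φ b g) : YonedaExt X →ₐ[k] R :=
  AlgHom.ofLinearMap (toModule φ) ((toModule_of φ 0 _).trans map_one) fun x y => by
    refine induction_on k x (by simp) (fun a f => ?_)
      fun x x' hx hx' => by simp only [add_mul, map_add, hx, hx']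
    refine induction_on k y (by simp) (fun b g => ?_)
      fun y y' hy hy' => by simp only [mul_add, map_add, hy, hy']
    rw [of_mul_of f g rfl, toModule_of, toModule_of, toModule_of, map_comp]

theorem toAlgHom_of {R : Type*} [Ring R] [Algebra k R] {X : C}
    (φ : ∀ n : ℤ, ShiftedHom X X n →ₗ[k] R) (h₁) (h₂) (n : ℤ) (f : ShiftedHom X X n) :
    toAlgHom φ h₁ h₂ (of k X n f) = φ n f :=
  toModule_of φ n f

/-- The action of an algebra on `Ext^*(X, X)` given by actions on the homogeneous components. -/
def action {H : Type v₃} [Ring H] [Algebra k H] {X : C}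
    (a : ∀ n : ℤ, H →ₗ[k] Module.End k (ShiftedHom X X n))
    (one_act : ∀ n, a n 1 = 1) (mul_act : ∀ n g h, a n (g * h) = a n g * a n h) :
    H →ₐ[k] Module.End k (YonedaExt X) :=
  AlgHom.ofLinearMap
    (LinearMap.mk₂ k (fun h => toModule fun n => of k X n ∘ₗ a n h)
      (fun h h' x => by
        refine LinearMap.congr_fun (f := toModule fun n => of k X n ∘ₗ a n (h + h'))
          (g := (toModule fun n => of k X n ∘ₗ a n h) + toModule fun n => of k X n ∘ₗ a n h')
          (linearMap_ext fun n f => ?_) x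
        simp [toModule_of])
      (fun c h x => by
        refine LinearMap.congr_fun (f := toModule fun n => of k X n ∘ₗ a n (c • h))
          (g := c • toModule fun n => of k X n ∘ₗ a n h) (linearMap_ext fun n f => ?_) x
        simp [toModule_of])
      (fun h x y => map_add _ x y) (fun c h x => map_smul _ c x))
    (linearMap_ext fun n f => by
      refine (toModule_of (fun n => of k X n ∘ₗ a n 1) n f).trans ?_
      rw [one_act]; rfl)
    (fun g h => linearMap_ext fun n f => by
      refine (toModule_of (fun n => of k X n ∘ₗ a n (g * h)) n f).trans ?_
      refine Eq.trans ?_ (congrArg (toModule fun n => of k X n ∘ₗ a n g)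
        (toModule_of (fun n => of k X n ∘ₗ a n h) n f)).symm
      refine Eq.trans ?_ (toModule_of (fun n => of k X n ∘ₗ a n g) n (a n h f)).symm
      rw [mul_act]; rfl)

theorem action_of {H : Type v₃} [Ring H] [Algebra k H] {X : C}
    (a : ∀ n : ℤ, H →ₗ[k] Module.End k (ShiftedHom X X n)) (h₁) (h₂) (h : H) (n : ℤ)
    (f : ShiftedHom X X n) : action a h₁ h₂ h (of k X n f) = of k X n (a n h f) :=
  toModule_of (fun n => of k X n ∘ₗ a n h) n f

/-- The module algebra structure on `Ext^*(X, X)` given by actions on the homogeneous components. -/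
def moduleAlgebra {H : Type v₃} [Ring H] [HopfAlgebra k H] {X : C}
    (a : ∀ n : ℤ, H →ₗ[k] Module.End k (ShiftedHom X X n))
    (one_act : ∀ n, a n 1 = 1) (mul_act : ∀ n g h, a n (g * h) = a n g * a n h)
    (act_one : ∀ h, a 0 h (ShiftedHom.mk₀ 0 rfl (𝟙 X)) =
      Coalgebra.counit (R := k) h • ShiftedHom.mk₀ 0 rfl (𝟙 X))
    (act_comp : ∀ (m n : ℤ) (f : ShiftedHom X X m) (g : ShiftedHom X X n) (h : H),
      a (m + n) h (g.comp f rfl) = ∑ i ∈ (ℛ k h).index,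
        (a n ((ℛ k h).right i) g).comp (a m ((ℛ k h).left i) f) rfl) :
    HopfModuleAlgebra k H (YonedaExt X) where
  act := action a one_act mul_act
  act_one h := by
    rw [← of_one (k := k), action_of, act_one, map_smul, of_one, Algebra.algebraMap_eq_smul_one]
  act_mul h x y := by
    have key : ∀ x y : YonedaExt X, action a one_act mul_act h (x * y) =
        ∑ i ∈ (ℛ k h).index, action a one_act mul_act ((ℛ k h).left i) x *
          action a one_act mul_act ((ℛ k h).right i) y := fun x y => by
      refine induction_on k x (by simp) (fun m f => ?_) fun x x' hx hx' => by
        simp only [add_mul, map_add, hx, hx', Finset.sum_add_distrib]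
      refine induction_on k y (by simp) (fun n g => ?_) fun y y' hy hy' => by
        simp only [mul_add, map_add, hy, hy', Finset.sum_add_distrib]
      rw [of_mul_of f g rfl, action_of, act_comp, map_sum]
      exact Finset.sum_congr rfl fun i _ => by rw [action_of, action_of, of_mul_of _ _ rfl]
    rw [key]
    conv_rhs => rw [← (ℛ k h).eq]
    simp only [map_sum, TensorProduct.map_tmul, LinearMap.mul'_apply]
    rfl

theorem moduleAlgebra_act_of {H : Type v₃} [Ring H] [HopfAlgebra k H] {X : C}
    (a : ∀ n : ℤ, H →ₗ[k] Module.End k (ShiftedHom X X n)) (h₁) (h₂) (h₃) (h₄) (h : H) (n : ℤ)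
    (f : ShiftedHom X X n) :
    (moduleAlgebra a h₁ h₂ h₃ h₄).act h (of k X n f) = of k X n (a n h f) :=
  action_of a h₁ h₂ h n f

end YonedaExt

end Graded

section Smash

variable {k : Type v₁} {H : Type v₂} {E : Type v₃} [Field k] [Ring H] [HopfAlgebra k H]
    [Ring E] [Algebra k E] (α : HopfModuleAlgebra k H E) {R : Type w₁} [Ring R] [Algebra k R]

namespace SmashProduct

/-- The linear map `h ⊗ x ↦ ∑ h₁ · x ⊗ h₂`, that is `h ⊗ x ↦ (1 # h) (x # 1)`. -/
def swap : H ⊗[k] E →ₗ[k] E ⊗[k] H :=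
  TensorProduct.lift (LinearMap.mk₂ k
    (fun h x => (α.act.toLinearMap.flip x).rTensor H (Coalgebra.comul (R := k) h))
    (fun h h' x => by rw [map_add, map_add])
    (fun c h x => by rw [map_smul, map_smul])
    (fun h x x' => by rw [map_add, LinearMap.rTensor_add, LinearMap.add_apply])
    (fun c h x => by rw [map_smul, LinearMap.rTensor_smul, LinearMap.smul_apply]))

theorem swap_tmul {ι : Type*} {h : H} (𝓡 : Repr k h ι) (x : E) :
    swap α (h ⊗ₜ x) = ∑ i ∈ 𝓡.index, α.act (𝓡.left i) x ⊗ₜ 𝓡.right i := by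
  simp [swap, ← 𝓡.eq]

/-- If the antipode is bijective, `x ⊗ h` is the image of `∑ h₂ ⊗ S⁻¹(h₁) · x` under `swap`. -/
theorem swap_surjective (hS : Function.Bijective (antipode k (A := H))) :
    Function.Surjective (swap α) := by
  let S := LinearEquiv.ofBijective (antipode k (A := H)) hS
  have hs : ∀ h, S.symm (antipode k h) = h := S.symm_apply_apply
  have hs' : ∀ h, antipode k (S.symm h) = h := S.apply_symm_apply
  have hsum {h : H} (𝓡 : Repr k h (H × H)) : ∑ i ∈ 𝓡.index, comul (R := k) (𝓡.right i) *
      (S.symm (𝓡.left i) ⊗ₜ[k] (1 : H)) = 1 ⊗ₜ h :=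
    sum_comul_mul_inverse_antipode_tmul_one (s := S.symm.toLinearMap) hs hs' 𝓡
  suffices h : ∀ (x : E) (h : H), x ⊗ₜ h ∈ LinearMap.range (swap α) by
    intro t
    change t ∈ LinearMap.range (swap α)
    induction t using TensorProduct.induction_on with
    | zero => exact zero_mem _
    | add s t hs ht => exact add_mem hs ht
    | tmul x g => exact h x g
  intro x h
  let 𝓡 := ℛ k h
  refine ⟨∑ i ∈ 𝓡.index, 𝓡.right i ⊗ₜ α.act (S.symm (𝓡.left i)) x, ?_⟩
  have e := congr((α.act.toLinearMap.flip x).rTensor H $(hsum 𝓡))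
  simp only [← (ℛ k (𝓡.right _)).eq] at e
  rw [map_sum, LinearMap.rTensor_tmul, LinearMap.flip_apply, AlgHom.toLinearMap_apply, map_one,
    Module.End.one_apply] at e
  rw [map_sum, ← e]
  refine Finset.sum_congr rfl fun i _ => ?_
  rw [swap_tmul α (ℛ k (𝓡.right i))]
  simp [Finset.sum_mul]

theorem tmul_mem_part {V : Submodule k E} {x : E} (hx : x ∈ V) (h : H) :
    (x ⊗ₜ[k] h : E ⊗[k] H) ∈ part α V :=
  ⟨(⟨x, hx⟩ : V) ⊗ₜ h, rfl⟩

theorem part_le {V : Submodule k E} {W : Submodule k (SmashProduct α)}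
    (h : ∀ x ∈ V, ∀ h : H, (x ⊗ₜ[k] h : E ⊗[k] H) ∈ W) : part α V ≤ W := by
  rintro _ ⟨t, rfl⟩
  induction t using TensorProduct.induction_on with
  | zero => exact zero_mem W
  | add s t hs ht =>
    exact (congrArg (· ∈ W) (map_add (TensorProduct.map V.subtype LinearMap.id) s t)).mpr
      (add_mem hs ht)
  | tmul x g => exact h x x.2 g

theorem swap_mem_part {V : Submodule k E} (hV : ∀ (h : H), ∀ x ∈ V, α.act h x ∈ V) (h : H) {x : E}
    (hx : x ∈ V) : swap α (h ⊗ₜ x) ∈ part α V := by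
  rw [swap_tmul α (ℛ k h)]
  exact Submodule.sum_mem (part α V) fun i _ => tmul_mem_part α (hV _ x hx) _

/-- The homomorphism of algebras `x # h ↦ i(x) j(h)` out of the smash product `E # H`, for
homomorphisms `i` and `j` which satisfy the commutation rule `j(h) i(x) = ∑ i(h₁ · x) j(h₂)`. -/
def lift (i : E →ₐ[k] R) (j : H →ₐ[k] R)
    (h : ∀ (h : H) (x : E), j h * i x =
      LinearMap.mul' k R (TensorProduct.map i.toLinearMap j.toLinearMap (swap α (h ⊗ₜ x)))) :
    SmashProduct α →ₐ[k] R :=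
  AlgHom.ofLinearMap (A := SmashProduct α)
    (LinearMap.mul' k R ∘ₗ TensorProduct.map i.toLinearMap j.toLinearMap)
    (by
      change LinearMap.mul' k R (TensorProduct.map i.toLinearMap j.toLinearMap (1 ⊗ₜ 1)) = 1
      simp)
    (fun s t => by
      change LinearMap.mul' k R (TensorProduct.map i.toLinearMap j.toLinearMap (mulₗ α s t)) =
        LinearMap.mul' k R (TensorProduct.map i.toLinearMap j.toLinearMap s) *
        LinearMap.mul' k R (TensorProduct.map i.toLinearMap j.toLinearMap t)
      change E ⊗[k] H at s t
      induction s using TensorProduct.induction_on with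
      | zero => simp
      | add s s' hs hs' => simp only [map_add, LinearMap.add_apply, add_mul, hs, hs']
      | tmul x g =>
      induction t using TensorProduct.induction_on with
      | zero => simp
      | add s s' hs hs' => simp only [map_add, mul_add, hs, hs']
      | tmul y l =>
        have e := congr(i x * $(h g y) * j l)
        rw [swap_tmul α (ℛ k g)] at e
        rw [mulₗ_tmul_tmul, ← (ℛ k g).eq]
        simp only [map_sum, TensorProduct.map_tmul, LinearMap.mul'_apply, Finset.mul_sum,
          Finset.sum_mul, LinearMap.comp_apply, LinearMap.mulLeft_apply, LinearMap.mulRight_apply,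
          LinearMap.flip_apply, AlgHom.toLinearMap_apply, map_mul] at e ⊢
        simp only [mul_assoc] at e ⊢
        exact e.symm)

/-- If `h ⊗ x ↦ j(h) i(x)` is bijective, then so is the homomorphism `x # h ↦ i(x) j(h)`. -/
theorem lift_bijective (hS : Function.Bijective (antipode k (A := H)))
    (i : E →ₐ[k] R) (j : H →ₐ[k] R) (h)
    (hb : Function.Bijective
      (LinearMap.mul' k R ∘ₗ TensorProduct.map j.toLinearMap i.toLinearMap)) :
    Function.Bijective (lift α i j h) := by
  have e : (LinearMap.mul' k R ∘ₗ TensorProduct.map j.toLinearMap i.toLinearMap : H ⊗[k] E → R) =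
      lift α i j h ∘ swap α := by
    refine congrArg DFunLike.coe (TensorProduct.ext' (g := LinearMap.mul' k R ∘ₗ
      TensorProduct.map j.toLinearMap i.toLinearMap) (h := (LinearMap.mul' k R ∘ₗ
      TensorProduct.map i.toLinearMap j.toLinearMap) ∘ₗ swap α) fun g x => ?_)
    exact h g x
  rw [e] at hb
  have hs : Function.Bijective (swap α) := ⟨hb.1.of_comp, swap_surjective α hS⟩
  exact (Function.Bijective.of_comp_iff _ hs).1 hb

end SmashProduct

end Smash

/-! ### Morphisms in the derived category from K-projective complexes -/

section DerivedCategory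

variable {C : Type u} [Category.{v₁} C] [Abelian C] [HasDerivedCategory.{w₁} C]

theorem Q_map_surjective (K L : CochainComplex C ℤ) [K.IsKProjective] :
    Function.Surjective (DerivedCategory.Q.map : (K ⟶ L) → _) := fun f => by
  obtain ⟨g, hg⟩ := (CochainComplex.IsKProjective.Qh_map_bijective K
    ((HomotopyCategory.quotient _ _).obj L)).surjective
    ((DerivedCategory.quotientCompQhIso C).hom.app K ≫ f ≫
      (DerivedCategory.quotientCompQhIso C).inv.app L)
  obtain ⟨g, rfl⟩ := (HomotopyCategory.quotient _ _).map_surjective g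
  refine ⟨g, ?_⟩
  have := DerivedCategory.quotientCompQhIso_hom_naturality g
  rw [hg] at this
  simpa using this.symm

theorem homotopy_of_Q_map_eq {K L : CochainComplex C ℤ} [K.IsKProjective] {f g : K ⟶ L}
    (h : DerivedCategory.Q.map f = DerivedCategory.Q.map g) : Nonempty (Homotopy f g) := by
  refine ⟨HomotopyCategory.homotopyOfEq _ _
    ((CochainComplex.IsKProjective.Qh_map_bijective K _).injective ?_)⟩
  have hf := DerivedCategory.quotientCompQhIso_hom_naturality f
  have hg := DerivedCategory.quotientCompQhIso_hom_naturality g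
  rw [h, ← hg] at hf
  exact (cancel_mono _).1 hf

variable {k : Type v₂} [Field k] [Linear k C] {K L : CochainComplex C ℤ} {X : DerivedCategory C}

/-- The class in `Hom(X, X[n])` of a morphism of complexes `K → K[n]`, for an isomorphism `e` of `K`
with `X` in the derived category. -/
def shiftedClass (k : Type v₂) [Field k] [Linear k C] (e : DerivedCategory.Q.obj K ≅ X) (n : ℤ) :
    (K ⟶ K⟦n⟧) →ₗ[k] ShiftedHom X X n where
  toFun f := e.inv ≫ ShiftedHom.map f DerivedCategory.Q ≫ e.hom⟦n⟧'
  map_add' f g := by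
    rw [ShiftedHom.map_add, Preadditive.add_comp, Preadditive.comp_add]
  map_smul' c f := by
    rw [ShiftedHom.map_smul, Linear.smul_comp, Linear.comp_smul, RingHom.id_apply]

theorem shiftedClass_apply (e : DerivedCategory.Q.obj K ≅ X) (n : ℤ) (f : K ⟶ K⟦n⟧) :
    shiftedClass k e n f = e.inv ≫ ShiftedHom.map f DerivedCategory.Q ≫ e.hom⟦n⟧' := rfl

theorem shiftedClass_surjective [K.IsKProjective] (e : DerivedCategory.Q.obj K ≅ X) (n : ℤ) :
    Function.Surjective (shiftedClass k e n) := fun x => by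
  obtain ⟨f, hf⟩ := Q_map_surjective K (K⟦n⟧)
    (e.hom ≫ x ≫ e.inv⟦n⟧' ≫ (DerivedCategory.Q.commShiftIso n).inv.app K)
  refine ⟨f, ?_⟩
  rw [shiftedClass_apply, ShiftedHom.map, hf]
  simp [← Functor.map_comp]

theorem shiftedClass_eq_zero (e : DerivedCategory.Q.obj K ≅ X) {n : ℤ} {f : K ⟶ K⟦n⟧}
    (h : Homotopy f 0) : shiftedClass k e n f = 0 := by
  rw [shiftedClass_apply, ShiftedHom.map, DerivedCategory.Q_map_eq_of_homotopy C h]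
  simp

theorem homotopy_of_shiftedClass_eq_zero [K.IsKProjective] (e : DerivedCategory.Q.obj K ≅ X)
    {n : ℤ} {f : K ⟶ K⟦n⟧} (h : shiftedClass k e n f = 0) : Nonempty (Homotopy f 0) := by
  refine homotopy_of_Q_map_eq ?_
  rw [shiftedClass_apply, ShiftedHom.map, ← cancel_epi e.hom, e.hom_inv_id_assoc,
    Limits.comp_zero] at h
  have h' : (DerivedCategory.Q.map f ≫ (DerivedCategory.Q.commShiftIso n).hom.app K) ≫ e.hom⟦n⟧' =
    0 ≫ (DerivedCategory.Q.commShiftIso n).hom.app K ≫ e.hom⟦n⟧' := by simpa using h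
  rw [Category.assoc] at h'
  rw [(cancel_mono _).1 h', Functor.map_zero]

theorem shiftedClass_comp (e : DerivedCategory.Q.obj K ≅ X) {a b c : ℤ} (f : K ⟶ K⟦a⟧)
    (g : K ⟶ K⟦b⟧) (h : b + a = c) :
    shiftedClass k e c (ShiftedHom.comp f g h) =
      (shiftedClass k e a f).comp (shiftedClass k e b g) h := by
  rw [shiftedClass_apply, ShiftedHom.map_comp, shiftedClass_apply, shiftedClass_apply]
  simp only [ShiftedHom.comp, Category.assoc, Functor.map_comp]
  rw [← Functor.map_comp_assoc _ e.hom, e.hom_inv_id]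
  have hn := (shiftFunctorAdd' (DerivedCategory C) b a c h).inv.naturality e.hom
  dsimp only [Functor.comp_map] at hn
  rw [hn]
  simp

theorem shiftedClass_mk₀_id (e : DerivedCategory.Q.obj K ≅ X) :
    shiftedClass k e 0 (ShiftedHom.mk₀ 0 rfl (𝟙 K)) = ShiftedHom.mk₀ 0 rfl (𝟙 X) := by
  rw [shiftedClass_apply, ShiftedHom.map_mk₀, ← ShiftedHom.comp_mk₀ _ 0 rfl,
    ShiftedHom.mk₀_comp_mk₀, ← ShiftedHom.mk₀_comp 0 rfl, ShiftedHom.mk₀_comp_mk₀]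
  simp

/-- Classes can be transported between two resolutions of `X` along morphisms of complexes. -/
theorem shiftedClass_conj {e : DerivedCategory.Q.obj K ≅ X} {e' : DerivedCategory.Q.obj L ≅ X}
    {u : K ⟶ L} {v : L ⟶ K} (hu : DerivedCategory.Q.map u ≫ e'.hom = e.hom)
    (hv : DerivedCategory.Q.map v ≫ e.hom = e'.hom) {n : ℤ} (z : L ⟶ L⟦n⟧) :
    shiftedClass k e n (u ≫ z ≫ v⟦n⟧') = shiftedClass k e' n z := by
  have hu' : e.inv ≫ DerivedCategory.Q.map u = e'.inv := by
    rw [Iso.inv_comp_eq, ← hu]; simp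
  have hn : DerivedCategory.Q.map (v⟦n⟧') ≫ (DerivedCategory.Q.commShiftIso n).hom.app K =
      (DerivedCategory.Q.commShiftIso n).hom.app L ≫ (DerivedCategory.Q.map v)⟦n⟧' :=
    (DerivedCategory.Q.commShiftIso n).hom.naturality v
  rw [shiftedClass_apply, shiftedClass_apply, ShiftedHom.map, ShiftedHom.map, Functor.map_comp,
    Functor.map_comp]
  simp only [Category.assoc]
  rw [reassoc_of% hn, ← Functor.map_comp, hv, reassoc_of% hu']

end DerivedCategory

/-! ### The action on the Yoneda algebra and the smash product -/

/-- The image of a nullhomotopic morphism `K → K[n]` under an additive functor is nullhomotopic. -/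
def homotopyShiftedHomMap {C D : Type*} [Category* C] [Category* D] [Preadditive C] [Preadditive D]
    (F : C ⥤ D) [F.Additive] {K L : CochainComplex C ℤ} {n : ℤ} {f : K ⟶ L⟦n⟧}
    (t : Homotopy f 0) :
    Homotopy (ShiftedHom.map f (F.mapHomologicalComplex (ComplexShape.up ℤ))) 0 :=
  ((F.mapHomotopy t).compRight (((F.mapHomologicalComplex (ComplexShape.up ℤ)).commShiftIso n).hom.app
    L)).trans (Homotopy.ofEq (by simp))

namespace ComoduleAlgebra

variable {k : Type v₁} {H : Type v₂} {A : Type u} [Field k] [Ring H] [HopfAlgebra k H]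
    [Ring A] [Algebra k A] (ρ : ComoduleAlgebra k H A) (hρ : ρ.IsGalois)
    {P : CochainComplex (ModuleCat.{u} Aᵐᵒᵖ) ℤ}

section Action

variable [HasDerivedCategory.{w₂} (ModuleCat.{u} (ρ.coinvariants)ᵐᵒᵖ)]
    [(ρ.resComplex P).IsKProjective] {X : DerivedCategory (ModuleCat.{u} (ρ.coinvariants)ᵐᵒᵖ)}
    (e : DerivedCategory.Q.obj (ρ.resComplex P) ≅ X)

/-- A representative of an element of `Hom(X, X[n])`, depending linearly on it. -/
def representative (n : ℤ) :
    ShiftedHom X X n →ₗ[k] (ρ.resComplex P ⟶ (ρ.resComplex P)⟦n⟧) :=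
  (LinearMap.exists_rightInverse_of_surjective (shiftedClass k e n)
    (LinearMap.range_eq_top.2 (shiftedClass_surjective e n))).choose

theorem shiftedClass_representative {n : ℤ} (x : ShiftedHom X X n) :
    shiftedClass k e n (ρ.representative e n x) = x :=
  LinearMap.congr_fun (LinearMap.exists_rightInverse_of_surjective (shiftedClass k e n)
    (LinearMap.range_eq_top.2 (shiftedClass_surjective e n))).choose_spec x

theorem homotopy_representative {n : ℤ} (f : ρ.resComplex P ⟶ (ρ.resComplex P)⟦n⟧) :
    Nonempty (Homotopy (ρ.representative e n (shiftedClass k e n f) - f) 0) :=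
  homotopy_of_shiftedClass_eq_zero (k := k) e
    (by rw [map_sub, shiftedClass_representative, sub_self])

/-- The action of `H` on `Hom(X, X[n])` induced by the action on morphisms of complexes. -/
def shiftedAct (n : ℤ) : H →ₗ[k] Module.End k (ShiftedHom X X n) :=
  LinearMap.mk₂ k (fun h x => shiftedClass k e n (ρ.twistComplexₗ hρ P P n (antipode k h)
      (ρ.representative e n x)))
    (fun h h' x => by simp only [map_add, LinearMap.add_apply])
    (fun c h x => by simp only [map_smul, LinearMap.smul_apply])
    (fun h x x' => by simp only [map_add])
    (fun c h x => by simp only [map_smul])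

theorem shiftedAct_shiftedClass {n : ℤ} (h : H) (f : ρ.resComplex P ⟶ (ρ.resComplex P)⟦n⟧) :
    ρ.shiftedAct hρ e n h (shiftedClass k e n f) =
      shiftedClass k e n (ρ.twistComplex hρ (antipode k h) f) := by
  obtain ⟨t⟩ := ρ.homotopy_representative e f
  have := shiftedClass_eq_zero (k := k) e (ρ.homotopyTwistComplex hρ (antipode k h) t)
  rw [← twistComplexₗ_apply, map_sub, map_sub, sub_eq_zero] at this
  exact this

/-- The `H`-module algebra structure on `Ext^*(X, X)`, for an object `X` of `D(B)` which is
isomorphic to the restriction of a complex `P` of `A`-modules. -/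
def extAction : HopfModuleAlgebra k H (YonedaExt X) :=
  YonedaExt.moduleAlgebra (ρ.shiftedAct hρ e)
    (fun n => LinearMap.ext fun x => by
      obtain ⟨f, rfl⟩ := shiftedClass_surjective (k := k) e n x
      rw [shiftedAct_shiftedClass, antipode_one, twistComplex_one, Module.End.one_apply])
    (fun n g h => LinearMap.ext fun x => by
      obtain ⟨f, rfl⟩ := shiftedClass_surjective (k := k) e n x
      rw [Module.End.mul_apply, shiftedAct_shiftedClass, shiftedAct_shiftedClass,
        shiftedAct_shiftedClass, twistComplex_twistComplex, antipode_mul_antidistrib])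
    (fun h => by
      rw [← shiftedClass_mk₀_id (k := k) e, shiftedAct_shiftedClass, twistComplex_mk₀_id, map_smul,
        counit_antipode])
    (fun m n x y h => by
      obtain ⟨f, rfl⟩ := shiftedClass_surjective (k := k) e m x
      obtain ⟨g, rfl⟩ := shiftedClass_surjective (k := k) e n y
      -- the antipode reverses the comultiplication
      let 𝓡 : Repr k (antipode k h) (H × H) :=
        { index := (ℛ k h).index
          left := fun i => antipode k ((ℛ k h).right i)
          right := fun i => antipode k ((ℛ k h).left i)
          eq := (comul_antipode (ℛ k h)).symm }
      rw [← shiftedClass_comp, shiftedAct_shiftedClass, twistComplex_comp ρ hρ _ _ _ 𝓡, map_sum]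
      refine Finset.sum_congr rfl fun i _ => ?_
      rw [shiftedClass_comp, shiftedAct_shiftedClass, shiftedAct_shiftedClass])

theorem extAction_of (h : H) {n : ℤ} (f : ρ.resComplex P ⟶ (ρ.resComplex P)⟦n⟧) :
    (ρ.extAction hρ e).act h (YonedaExt.of k X n (shiftedClass k e n f)) =
      YonedaExt.of k X n (shiftedClass k e n (ρ.twistComplex hρ (antipode k h) f)) := by
  rw [extAction, YonedaExt.moduleAlgebra_act_of, shiftedAct_shiftedClass]

theorem extAction_mem_deg (h : H) (n : ℤ) {x : YonedaExt X} (hx : x ∈ YonedaExt.deg k X n) :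
    (ρ.extAction hρ e).act h x ∈ YonedaExt.deg k X n := by
  obtain ⟨x, rfl⟩ := hx
  obtain ⟨f, rfl⟩ := shiftedClass_surjective (k := k) e n x
  exact ⟨_, (ρ.extAction_of hρ e h f).symm⟩

end Action

section SmashProduct

variable [HasDerivedCategory.{w₁} (ModuleCat.{u} Aᵐᵒᵖ)]
    [HasDerivedCategory.{w₂} (ModuleCat.{u} (ρ.coinvariants)ᵐᵒᵖ)]
    [(ρ.resComplex P).IsKProjective] {X : DerivedCategory (ModuleCat.{u} (ρ.coinvariants)ᵐᵒᵖ)}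
    (e : DerivedCategory.Q.obj (ρ.resComplex P) ≅ X)
    {T : DerivedCategory (ModuleCat.{u} Aᵐᵒᵖ)}
    (e' : DerivedCategory.Q.obj (ρ.indComplex (ρ.resComplex P)) ≅ T)

/-- `indShifted` as a linear map. -/
def indShiftedₗ (P : CochainComplex (ModuleCat.{u} Aᵐᵒᵖ) ℤ) (n : ℤ) :
    (ρ.resComplex P ⟶ (ρ.resComplex P)⟦n⟧) →ₗ[k]
      (ρ.indComplex (ρ.resComplex P) ⟶ (ρ.indComplex (ρ.resComplex P))⟦n⟧) where
  toFun := ρ.indShifted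
  map_add' f g := ShiftedHom.map_add f g _
  map_smul' c f := ShiftedHom.map_smul c f _

/-- `component` as a linear map. -/
def componentₗ (P : CochainComplex (ModuleCat.{u} Aᵐᵒᵖ) ℤ) (n : ℤ) (ξ : H →ₗ[k] k) :
    (ρ.indComplex (ρ.resComplex P) ⟶ (ρ.indComplex (ρ.resComplex P))⟦n⟧) →ₗ[k]
      (ρ.resComplex P ⟶ (ρ.resComplex P)⟦n⟧) where
  toFun := ρ.component ξ
  map_add' f g := by
    rw [component, resShifted, ShiftedHom.map_add, Preadditive.add_comp, Preadditive.comp_add]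
    rfl
  map_smul' c f := by
    rw [component, resShifted, ShiftedHom.map_smul, Linear.smul_comp, Linear.comp_smul]
    rfl

/-- Induction `Hom(X, X[n]) → Hom(T, T[n])`, where `T` is isomorphic to `P ⊗_B A`. -/
def shiftedInd (n : ℤ) : ShiftedHom X X n →ₗ[k] ShiftedHom T T n :=
  shiftedClass k e' n ∘ₗ ρ.indShiftedₗ P n ∘ₗ ρ.representative e n

theorem shiftedInd_shiftedClass {n : ℤ} (f : ρ.resComplex P ⟶ (ρ.resComplex P)⟦n⟧) :
    ρ.shiftedInd e e' n (shiftedClass k e n f) = shiftedClass k e' n (ρ.indShifted f) := by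
  obtain ⟨t⟩ := ρ.homotopy_representative e f
  have := shiftedClass_eq_zero (k := k) e' (homotopyShiftedHomMap ρ.ind t)
  change shiftedClass k e' n (ρ.indShiftedₗ P n _) = 0 at this
  rw [map_sub, map_sub, sub_eq_zero] at this
  exact this

/-- Induction, as a homomorphism `Ext_B^*(X, X) → Ext_A^*(T, T)` of algebras. -/
def extInd : YonedaExt X →ₐ[k] YonedaExt T :=
  YonedaExt.toAlgHom (fun n => YonedaExt.of k T n ∘ₗ ρ.shiftedInd e e' n)
    (by
      rw [← shiftedClass_mk₀_id (k := k) e, LinearMap.comp_apply, shiftedInd_shiftedClass,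
        indShifted, ShiftedHom.map_mk₀, CategoryTheory.Functor.map_id]
      exact (congrArg (YonedaExt.of k T 0) (shiftedClass_mk₀_id (k := k) e')).trans
        YonedaExt.of_one)
    (fun a b x y => by
      obtain ⟨f, rfl⟩ := shiftedClass_surjective (k := k) e a x
      obtain ⟨g, rfl⟩ := shiftedClass_surjective (k := k) e b y
      rw [← shiftedClass_comp, LinearMap.comp_apply, LinearMap.comp_apply, LinearMap.comp_apply,
        shiftedInd_shiftedClass, shiftedInd_shiftedClass, shiftedInd_shiftedClass, indShifted,
        ShiftedHom.map_comp, shiftedClass_comp, YonedaExt.of_mul_of _ _ rfl])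

theorem extInd_of {n : ℤ} (f : ρ.resComplex P ⟶ (ρ.resComplex P)⟦n⟧) :
    ρ.extInd e e' (YonedaExt.of k X n (shiftedClass k e n f)) =
      YonedaExt.of k T n (shiftedClass k e' n (ρ.indShifted f)) := by
  rw [extInd, YonedaExt.toAlgHom_of, LinearMap.comp_apply, shiftedInd_shiftedClass]

/-- The homomorphism `H → Ext_A^0(T, T)` of algebras, given by left multiplication on the factor `H`
of `P ⊗_B A ≅ P ⊗ H`. -/
def extLeftMul : H →ₐ[k] YonedaExt T :=
  AlgHom.ofLinearMap
    (YonedaExt.of k T 0 ∘ₗ shiftedClass k e' 0 ∘ₗ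
      { toFun := fun h => ShiftedHom.mk₀ 0 rfl (ρ.leftMulComplex hρ P h)
        map_add' := fun g h => by rw [leftMulComplex_add, ShiftedHom.mk₀_add]
        map_smul' := fun c h => by
          rw [leftMulComplex_smul, ShiftedHom.mk₀_smul, RingHom.id_apply] })
    (by
      change YonedaExt.of k T 0 (shiftedClass k e' 0 (ShiftedHom.mk₀ 0 rfl _)) = 1
      rw [leftMulComplex_one, shiftedClass_mk₀_id, YonedaExt.of_one])
    (fun g h => by
      change YonedaExt.of k T 0 (shiftedClass k e' 0 (ShiftedHom.mk₀ 0 rfl _)) =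
        YonedaExt.of k T 0 (shiftedClass k e' 0 (ShiftedHom.mk₀ 0 rfl _)) *
          YonedaExt.of k T 0 (shiftedClass k e' 0 (ShiftedHom.mk₀ 0 rfl _))
      rw [YonedaExt.of_mul_of _ _ (add_zero 0), ← shiftedClass_comp, ShiftedHom.mk₀_comp_mk₀,
        leftMulComplex_comp])

omit [HasDerivedCategory.{w₂} (ModuleCat.{u} (ρ.coinvariants)ᵐᵒᵖ)]
    [(ρ.resComplex P).IsKProjective] in
theorem extLeftMul_apply (h : H) : ρ.extLeftMul hρ e' h =
    YonedaExt.of k T 0 (shiftedClass k e' 0 (ShiftedHom.mk₀ 0 rfl (ρ.leftMulComplex hρ P h))) :=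
  rfl

theorem extLeftMul_mul_extInd (h : H) {n : ℤ} (f : ρ.resComplex P ⟶ (ρ.resComplex P)⟦n⟧) :
    ρ.extLeftMul hρ e' h * ρ.extInd e e' (YonedaExt.of k X n (shiftedClass k e n f)) =
      YonedaExt.of k T n (shiftedClass k e' n
        (ρ.indShifted f ≫ (ρ.leftMulComplex hρ P h)⟦n⟧')) := by
  rw [extInd_of, extLeftMul_apply, YonedaExt.of_mul_of _ _ (zero_add n), ← shiftedClass_comp,
    ShiftedHom.comp_mk₀]

theorem extInd_mul_extLeftMul (h : H) {n : ℤ} (f : ρ.resComplex P ⟶ (ρ.resComplex P)⟦n⟧) :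
    ρ.extInd e e' (YonedaExt.of k X n (shiftedClass k e n f)) * ρ.extLeftMul hρ e' h =
      YonedaExt.of k T n (shiftedClass k e' n
        (ρ.leftMulComplex hρ P h ≫ ρ.indShifted f)) := by
  rw [extInd_of, extLeftMul_apply, YonedaExt.of_mul_of _ _ (add_zero n), ← shiftedClass_comp,
    ShiftedHom.mk₀_comp]

theorem extLeftMul_mul_extInd_eq (h : H) (x : YonedaExt X) :
    ρ.extLeftMul hρ e' h * ρ.extInd e e' x = LinearMap.mul' k (YonedaExt T)
      (TensorProduct.map (ρ.extInd e e').toLinearMap (ρ.extLeftMul hρ e').toLinearMap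
        (SmashProduct.swap (ρ.extAction hρ e) (h ⊗ₜ x))) := by
  rw [SmashProduct.swap_tmul _ (ℛ k h)]
  refine YonedaExt.induction_on k x (by simp) (fun n x => ?_) fun x y hx hy => by
    simp only [map_add, mul_add, hx, hy, TensorProduct.add_tmul, Finset.sum_add_distrib]
  obtain ⟨f, rfl⟩ := shiftedClass_surjective (k := k) e n x
  rw [extLeftMul_mul_extInd, indShifted_comp_leftMulComplex ρ hρ f (ℛ k h), map_sum, map_sum,
    map_sum, map_sum]
  refine Finset.sum_congr rfl fun i _ => ?_
  rw [TensorProduct.map_tmul, LinearMap.mul'_apply, extAction_of]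
  exact (ρ.extInd_mul_extLeftMul hρ e e' _ _).symm

section

variable [(ρ.indComplex (ρ.resComplex P)).IsKProjective]

/-- The map `Hom(T, T[n]) → Hom(X, X[n])` induced by `component ξ`. -/
def shiftedComponent (ξ : H →ₗ[k] k) (n : ℤ) : ShiftedHom T T n →ₗ[k] ShiftedHom X X n :=
  shiftedClass k e n ∘ₗ ρ.componentₗ P n ξ ∘ₗ
    (LinearMap.exists_rightInverse_of_surjective (shiftedClass k e' n)
      (LinearMap.range_eq_top.2 (shiftedClass_surjective e' n))).choose

omit [(ρ.resComplex P).IsKProjective] in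
theorem shiftedComponent_shiftedClass (ξ : H →ₗ[k] k) {n : ℤ}
    (t : ρ.indComplex (ρ.resComplex P) ⟶ (ρ.indComplex (ρ.resComplex P))⟦n⟧) :
    ρ.shiftedComponent e e' ξ n (shiftedClass k e' n t) =
      shiftedClass k e n (ρ.component ξ t) := by
  let s := (LinearMap.exists_rightInverse_of_surjective (shiftedClass k e' n)
    (LinearMap.range_eq_top.2 (shiftedClass_surjective e' n))).choose
  have hs : ∀ x, shiftedClass k e' n (s x) = x := fun x => LinearMap.congr_fun
    (LinearMap.exists_rightInverse_of_surjective (shiftedClass k e' n)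
      (LinearMap.range_eq_top.2 (shiftedClass_surjective e' n))).choose_spec x
  obtain ⟨r⟩ := homotopy_of_shiftedClass_eq_zero (k := k) e'
    (f := s (shiftedClass k e' n t) - t) (by rw [map_sub, hs, sub_self])
  have := shiftedClass_eq_zero (k := k) e
    ((((homotopyShiftedHomMap ρ.res r).compRight ((ρ.contractComplex P ξ)⟦n⟧')).compLeft
      (ρ.unitComplex P)).trans (Homotopy.ofEq (by simp)))
  change shiftedClass k e n (ρ.componentₗ P n ξ _) = 0 at this
  rw [map_sub, map_sub, sub_eq_zero] at this
  exact this

/-- As a vector space, `Ext_A^*(T, T)` is the tensor product of its subalgebras `H` and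
`Ext_B^*(X, X)`: the inverse of the multiplication map is `t ↦ ∑ bᵢ ⊗ tᵢ` for a basis `bᵢ` of `H`, where
`tᵢ` is the component of `t` with respect to the `i`-th coordinate. -/
theorem extLeftMul_extInd_bijective [Module.Finite k H] : Function.Bijective
    (LinearMap.mul' k (YonedaExt T) ∘ₗ
      TensorProduct.map (ρ.extLeftMul hρ e').toLinearMap (ρ.extInd e e').toLinearMap) := by
  let b := Module.finBasis k H
  let Ψ : YonedaExt T →ₗ[k] H ⊗[k] YonedaExt X := YonedaExt.toModule fun n =>
    ∑ i, TensorProduct.mk k H (YonedaExt X) (b i) ∘ₗ YonedaExt.of k X n ∘ₗ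
      ρ.shiftedComponent e e' (b.coord i) n
  have hΨ {n : ℤ} (t : ρ.indComplex (ρ.resComplex P) ⟶ (ρ.indComplex (ρ.resComplex P))⟦n⟧) :
      Ψ (YonedaExt.of k T n (shiftedClass k e' n t)) = ∑ i, b i ⊗ₜ[k]
        YonedaExt.of k X n (shiftedClass k e n (ρ.component (b.coord i) t)) := by
    simp [Ψ, YonedaExt.toModule_of, shiftedComponent_shiftedClass]
  refine Function.bijective_iff_has_inverse.2 ⟨Ψ, fun y => ?_, fun x => ?_⟩
  · refine LinearMap.congr_fun (f := Ψ ∘ₗ _) (g := LinearMap.id)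
      (TensorProduct.ext (LinearMap.ext fun h => YonedaExt.linearMap_ext fun n x => ?_)) y
    obtain ⟨f, rfl⟩ := shiftedClass_surjective (k := k) e n x
    change Ψ (ρ.extLeftMul hρ e' h *
      ρ.extInd e e' (YonedaExt.of k X n (shiftedClass k e n f))) = h ⊗ₜ _
    rw [extLeftMul_mul_extInd, hΨ]
    simp only [component_indShifted, map_smul, ← TensorProduct.smul_tmul, ← TensorProduct.sum_tmul,
      Module.Basis.coord_apply, b.sum_repr]
  · refine YonedaExt.induction_on k x (by simp) (fun n x => ?_) fun x y hx hy => by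
      rw [map_add, map_add, hx, hy]
    obtain ⟨t, rfl⟩ := shiftedClass_surjective (k := k) e' n x
    rw [hΨ, map_sum]
    conv_rhs => rw [← ρ.sum_indShifted_component hρ b t, map_sum, map_sum]
    exact Finset.sum_congr rfl fun i _ => ρ.extLeftMul_mul_extInd hρ e e' _ _

/-- `Ext_A^*(T, T)` is the smash product of `Ext_B^*(X, X)` and `H`. -/
theorem exists_algEquiv_smashProduct [Module.Finite k H]
    (hS : Function.Bijective (antipode k (A := H)))
    (e' : DerivedCategory.Q.obj (ρ.indComplex (ρ.resComplex P)) ≅ T) :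
    ∃ Φ : YonedaExt T ≃ₐ[k] SmashProduct (ρ.extAction hρ e),
      ∀ n : ℤ, (YonedaExt.deg k T n).map Φ.toLinearMap =
        SmashProduct.part (ρ.extAction hρ e) (YonedaExt.deg k X n) := by
  let F := SmashProduct.lift (ρ.extAction hρ e) (ρ.extInd e e') (ρ.extLeftMul hρ e')
    (ρ.extLeftMul_mul_extInd_eq hρ e e')
  have hF : Function.Bijective F := SmashProduct.lift_bijective _ hS _ _ _
    (ρ.extLeftMul_extInd_bijective hρ e e')
  let Φ := AlgEquiv.ofBijective F hF
  suffices h : ∀ n, (SmashProduct.part (ρ.extAction hρ e) (YonedaExt.deg k X n)).map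
      F.toLinearMap = YonedaExt.deg k T n by
    refine ⟨Φ.symm, fun n => ?_⟩
    rw [← h n, ← Submodule.map_comp]
    have : Φ.symm.toLinearMap ∘ₗ F.toLinearMap = LinearMap.id :=
      LinearMap.ext fun t => Φ.symm_apply_apply t
    rw [this, Submodule.map_id]
  intro n
  refine le_antisymm (Submodule.map_le_iff_le_comap.2 (SmashProduct.part_le _ ?_)) ?_
  · rintro _ ⟨x, rfl⟩ h
    obtain ⟨f, rfl⟩ := shiftedClass_surjective (k := k) e n x
    refine ⟨_, (Eq.trans ?_ (ρ.extInd_mul_extLeftMul hρ e e' h f)).symm⟩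
    rfl
  · rintro _ ⟨x, rfl⟩
    obtain ⟨t, rfl⟩ := shiftedClass_surjective (k := k) e' n x
    rw [← ρ.sum_indShifted_component hρ (Module.finBasis k H) t, map_sum, map_sum]
    refine sum_mem fun i _ => ?_
    rw [← ρ.extLeftMul_mul_extInd hρ e e', extLeftMul_mul_extInd_eq]
    exact ⟨_, SmashProduct.swap_mem_part _ (fun h x hx => ρ.extAction_mem_deg hρ e h n hx) _
      ⟨_, rfl⟩, rfl⟩

end

end SmashProduct

end ComoduleAlgebra

/-! ### Resolutions and derived tensor products -/

namespace ComoduleAlgebra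

variable {k : Type v₁} {H : Type v₂} {A : Type u} [Field k] [Ring H] [HopfAlgebra k H]
    [Ring A] [Algebra k A] (ρ : ComoduleAlgebra k H A) (hρ : ρ.IsGalois)
    {P P' : CochainComplex (ModuleCat.{u} Aᵐᵒᵖ) ℤ}

theorem isStrictlyLE_resComplex (d : ℤ) [P.IsStrictlyLE d] : (ρ.resComplex P).IsStrictlyLE d := by
  rw [CochainComplex.isStrictlyLE_iff]
  exact fun i hi => ρ.res.map_isZero (P.isZero_of_isStrictlyLE d i hi)

theorem isStrictlyLE_indComplex {Q : CochainComplex (ModuleCat.{u} (ρ.coinvariants)ᵐᵒᵖ) ℤ} (d : ℤ)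
    [Q.IsStrictlyLE d] : (ρ.indComplex Q).IsStrictlyLE d := by
  rw [CochainComplex.isStrictlyLE_iff]
  exact fun i hi => ρ.ind.map_isZero (Q.isZero_of_isStrictlyLE d i hi)

include hρ in
theorem isKProjective_resComplex [Module.Finite k H]
    (hS : Function.Bijective (antipode k (A := H))) (d : ℤ) [P.IsStrictlyLE d]
    [∀ i, Projective (P.X i)] : (ρ.resComplex P).IsKProjective := by
  have := ρ.isStrictlyLE_resComplex (P := P) d
  have (i : ℤ) : Projective ((ρ.resComplex P).X i) := ρ.projective_res hρ hS (P.X i)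
  exact CochainComplex.isKProjective_of_projective _ d

include hρ in
theorem isKProjective_indComplex_resComplex [Module.Finite k H]
    (hS : Function.Bijective (antipode k (A := H))) (d : ℤ) [P.IsStrictlyLE d]
    [∀ i, Projective (P.X i)] : (ρ.indComplex (ρ.resComplex P)).IsKProjective := by
  have := ρ.isStrictlyLE_resComplex (P := P) d
  have := ρ.isStrictlyLE_indComplex (Q := ρ.resComplex P) d
  have (i : ℤ) : Projective ((ρ.indComplex (ρ.resComplex P)).X i) := by
    have := ρ.projective_res hρ hS (P.X i)
    exact projective_induced ρ.inclOp (ρ.res.obj (P.X i))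
  exact CochainComplex.isKProjective_of_projective _ d

variable [HasDerivedCategory.{w₁} (ModuleCat.{u} Aᵐᵒᵖ)]
    [HasDerivedCategory.{w₂} (ModuleCat.{u} (ρ.coinvariants)ᵐᵒᵖ)]

/-- The isomorphism in `D(B)` obtained by restriction from an isomorphism in `D(A)`. -/
abbrev resIso {M : DerivedCategory (ModuleCat.{u} Aᵐᵒᵖ)} (e : DerivedCategory.Q.obj P ≅ M) :
    DerivedCategory.Q.obj (ρ.resComplex P) ≅ ρ.dRes.obj M :=
  (ρ.res.mapDerivedCategoryFactors.app P).symm ≪≫ ρ.dRes.mapIso e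

theorem Q_map_res_map_comp_resIso {M : DerivedCategory (ModuleCat.{u} Aᵐᵒᵖ)}
    {e : DerivedCategory.Q.obj P ≅ M} {e' : DerivedCategory.Q.obj P' ≅ M} {f : P ⟶ P'}
    (hf : DerivedCategory.Q.map f ≫ e'.hom = e.hom) :
    DerivedCategory.Q.map ((ρ.res.mapHomologicalComplex (ComplexShape.up ℤ)).map f) ≫
      (ρ.resIso e').hom = (ρ.resIso e).hom := by
  have h := ρ.res.mapDerivedCategoryFactors.inv.naturality f
  dsimp only [Functor.comp_map] at h
  simp only [resIso, Iso.trans_hom, Iso.symm_hom, Iso.app_inv, Functor.mapIso_hom]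
  rw [reassoc_of% h, ← Functor.map_comp, hf]

theorem cocycleClass_eq {M : DerivedCategory (ModuleCat.{u} Aᵐᵒᵖ)}
    (e : DerivedCategory.Q.obj P ≅ M) {n : ℤ}
    (z : CochainComplex.HomComplex.Cocycle (ρ.resComplex P) (ρ.resComplex P) n) :
    ρ.cocycleClass e z = shiftedClass k (ρ.resIso e) n
      (CochainComplex.HomComplex.Cocycle.equivHomShift.symm z) := rfl

/-- The action constructed from one resolution `P` is natural, since it can be compared to the one
given by another resolution `P'` through `A`-linear morphisms between `P` and `P'`. -/
theorem isNaturalAction_extAction {M : DerivedCategory (ModuleCat.{u} Aᵐᵒᵖ)} [P.IsKProjective]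
    [(ρ.resComplex P).IsKProjective] (e : DerivedCategory.Q.obj P ≅ M) :
    ρ.IsNaturalAction hρ M (ρ.extAction hρ (ρ.resIso e)) := by
  rintro P' ⟨d, _⟩ hP' e' n h z
  have := CochainComplex.isKProjective_of_projective P' d
  obtain ⟨a, ha⟩ := Q_map_surjective P P' (e.hom ≫ e'.inv)
  obtain ⟨b, hb⟩ := Q_map_surjective P' P (e'.hom ≫ e.inv)
  have hz (z : CochainComplex.HomComplex.Cocycle (ρ.resComplex P') (ρ.resComplex P') n) :=
    shiftedClass_conj (k := k) (ρ.Q_map_res_map_comp_resIso (e := e) (e' := e') (f := a)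
      (by simp [ha])) (ρ.Q_map_res_map_comp_resIso (e := e') (e' := e) (f := b) (by simp [hb]))
      (CochainComplex.HomComplex.Cocycle.equivHomShift.symm z)
  rw [cocycleClass_eq, cocycleClass_eq, ← hz, ← hz, extAction_of, twistComplex_res_map_comp,
    equivHomShift_symm_cocycleAct]

/-- Two natural actions agree, as all classes are represented by cocycles of one resolution. -/
theorem IsNaturalAction.eq {M : DerivedCategory (ModuleCat.{u} Aᵐᵒᵖ)} {d : ℤ} [P.IsStrictlyLE d]
    [∀ i, Projective (P.X i)] [(ρ.resComplex P).IsKProjective] (e : DerivedCategory.Q.obj P ≅ M)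
    {α α' : HopfModuleAlgebra k H (YonedaExt (ρ.dRes.obj M))}
    (hα : ρ.IsNaturalAction hρ M α) (hα' : ρ.IsNaturalAction hρ M α') : α = α' := by
  have h : α.act = α'.act := AlgHom.ext fun h => YonedaExt.linearMap_ext fun n x => by
    obtain ⟨f, rfl⟩ := shiftedClass_surjective (k := k) (ρ.resIso e) n x
    obtain ⟨z, rfl⟩ := CochainComplex.HomComplex.Cocycle.equivHomShift.symm.surjective f
    rw [← cocycleClass_eq, hα P ⟨d, inferInstance⟩ inferInstance e,
      hα' P ⟨d, inferInstance⟩ inferInstance e]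
  cases α
  cases α'
  congr

/-- The derived tensor product can be computed with the resolution `P`, restricted to `B`. -/
theorem IsDerivedTensor.nonempty_iso [(ρ.resComplex P).IsKProjective]
    {X : DerivedCategory (ModuleCat.{u} (ρ.coinvariants)ᵐᵒᵖ)}
    (e : DerivedCategory.Q.obj (ρ.resComplex P) ≅ X) {T : DerivedCategory (ModuleCat.{u} Aᵐᵒᵖ)}
    (hT : ρ.IsDerivedTensor X T) :
    Nonempty (DerivedCategory.Q.obj (ρ.indComplex (ρ.resComplex P)) ≅ T) := by
  obtain ⟨Q, ⟨d, _⟩, hQ, ⟨e₁⟩, ⟨e₂⟩⟩ := hT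
  have := CochainComplex.isKProjective_of_projective Q d
  obtain ⟨a, ha⟩ := Q_map_surjective (ρ.resComplex P) Q (e.hom ≫ e₁.inv)
  obtain ⟨b, hb⟩ := Q_map_surjective Q (ρ.resComplex P) (e₁.hom ≫ e.inv)
  obtain ⟨t⟩ := homotopy_of_Q_map_eq (f := a ≫ b) (g := 𝟙 _) (by simp [ha, hb])
  obtain ⟨s⟩ := homotopy_of_Q_map_eq (f := b ≫ a) (g := 𝟙 _) (by simp [ha, hb])
  have ht := DerivedCategory.Q_map_eq_of_homotopy _ (ρ.ind.mapHomotopy t)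
  have hs := DerivedCategory.Q_map_eq_of_homotopy _ (ρ.ind.mapHomotopy s)
  rw [Functor.map_comp, Functor.map_comp, CategoryTheory.Functor.map_id,
    CategoryTheory.Functor.map_id] at ht hs
  exact ⟨{ hom := _, inv := _, hom_inv_id := ht, inv_hom_id := hs } ≪≫ e₂⟩

end ComoduleAlgebra

end

end HopfGalois

open CategoryTheory HopfGalois in
theorem theorem2p1 {k : Type v₁} {H : Type v₂} {A : Type u}
    [Field k] [Ring H] [HopfAlgebra k H] [Module.Finite k H] [Ring A] [Algebra k A]
    (hS : Function.Bijective (HopfAlgebra.antipode k (A := H)))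
    (ρ : ComoduleAlgebra k H A) (hρ : ρ.IsGalois)
    [HasDerivedCategory.{w₁} (ModuleCat.{u} Aᵐᵒᵖ)]
    [HasDerivedCategory.{w₂} (ModuleCat.{u} (ρ.coinvariants)ᵐᵒᵖ)]
    (M : DerivedCategory (ModuleCat.{u} Aᵐᵒᵖ)) (hM : DerivedCategory.TStructure.t.minus M) :
    ∃ α : HopfModuleAlgebra k H (YonedaExt (ρ.dRes.obj M)),
      ρ.IsNaturalAction hρ M α ∧
      (∀ α' : HopfModuleAlgebra k H (YonedaExt (ρ.dRes.obj M)),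
        ρ.IsNaturalAction hρ M α' → α' = α) ∧
      (∀ (h : H) (i : ℤ), ∀ x ∈ YonedaExt.deg k (ρ.dRes.obj M) i,
        α.act h x ∈ YonedaExt.deg k (ρ.dRes.obj M) i) ∧
      ∀ T : DerivedCategory (ModuleCat.{u} Aᵐᵒᵖ), ρ.IsDerivedTensor (ρ.dRes.obj M) T →
        ∃ e : YonedaExt T ≃ₐ[k] SmashProduct α,
          ∀ i : ℤ, (YonedaExt.deg k T i).map e.toLinearMap =
            SmashProduct.part α (YonedaExt.deg k (ρ.dRes.obj M) i) := by
  obtain ⟨d, hd⟩ := hM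
  have : M.IsLE d := hd
  obtain ⟨K, _, ⟨e⟩⟩ := M.exists_iso_Q_obj_of_isLE d
  obtain ⟨P, f, _, hP, _⟩ := exists_projective K d
  let e : DerivedCategory.Q.obj P ≅ M := asIso (DerivedCategory.Q.map f) ≪≫ e.symm
  have := CochainComplex.isKProjective_of_projective P d
  have := ρ.isKProjective_resComplex (P := P) hρ hS d
  have := ρ.isKProjective_indComplex_resComplex (P := P) hρ hS d
  have hα := ρ.isNaturalAction_extAction hρ e
  refine ⟨_, hα, fun α' hα' => hα'.eq ρ hρ (d := d) e hα,
    fun h i x hx => ρ.extAction_mem_deg hρ _ h i hx, fun T hT => ?_⟩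
  obtain ⟨e'⟩ := hT.nonempty_iso ρ (ρ.resIso e)
  exact ρ.exists_algEquiv_smashProduct hρ _ hS e'
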